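/- Let $\mathcal O$ be a complete discrete valuation ring whose residue field $k$ is algebraically closed of characteristic zero, with a coefficient field $k\hookrightarrow\mathcal O$ fixed (so $\mathcal O\cong k[[t]]$), with maximal ideal $\mathfrak m$, and put $\mathbb D=\operatorname{Spec}\mathcal O$. Let $\mathcal X$ be a reduced separated scheme, flat and of finite type over $\mathbb D$, with reduced closed fiber and of pure relative dimension $d$. Write $\mathcal X_\infty$ for its set of sections over $\mathbb D$, $\mathcal X_n$ for its set of sections up to order $n$, i.e. of $\mathbb D$-morphisms $\operatorname{Spec}(\mathcal O/\mathfrak m^{n+1})\to\mathcal X$, regarded as the $k$-variety obtained by Weil restriction, and $\pi_n:\mathcal X_\infty\to\mathcal X_n$ for the projection. Let $K_0(\mathcal V_k)$ be the Grothendieck ring of $k$-varieties, $\mathbb L=[\mathbb A^1]$, $M_k=K_0(\mathcal V_k)[\mathbb L^{-1}]$, and for $m\in\mathbb Z$ let $F_mM_k\subset M_k$ be the subgroup spanned by the elements $[Z]\mathbb L^{-r}$ with $\dim Z\le m+r$. Let $\hat M_k=\varprojlim_{m\to-\infty}M_k/F_mM_k$, with the inverse limit topology (each $M_k/F_mM_k$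 being discrete). A subset $A\subset\mathcal X_\infty$ is *stable* if for some $n\in\mathbb N$ the set $\pi_n(A)$ is constructible in $\mathcal X_n$, $A=\pi_n^{-1}\pi_n(A)$, and for all $m\ge n$ the projection $\pi_{m+1}(A)\to\pi_m(A)$ is a piecewise trivial fibration (trivial over each member of a finite decomposition into subvarieties) with fiber $\mathbb A^d$. For such $A$ and $n$ put $\dim A=\dim\pi_n(A)-nd$ (with $\dim\emptyset=-\infty$), and let $\mu_{\mathcal X}(A)\in\hat M_k$ be the image of $[\pi_n(A)]\mathbb L^{-nd}\in M_k$. For a subset $A\subset\mathcal X_\infty$ and a negative integer $m$, say that a stable set $A_m$ *approximates $A$ up to dimension $<m$* if there is a sequence $(C_i)_{i\in\mathbb N}$ of stable subsets with $A\,\Delta\,A_m\subset\bigcup_i C_i$, $\dim C_i<m$ for all $i$, and $\dim C_i\to-\infty$ as $i\to\infty$. Call $A$ *measurable* if for every negative integer $m$ such an $A_m$ exists. **Proposition.** The measurable subsets of $\mathcal X_\infty$ form a Boolean ring of sets: $\emptyset$ is measurable, and finite unions and differences of measurable sets are measurable. Every stable set is measurable, and $\mu_{\mathcal X}$ extends from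 the stable sets to a finitely additive $\hat M_k$-valued measure on the measurable sets such that, for every measurable $A$ and every choice of stable sets $(A_m)_{m<0}$ with $A_m$ approximating $A$ up to dimension $<m$, $$\mu_{\mathcal X}(A)=\lim_{m\to-\infty}\mu_{\mathcal X}(A_m).$$ In particular, this limit exists in $\hat M_k$, is unique, and depends only on $A$, not on the choice of the $A_m$. -/

import Mathlib

open CategoryTheory AlgebraicGeometry IsLocalRing Filter Topology

universe u

noncomputable section

namespace Motivic

/-! ### The Grothendieck ring of varieties and its dimensional completion -/

section Grothendieck

variable (k : Type u) [Field k]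

/-- A `k`-variety: a reduced separated scheme of finite type over `k`. -/
def IsVariety (X : Over (Spec (CommRingCat.of k))) : Prop :=
  IsReduced X.left ∧ IsSeparated X.hom ∧ LocallyOfFiniteType X.hom ∧ QuasiCompact X.hom

/-- The type of all `k`-varieties. -/
def Variety : Type (u + 1) := {X : Over (Spec (CommRingCat.of k)) // IsVariety k X}

/-- The relations of the Grothendieck ring: isomorphic varieties have the same class, a variety is
the sum of a closed subvariety and of its open complement, the class of a product over `k` is the
product of the classes, and the class of the point is `1`. (For algebraically closed `k` the
product of two varieties is again reduced, so that the third clause covers every product. As the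
additive relations are stable under products, the additive group of the ring thus presented is
the one presented by the first two clauses.) -/
inductive GrothendieckRelation : FreeCommRing (Variety k) → Prop
  | iso (X Y : Variety k) (e : X.1 ≅ Y.1) :
      GrothendieckRelation (FreeCommRing.of X - FreeCommRing.of Y)
  | scissor (X Y U : Variety k) (i : Y.1 ⟶ X.1) (j : U.1 ⟶ X.1)
      (hi : IsClosedImmersion i.left) (hj : IsOpenImmersion j.left)
      (hij : Set.range j.left = (Set.range i.left)ᶜ) :
      GrothendieckRelation (FreeCommRing.of X - FreeCommRing.of Y - FreeCommRing.of U)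
  | prod (X Y P : Variety k) (p : P.1 ⟶ X.1) (q : P.1 ⟶ Y.1)
      (h : IsPullback p.left q.left X.1.hom Y.1.hom) :
      GrothendieckRelation (FreeCommRing.of P - FreeCommRing.of X * FreeCommRing.of Y)
  | point (P : Variety k) (h : IsIso P.1.hom) :
      GrothendieckRelation (FreeCommRing.of P - 1)

/-- The Grothendieck ring `K₀(𝒱_k)` of `k`-varieties. -/
abbrev K0 : Type (u + 1) :=
  FreeCommRing (Variety k) ⧸ Ideal.span {r : FreeCommRing (Variety k) | GrothendieckRelation k r}

open Classical in
/-- The class in `K₀(𝒱_k)` of a scheme over `k`; meant for varieties, and `0` otherwise. -/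
def K0.cls (X : Over (Spec (CommRingCat.of k))) : K0 k :=
  if h : IsVariety k X then Ideal.Quotient.mk _ (FreeCommRing.of ⟨X, h⟩) else 0

/-- The spectrum of a `k`-algebra as a scheme over `k`. -/
def specOver (R : Type u) [CommRing R] [Algebra k R] : Over (Spec (CommRingCat.of k)) :=
  Over.mk (Spec.map (CommRingCat.ofHom (algebraMap k R)))

/-- The class of the affine line in `K₀(𝒱_k)`. -/
def K0.L : K0 k := K0.cls k (specOver k (Polynomial k))

/-- `M_k = K₀(𝒱_k)[𝕃⁻¹]`. -/
abbrev M : Type (u + 1) := Localization.Away (K0.L k)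

/-- The class in `M_k` of a scheme over `k`; meant for varieties. -/
def M.cls (X : Over (Spec (CommRingCat.of k))) : M k := algebraMap (K0 k) (M k) (K0.cls k X)

/-- The class `𝕃` of the affine line as a unit of `M_k`. -/
def M.L : (M k)ˣ := (IsLocalization.Away.algebraMap_isUnit (S := M k) (K0.L k)).unit

/-- A Krull dimension (`⊥` for the empty space) as an extended integer. -/
def castDim (x : WithBot ℕ∞) : WithBot (WithTop ℤ) := x.map (ENat.map (fun n : ℕ => (n : ℤ)))

/-- The dimension filtration: `F_m M_k` is the subgroup of `M_k` spanned by the `[Z] 𝕃^{-r}` with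
`Z` a variety such that `dim Z ≤ m + r`. -/
def M.F (m : ℤ) : AddSubgroup (M k) :=
  AddSubgroup.closure {x | ∃ (Z : Over (Spec (CommRingCat.of k))) (r : ℤ), IsVariety k Z ∧
    castDim (topologicalKrullDim Z.left) ≤ ((m + r : ℤ) : WithBot (WithTop ℤ)) ∧
    x = M.cls k Z * ((M.L k ^ (-r) : (M k)ˣ) : M k)}

/-- The dimensional completion `lim M_k / F_m M_k`, `m → -∞`: the compatible families of classes
modulo the `F_m M_k`. -/
def MHatSubgroup : AddSubgroup (∀ m : ℤ, M k ⧸ M.F k m) where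
  carrier := {x | ∀ m m' : ℤ, m ≤ m' → ∃ a : M k,
    (QuotientAddGroup.mk a : M k ⧸ M.F k m) = x m ∧
    (QuotientAddGroup.mk a : M k ⧸ M.F k m') = x m'}
  zero_mem' _ _ _ := ⟨0, rfl, rfl⟩
  add_mem' {x y} hx hy m m' h := by
    obtain ⟨a, ha, ha'⟩ := hx m m' h
    obtain ⟨b, hb, hb'⟩ := hy m m' h
    exact ⟨a + b, by simp [← ha, ← hb], by simp [← ha', ← hb']⟩
  neg_mem' {x} hx m m' h := by
    obtain ⟨a, ha, ha'⟩ := hx m m' h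
    exact ⟨-a, by simp [← ha], by simp [← ha']⟩

/-- The dimensional completion `M̂_k` of `M_k`. -/
abbrev MHat : Type (u + 1) := MHatSubgroup k

/-- The inverse limit topology on `M̂_k`, all the `M_k / F_m M_k` being discrete. -/
instance : TopologicalSpace (MHat k) :=
  TopologicalSpace.induced Subtype.val
    (@Pi.topologicalSpace ℤ (fun m => M k ⧸ M.F k m) (fun _ => ⊥))

/-- The natural map `M_k → M̂_k`. -/
def toMHat : M k →+ MHat k where
  toFun a := ⟨fun m => (QuotientAddGroup.mk a : M k ⧸ M.F k m), fun _ _ _ => ⟨a, rfl, rfl⟩⟩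
  map_zero' := rfl
  map_add' _ _ := rfl

end Grothendieck

/-! ### Classical varieties through charts and coordinate functions -/

/-- Charts on a set `V` of `k`-points, each with a set of coordinate functions. Only the values of
the coordinate functions of a chart on the domain of that chart matter. -/
structure Atlas (k V : Type u) where
  /-- the index set of the charts -/
  ι : Type u
  /-- the domains of the charts -/
  dom : ι → Set V
  /-- the coordinate functions of the charts -/
  coord : ι → Set (V → k)

namespace Atlas

variable {k : Type u} [Field k] {V W : Type u} (𝔸 : Atlas k V) (𝔹 : Atlas k W)

/-- The functions that are polynomial in the coordinate functions of a chart. -/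
def poly (i : 𝔸.ι) : Subalgebra k (V → k) := Algebra.adjoin k (𝔸.coord i)

/-- The Zariski topology: the sets `{x ∈ dom i | g x ≠ 0}` with `g` polynomial in the coordinates
of the chart `i` generate it. -/
@[reducible] def zariski : TopologicalSpace V :=
  TopologicalSpace.generateFrom {D | ∃ (i : 𝔸.ι) (g : V → k), g ∈ 𝔸.poly i ∧
    D = {x | x ∈ 𝔸.dom i ∧ g x ≠ 0}}

/-- Locally closed subsets, that is, the underlying sets of the subvarieties. -/
def LocClosed (S : Set V) : Prop := @IsLocallyClosed V 𝔸.zariski S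

/-- Constructible subsets: finite unions of locally closed subsets. -/
def Constructible (C : Set V) : Prop :=
  ∃ (r : ℕ) (S : Fin r → Set V), (∀ j, 𝔸.LocClosed (S j)) ∧ C = ⋃ j, S j

/-- The dimension of a subset: the Krull dimension in the induced Zariski topology. -/
def dim (S : Set V) : WithBot ℕ∞ :=
  letI := 𝔸.zariski
  topologicalKrullDim S

/-- `f` is a regular function on the subset `S`: near each point of `S` it is a quotient of
polynomials in the coordinates of a chart. -/
def RegularOn (S : Set V) (f : V → k) : Prop :=
  ∀ x ∈ S, ∃ i : 𝔸.ι, x ∈ 𝔸.dom i ∧ ∃ g ∈ 𝔸.poly i, ∃ h ∈ 𝔸.poly i, h x ≠ 0 ∧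
    ∀ y ∈ S ∩ 𝔸.dom i, h y ≠ 0 → f y = g y / h y

/-- `φ` restricts to a morphism from the subset `S` to the subset `T`: it is continuous and pulls
regular functions on open subsets of `T` back to regular functions. -/
def MorphismOn (φ : V → W) (S : Set V) (T : Set W) : Prop :=
  Set.MapsTo φ S T ∧ @ContinuousOn V W 𝔸.zariski 𝔹.zariski φ S ∧
    ∀ (D : Set W) (g : W → k), IsOpen[𝔹.zariski] D → 𝔹.RegularOn (T ∩ D) g →
      𝔸.RegularOn (S ∩ φ ⁻¹' D) (g ∘ φ)

/-- The product with the affine space of dimension `d`. -/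
def prodAffine (d : ℕ) : Atlas k (V × (Fin d → k)) where
  ι := 𝔸.ι
  dom i := {x | x.1 ∈ 𝔸.dom i}
  coord i := {g | ∃ c ∈ 𝔸.coord i, g = fun x => c x.1} ∪ {g | ∃ a : Fin d, g = fun x => x.2 a}

/-- `p` makes the subset `T` a trivial fibration over the subset `S` with fiber the affine space
of dimension `d`: there is an isomorphism of `T` with `S × 𝔸^d` over `S`. -/
def TrivialOver (d : ℕ) (p : W → V) (T : Set W) (S : Set V) : Prop :=
  ∃ (φ : W → V × (Fin d → k)) (ψ : V × (Fin d → k) → W),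
    MorphismOn 𝔹 (𝔸.prodAffine d) φ T {x | x.1 ∈ S} ∧
    MorphismOn (𝔸.prodAffine d) 𝔹 ψ {x | x.1 ∈ S} T ∧
    Set.LeftInvOn ψ φ T ∧ Set.RightInvOn ψ φ {x | x.1 ∈ S} ∧
    ∀ y ∈ T, (φ y).1 = p y

/-- `p` makes the subset `B` a piecewise trivial fibration over the subset `C` with fiber the
affine space of dimension `d`: there is a finite decomposition of `C` into subvarieties over each
of which `B` is a subvariety that is a trivial fibration. -/
def PiecewiseTrivial (d : ℕ) (p : W → V) (B : Set W) (C : Set V) : Prop :=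
  Set.MapsTo p B C ∧ ∃ (r : ℕ) (S : Fin r → Set V),
    Pairwise (Function.onFun Disjoint S) ∧ C = ⋃ j, S j ∧
    ∀ j, 𝔸.LocClosed (S j) ∧ 𝔹.LocClosed (B ∩ p ⁻¹' S j) ∧
      TrivialOver 𝔸 𝔹 d p (B ∩ p ⁻¹' S j) (S j)

/-- An affine subvariety given explicitly: a principal open subset of a closed subset of a
chart. -/
structure AffinePiece where
  /-- the chart -/
  i : 𝔸.ι
  /-- the equations -/
  eqs : Set (V → k)
  eqs_subset : eqs ⊆ 𝔸.poly i
  /-- the function that is inverted -/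
  h : V → k
  h_mem : h ∈ 𝔸.poly i

variable {𝔸}

/-- The set of points of an affine piece. -/
def AffinePiece.carrier (P : 𝔸.AffinePiece) : Set V :=
  {x | x ∈ 𝔸.dom P.i ∧ (∀ g ∈ P.eqs, g x = 0) ∧ P.h x ≠ 0}

/-- The coordinate ring of an affine piece, as an algebra of functions on it: it is generated by
the coordinates of the chart and by the inverse of `h`. -/
def AffinePiece.coordRing (P : 𝔸.AffinePiece) : Subalgebra k (P.carrier → k) :=
  Algebra.adjoin k ({g | ∃ c ∈ 𝔸.coord P.i, g = fun x => c x.1} ∪ {fun x => (P.h x.1)⁻¹})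

variable (𝔸)

/-- A finite decomposition of a subset into affine pieces. -/
def IsDecomposition (C : Set V) (r : ℕ) (P : Fin r → 𝔸.AffinePiece) : Prop :=
  Pairwise (Function.onFun Disjoint fun j => (P j).carrier) ∧ C = ⋃ j, (P j).carrier

open Classical in
/-- The class `[C] ∈ M_k` of a constructible subset: the sum of the classes of the members of a
finite decomposition of `C` into affine subvarieties. By the scissor relations it does not depend
on the choice of the decomposition. (Subsets without such a decomposition get the value `0`.) -/
def cls (C : Set V) : M k :=
  if h : ∃ D : (r : ℕ) × (Fin r → 𝔸.AffinePiece), 𝔸.IsDecomposition C D.1 D.2 then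
    ∑ j, M.cls k (specOver k (h.choose.2 j).coordRing)
  else 0

end Atlas

/-! ### `𝔻`-varieties, their jets and their sections -/

section Sections

variable {O : Type u} [CommRing O] [IsLocalRing O] {X : Scheme.{u}} (f : X ⟶ Spec (CommRingCat.of O))

/-- A `𝔻`-variety, `𝔻 = Spec O`: a reduced separated scheme, flat and of finite type over `𝔻`,
with reduced closed fiber. -/
structure IsDVariety : Prop where
  reduced : IsReduced X
  separated : IsSeparated f
  flat : Flat f
  locallyOfFiniteType : LocallyOfFiniteType f
  quasiCompact : QuasiCompact f
  reduced_closedFiber : IsReduced (f.fiber (closedPoint O))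

/-- Pure relative dimension `d`: all irreducible components of all fibers have dimension `d`. -/
def HasPureRelativeDimension (d : ℕ) : Prop :=
  ∀ s : Spec (CommRingCat.of O), ∀ Z ∈ irreducibleComponents (f.fiber s), topologicalKrullDim Z = d

/-- The set `𝒳_∞` of sections of `𝒳 → 𝔻`. -/
def Arcs : Type u := {γ : Spec (CommRingCat.of O) ⟶ X // γ ≫ f = 𝟙 _}

/-- The set `𝒳_n` of sections of `𝒳 → 𝔻` up to order `n`, that is, over
`Spec (O / 𝔪 ^ (n + 1))`. -/
def Jets (n : ℕ) : Type u :=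
  {γ : Spec (CommRingCat.of (O ⧸ maximalIdeal O ^ (n + 1))) ⟶ X //
    γ ≫ f = Spec.map (CommRingCat.ofHom (Ideal.Quotient.mk (maximalIdeal O ^ (n + 1))))}

/-- The projection `π_n : 𝒳_∞ → 𝒳_n`. -/
def proj (n : ℕ) (γ : Arcs f) : Jets f n :=
  ⟨Spec.map (CommRingCat.ofHom (Ideal.Quotient.mk (maximalIdeal O ^ (n + 1)))) ≫ γ.1, by
    rw [Category.assoc, γ.2, Category.comp_id]⟩

/-- The forgetful map `𝒳_{n+1} → 𝒳_n`. -/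
def forget (n : ℕ) (γ : Jets f (n + 1)) : Jets f n :=
  ⟨Spec.map (CommRingCat.ofHom (Ideal.Quotient.factor
      (Ideal.pow_le_pow_right (I := maximalIdeal O) (Nat.le_succ (n + 1))))) ≫ γ.1, by
    rw [Category.assoc, γ.2, ← Spec.map_comp, ← CommRingCat.ofHom_comp, Ideal.Quotient.factor_comp_mk]⟩

variable {f} in
/-- The pullback `γ^* s ∈ O / 𝔪 ^ (n + 1)` of a function `s` on an open `U ⊆ 𝒳` along a jet `γ`
that lies in `U`. -/
def Jets.pullback {n : ℕ} (γ : Jets f n) (U : X.Opens) (h : ⊤ ≤ γ.1 ⁻¹ᵁ U) (s : Γ(X, U)) :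
    O ⧸ maximalIdeal O ^ (n + 1) :=
  (Scheme.ΓSpecIso (CommRingCat.of (O ⧸ maximalIdeal O ^ (n + 1)))).hom (γ.1.appLE U ⊤ h s)

variable (k : Type u) [Field k] [Algebra k O]

/-- The structure of a `k`-variety on `𝒳_n` (the closed points of the Weil restriction of `𝒳`
modulo `𝔪 ^ (n + 1)` to `k`, with the reduced structure): for every affine open `U ⊆ 𝒳`, the set
`U_n` of the jets in `U` is a chart, and its coordinate ring is generated by the coefficients
`γ ↦ l (γ^* s)` of the functions `s` on `U`, where `l` runs through the `k`-linear forms on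
`O / 𝔪 ^ (n + 1)`. -/
def jetAtlas (n : ℕ) : Atlas k (Jets f n) where
  ι := X.affineOpens
  dom U := {γ | ⊤ ≤ γ.1 ⁻¹ᵁ U.1}
  coord U := {g | ∃ (s : Γ(X, U.1)) (l : (O ⧸ maximalIdeal O ^ (n + 1)) →ₗ[k] k),
    ∀ (γ : Jets f n) (h : ⊤ ≤ γ.1 ⁻¹ᵁ U.1), g γ = l (γ.pullback U.1 h s)}

/-! ### Stable sets, measurable sets -/

/-- `A ⊆ 𝒳_∞` is stable, and `n` is a level from which on the conditions of stability hold. -/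
def StableAt (d n : ℕ) (A : Set (Arcs f)) : Prop :=
  (jetAtlas f k n).Constructible (proj f n '' A) ∧
  A = proj f n ⁻¹' (proj f n '' A) ∧
  ∀ m, n ≤ m → (jetAtlas f k m).PiecewiseTrivial (jetAtlas f k (m + 1)) d (forget f m)
    (proj f (m + 1) '' A) (proj f m '' A)

/-- Stable subsets of `𝒳_∞`, for `𝒳` of pure relative dimension `d`. -/
def IsStable (d : ℕ) (A : Set (Arcs f)) : Prop := ∃ n, StableAt f k d n A

/-- The least level of a stable set. (The dimension and the measure below can be computed at any
other level just as well.) -/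
def level (d : ℕ) (A : Set (Arcs f)) : ℕ := sInf {n | StableAt f k d n A}

/-- The virtual dimension `dim π_n(A) - n d` of a stable set `A`; it is `-∞` for `A = ∅`. -/
def vdim (d : ℕ) (A : Set (Arcs f)) : WithBot (WithTop ℤ) :=
  castDim ((jetAtlas f k (level f k d A)).dim (proj f (level f k d A) '' A)) +
    ((-((level f k d A : ℤ) * d) : ℤ) : WithBot (WithTop ℤ))

/-- The measure `[π_n(A)] 𝕃^{-nd} ∈ M_k` of a stable set `A`. -/
def stableMeasure (d : ℕ) (A : Set (Arcs f)) : M k :=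
  (jetAtlas f k (level f k d A)).cls (proj f (level f k d A) '' A) *
    ((M.L k ^ (-((level f k d A : ℤ) * d)) : (M k)ˣ) : M k)

/-- The stable set `B` approximates `A` up to dimension `< m`: the symmetric difference of `A` and
`B` is covered by a sequence of stable sets of dimension `< m` whose dimensions tend to `-∞`. -/
def Approximates (d : ℕ) (m : ℤ) (A B : Set (Arcs f)) : Prop :=
  IsStable f k d B ∧ ∃ C : ℕ → Set (Arcs f), (∀ i, IsStable f k d (C i)) ∧
    symmDiff A B ⊆ ⋃ i, C i ∧
    (∀ i, vdim f k d (C i) < (m : WithBot (WithTop ℤ))) ∧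
    ∀ N : ℤ, ∀ᶠ i in atTop, vdim f k d (C i) < (N : WithBot (WithTop ℤ))

/-- Measurable subsets of `𝒳_∞`. -/
def IsMeasurable (d : ℕ) (A : Set (Arcs f)) : Prop :=
  ∀ m : ℤ, m < 0 → ∃ B, Approximates f k d m A B

end Sections

end Motivic

end

/-! Everything rests on one claim, `IsStable.vdim_lt_of_subset_iUnion`: a stable set covered by a
sequence of stable sets of dimension `< m`, whose dimensions tend to `-∞`, has dimension `< m`
itself. Given this, two stable sets `B`, `B'` approximating the same `A` up to dimension `< m`
differ by the stable sets `B \ B'` and `B' \ B`, which are covered in this way; their measures lie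
in `F_m`, so the measures of `B` and `B'` agree modulo `F_m` (`stableMeasure_sub_mem_F`). Hence
approximations define one class in every `M_k / F_m M_k`, and these classes are the coordinates of
the measure. Unions and differences of approximations approximate unions and differences, which
gives the ring of sets and additivity.

The claim is proved by contradiction, without extracting a finite subcover. If `dim A ≥ m`, an arc
of `A` outside all `C i` is built one order at a time. A jet is `Thin` for `C` if successive general
lifts within `A` end outside `C`. Counting dimensions along the fibrations with fiber `𝔸^d` shows
that the general point of a subvariety is thin for any `C` too small to contain its preimage
(`StableAt.exists_isOpen_thin`). A single jet of order `l` has a preimage of dimension `-ld`; so at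
order `l` only the finitely many `C i` of dimension at least `-ld` impose a condition, and each
condition is satisfied on a nonempty open subset of an irreducible fiber. Completeness of `O` turns
the resulting compatible jets into an arc (`exists_arc`).

The rest is classical algebraic geometry for sets of `k`-points. `Atlas.Good` lists what is used of
the charts and `good_jetAtlas` verifies it for jets. For good atlases the coordinate ring of an
affine piece is its ring of regular functions, and noetherian induction shows that the class of a
constructible set is independent of the decomposition, additive and invariant under isomorphism. A
piecewise trivial fibration with fiber `𝔸^d` therefore multiplies classes by `𝕃^d` and raises
dimensions by `d` (`PiecewiseTrivial.cls_eq`, `PiecewiseTrivial.dim_eq`), so measure and dimension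
of a stable set do not depend on the level. -/

noncomputable section

namespace Motivic

/-! ### Chains of primes in finitely generated domains -/

section Chains

/-- Induction on the number of variables: over a Jacobson ring a maximal ideal of a polynomial ring
in one variable contracts to a maximal ideal, and its height is one more than that of the
contraction. -/
theorem height_eq_of_isMaximal_mvPolynomial (k : Type*) [Field k] (s : ℕ)
    (m : Ideal (MvPolynomial (Fin s) k)) [hm : m.IsMaximal] : m.height = s := by
  induction s with
  | zero =>
    have h1 : (m.height : WithBot ℕ∞) ≤ ringKrullDim (MvPolynomial (Fin 0) k) :=
      Ideal.height_le_ringKrullDim_of_ne_top hm.ne_top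
    rw [MvPolynomial.ringKrullDim_of_isNoetherianRing, ringKrullDim_eq_zero_of_field] at h1
    simp at h1
    simp [h1]
  | succ s ih =>
    let e := (MvPolynomial.finSuccEquiv k s).toRingEquiv
    let m' := m.map e
    have hm' : m'.IsMaximal := Ideal.map_isMaximal_of_equiv e
    let p := m'.comap (Polynomial.C)
    have hp : p.IsMaximal := Polynomial.isMaximal_comap_C_of_isJacobsonRing m'
    have : m'.LiesOver p := ⟨rfl⟩
    have h := Polynomial.height_eq_height_add_one p m'
    rw [ih p] at h
    have h2 : m'.height = m.height := e.height_map m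
    rw [← h2, h]; simp

/-- Going up, applied one step at a time; injectivity provides the prime over the bottom of the
chain. -/
theorem exists_monotone_lift {A B : Type*} [CommRing A] [CommRing B] [IsDomain B]
    [Algebra A B] [Algebra.IsIntegral A B] (hinj : Function.Injective (algebraMap A B))
    (p : ℕ → PrimeSpectrum A) (hp : Monotone p) :
    ∃ q : ℕ → PrimeSpectrum B, Monotone q ∧
      ∀ i, (q i).comap (algebraMap A B) = p i := by
  have step : ∀ (i : ℕ) (Q : {Q : PrimeSpectrum B // Q.comap (algebraMap A B) = p i}),
      ∃ Q' : {Q : PrimeSpectrum B // Q.comap (algebraMap A B) = p (i + 1)}, Q.1 ≤ Q'.1 := by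
    rintro i ⟨Q, hQ⟩
    obtain ⟨Q', h1, h2, h3⟩ := Ideal.exists_ideal_over_prime_of_isIntegral (p (i + 1)).asIdeal
      Q.asIdeal (by
        have := hp (Nat.le_succ i)
        rw [← hQ] at this
        exact this)
    exact ⟨⟨⟨Q', h2⟩, PrimeSpectrum.ext h3⟩, h1⟩
  obtain ⟨Q0, h02, h03⟩ := Ideal.exists_ideal_over_prime_of_isIntegral_of_isDomain (S := B)
    (p 0).asIdeal (by
      rw [(RingHom.injective_iff_ker_eq_bot _).mp hinj]; exact bot_le)
  choose nxt hnxt using step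
  let q : ∀ i, {Q : PrimeSpectrum B // Q.comap (algebraMap A B) = p i} := fun i =>
    Nat.rec ⟨⟨Q0, h02⟩, PrimeSpectrum.ext h03⟩ (fun i Q => nxt i Q) i
  exact ⟨fun i => (q i).1, monotone_nat_of_le_succ fun i => hnxt i (q i), fun i => (q i).2⟩

/-- In a finitely generated domain there are chains of primes of maximal length all of whose
members avoid a given nonzero element. -/
theorem exists_ltSeries_notMem (k : Type*) {B : Type*} [Field k] [CommRing B] [IsDomain B]
    [Algebra k B] [Algebra.FiniteType k B] {g : B} (hg : g ≠ 0) {r : ℕ}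
    (hr : (r : WithBot ℕ∞) ≤ ringKrullDim B) :
    ∃ l : LTSeries (PrimeSpectrum B), l.length = r ∧ ∀ i, g ∉ (l i).asIdeal := by
  -- Noether normalization. In the polynomial ring `A`, take a chain of length `s` below a maximal
  -- ideal that misses a nonzero multiple `h` of `g`, and lift it to `B` by going up. A member
  -- containing `g` would contain `h`, and so would its contraction.
  obtain ⟨s, φ, hφ, hint⟩ := exists_integral_inj_algHom_of_fg k B
  let A := MvPolynomial (Fin s) k
  let _ : Algebra A B := φ.toRingHom.toAlgebra
  have : Algebra.IsIntegral A B := ⟨hint⟩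
  have hinj : Function.Injective (algebraMap A B) := hφ
  have hdim : ringKrullDim B ≤ s := by
    have h1 : ringKrullDim B ≤ ringKrullDim A :=
      Order.krullDim_le_of_strictMono (PrimeSpectrum.comap (algebraMap A B)) (by
        intro P Q h
        exact Ideal.IsIntegral.comap_lt_comap h)
    rwa [MvPolynomial.ringKrullDim_of_isNoetherianRing, ringKrullDim_eq_zero_of_field, zero_add,
      Nat.card_eq_fintype_card, Fintype.card_fin] at h1
  have hrs : r ≤ s := by exact_mod_cast hr.trans hdim
  obtain ⟨h, hh0, hdvd⟩ : ∃ h : A, h ≠ 0 ∧ g ∣ algebraMap A B h := by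
    have := Ideal.comap_ne_bot_of_integral_mem (R := A) (I := Ideal.span {g}) hg
      (Ideal.mem_span_singleton_self g) (Algebra.IsIntegral.isIntegral g)
    obtain ⟨h, h1, h2⟩ := Submodule.exists_mem_ne_zero_of_ne_bot this
    exact ⟨h, h2, Ideal.mem_span_singleton.mp h1⟩
  -- `A` is a reduced Jacobson ring, so its maximal ideals intersect in zero.
  obtain ⟨m, hm, hhm⟩ : ∃ m : Ideal A, m.IsMaximal ∧ h ∉ m := by
    by_contra! hc
    have : h ∈ Ideal.jacobson (⊥ : Ideal A) := by
      rw [Ideal.jacobson, Ideal.mem_sInf]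
      exact fun {I} hI => hc I hI.2
    rw [← Ideal.radical_eq_jacobson] at this
    have h0 : (⊥ : Ideal A).radical = ⊥ := by
      rw [Ideal.radical_eq_iff]; exact Ideal.isRadical_bot
    rw [h0] at this
    exact hh0 this
  have hmp : m.IsPrime := hm.isPrime
  obtain ⟨l, hl1, hl2⟩ := Ideal.exists_ltSeries_length_eq_height m
  have hls : l.length = s := by
    rw [height_eq_of_isMaximal_mvPolynomial] at hl2; exact_mod_cast hl2
  -- The chain is continued constantly beyond its last member, to be indexed by `ℕ`.
  let p : ℕ → PrimeSpectrum A := fun i => l ⟨min i s, by omega⟩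
  have hp : Monotone p := fun i j hij => l.strictMono.monotone (by
    simp only [Fin.mk_le_mk]; omega)
  obtain ⟨q, hq, hqp⟩ := exists_monotone_lift hinj p hp
  have hqs : ∀ i < s, q i < q (i + 1) := by
    intro i hi
    refine lt_of_le_of_ne (hq (Nat.le_succ i)) fun heq => ?_
    have h1 : p i = p (i + 1) := by rw [← hqp, ← hqp, heq]
    have h2 := l.strictMono.injective h1
    simp only [Fin.mk.injEq] at h2
    omega
  refine ⟨⟨r, fun i => q i, fun i => ?_⟩, rfl, fun i hgi => ?_⟩
  · exact hqs i (by have := i.2; omega)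
  · have h1 : algebraMap A B h ∈ (q i).asIdeal := Ideal.mem_of_dvd _ hdvd hgi
    have h2 : h ∈ (p i).asIdeal := by rw [← hqp]; exact h1
    apply hhm
    have h3 : p i ≤ l.last := l.strictMono.monotone (Fin.le_last _)
    rw [hl1] at h3
    exact h3 h2

/-- A nonempty principal open subset of an irreducible affine variety keeps the full dimension,
because a longest chain can be chosen among the primes that avoid `g`, and these are the primes of
the localization. -/
theorem le_ringKrullDim_away (k : Type*) {B : Type*} [Field k] [CommRing B] [IsDomain B]
    [Algebra k B] [Algebra.FiniteType k B] {g : B} (hg : g ≠ 0)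
    (S : Type*) [CommRing S] [Algebra B S] [IsLocalization.Away g S] {r : ℕ}
    (hr : (r : WithBot ℕ∞) ≤ ringKrullDim B) : (r : WithBot ℕ∞) ≤ ringKrullDim S := by
  obtain ⟨l, hl, hg⟩ := exists_ltSeries_notMem k hg hr
  have hrange : ∀ i, ∃ Q : PrimeSpectrum S, Q.comap (algebraMap B S) = l i := by
    intro i
    have : l i ∈ Set.range (PrimeSpectrum.comap (algebraMap B S)) := by
      rw [PrimeSpectrum.localization_away_comap_range S g]
      exact hg i
    exact this
  choose Q hQ using hrange
  let l' : LTSeries (PrimeSpectrum S) := ⟨l.length, Q, fun i => by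
    have h1 : l i.castSucc < l i.succ := l.step i
    rw [← hQ, ← hQ] at h1
    have := (IsLocalization.orderEmbedding (Submonoid.powers g) S).map_rel_iff
      (a := (Q i.castSucc).asIdeal) (b := (Q i.succ).asIdeal)
    refine lt_of_le_of_ne (this.mp h1.le) ?_
    intro h; rw [PrimeSpectrum.ext h] at h1; exact lt_irrefl _ h1⟩
  have := Order.LTSeries.length_le_krullDim l'
  rw [← hl]; exact this

end Chains

/-! ### Classes of affine varieties -/

section AffineClasses

variable {k : Type u} [Field k]

theorem isVariety_specOver (A : Type u) [CommRing A] [Algebra k A] [_root_.IsReduced A]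
    [Algebra.FiniteType k A] : IsVariety k (specOver k A) := by
  refine ⟨?_, ?_, ?_, ?_⟩
  · change IsReduced (Spec (CommRingCat.of A)); infer_instance
  · change IsSeparated (Spec.map _); infer_instance
  · change LocallyOfFiniteType (Spec.map _)
    rw [HasRingHomProperty.Spec_iff (P := @LocallyOfFiniteType)]
    exact RingHom.finiteType_algebraMap.mpr inferInstance
  · change QuasiCompact (Spec.map _); infer_instance

theorem K0.mk_eq_zero_of_relation {r : FreeCommRing (Variety k)} (h : GrothendieckRelation k r) :
    (Ideal.Quotient.mk (Ideal.span {r : FreeCommRing (Variety k) | GrothendieckRelation k r}) r)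
      = 0 :=
  Ideal.Quotient.eq_zero_iff_mem.mpr (Ideal.subset_span h)

/-- The morphism of `k`-schemes given by a homomorphism of `k`-algebras. -/
def specOverMap {A B : Type u} [CommRing A] [CommRing B] [Algebra k A] [Algebra k B]
    (φ : A →ₐ[k] B) : specOver k B ⟶ specOver k A :=
  Over.homMk (Spec.map (CommRingCat.ofHom φ.toRingHom)) (by
    change Spec.map _ ≫ Spec.map _ = Spec.map _
    rw [← Spec.map_comp, ← CommRingCat.ofHom_comp]
    congr 2
    exact φ.comp_algebraMap)

theorem K0.cls_eq {X : Over (Spec (CommRingCat.of k))} (h : IsVariety k X) :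
    K0.cls k X = Ideal.Quotient.mk _ (FreeCommRing.of ⟨X, h⟩) := dif_pos h

theorem K0.cls_congr {X Y : Over (Spec (CommRingCat.of k))} (hX : IsVariety k X)
    (hY : IsVariety k Y) (e : X ≅ Y) : K0.cls k X = K0.cls k Y := by
  rw [K0.cls_eq hX, K0.cls_eq hY, ← sub_eq_zero, ← map_sub]
  exact K0.mk_eq_zero_of_relation (.iso _ _ e)

theorem K0.cls_specOver_congr {A B : Type u} [CommRing A] [CommRing B] [Algebra k A] [Algebra k B]
    [_root_.IsReduced A] [Algebra.FiniteType k A] (e : A ≃ₐ[k] B) :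
    K0.cls k (specOver k A) = K0.cls k (specOver k B) := by
  have : _root_.IsReduced B := isReduced_of_injective e.symm e.symm.injective
  have : Algebra.FiniteType k B := Algebra.FiniteType.equiv ‹_› e
  refine K0.cls_congr (isVariety_specOver A) (isVariety_specOver B) ?_
  refine Over.isoMk (Scheme.Spec.mapIso (RingEquiv.toCommRingCatIso e.symm.toRingEquiv).op.symm.symm) ?_
  change Spec.map _ ≫ Spec.map _ = Spec.map _
  rw [← Spec.map_comp]
  congr 1
  ext x
  exact e.symm.commutes x

/-- The condition `hker` makes the closed subscheme the zero locus of `h` as a set. Only radicals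
are compared, since `h` need not generate the kernel. -/
theorem K0.cls_scissor {A B C : Type u} [CommRing A] [CommRing B] [CommRing C] [Algebra k A]
    [Algebra k B] [Algebra k C] [_root_.IsReduced A] [Algebra.FiniteType k A]
    [_root_.IsReduced B] [Algebra.FiniteType k B] [_root_.IsReduced C] [Algebra.FiniteType k C]
    (φ : A →ₐ[k] B) (hφ : Function.Surjective φ) (ψ : A →ₐ[k] C) (h : A)
    (hψ : @IsLocalization.Away A _ h C _ ψ.toRingHom.toAlgebra)
    (hker : (RingHom.ker φ).radical = (Ideal.span {h}).radical) :
    K0.cls k (specOver k A) = K0.cls k (specOver k B) + K0.cls k (specOver k C) := by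
  rw [K0.cls_eq (isVariety_specOver A), K0.cls_eq (isVariety_specOver B),
    K0.cls_eq (isVariety_specOver C), ← sub_eq_zero, ← sub_sub, ← map_sub, ← map_sub]
  refine K0.mk_eq_zero_of_relation (.scissor _ _ _ (specOverMap φ) (specOverMap ψ) ?_ ?_ ?_)
  · exact IsClosedImmersion.spec_of_surjective _ hφ
  · let _ := ψ.toRingHom.toAlgebra
    exact IsOpenImmersion.of_isLocalization (S := C) h
  · let _ := ψ.toRingHom.toAlgebra
    have h1 : Set.range (specOverMap ψ).left = (PrimeSpectrum.basicOpen h : Set (PrimeSpectrum A)) :=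
      PrimeSpectrum.localization_away_comap_range C h
    have h2 : Set.range (specOverMap φ).left = PrimeSpectrum.zeroLocus (RingHom.ker φ) :=
      range_comap_of_surjective B φ.toRingHom hφ
    change Set.range (specOverMap ψ).left = (Set.range (specOverMap φ).left)ᶜ
    refine h1.trans ?_
    rw [h2, ← PrimeSpectrum.zeroLocus_radical, hker, PrimeSpectrum.zeroLocus_radical,
      PrimeSpectrum.zeroLocus_span, PrimeSpectrum.basicOpen_eq_zeroLocus_compl]
    rfl

/-- The relation for products applies because `A[X]` is the tensor product of `A` and `k[X]`, and it
is visibly reduced. -/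
theorem K0.cls_polynomial {A : Type u} [CommRing A] [Algebra k A]
    [_root_.IsReduced A] [Algebra.FiniteType k A] :
    K0.cls k (specOver k (Polynomial A)) = K0.L k * K0.cls k (specOver k A) := by
  let T := TensorProduct k A (Polynomial k)
  have : _root_.IsReduced (Polynomial A) :=
    isReduced_of_injective (MvPolynomial.uniqueAlgEquiv A Unit).symm
      (MvPolynomial.uniqueAlgEquiv A Unit).symm.injective
  have : Algebra.FiniteType k (Polynomial A) :=
    Algebra.FiniteType.trans (S := A) inferInstance inferInstance
  have : _root_.IsReduced T := isReduced_of_injective (polyEquivTensor k A).symm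
    (polyEquivTensor k A).symm.injective
  have : Algebra.FiniteType k T := Algebra.FiniteType.equiv ‹_› (polyEquivTensor k A)
  rw [K0.cls_specOver_congr (polyEquivTensor k A), mul_comm]
  have hT : IsVariety k (specOver k T) := isVariety_specOver T
  rw [K0.cls_eq hT, K0.L, K0.cls_eq (isVariety_specOver A),
    K0.cls_eq (isVariety_specOver (Polynomial k)), ← sub_eq_zero, ← map_mul, ← map_sub]
  refine K0.mk_eq_zero_of_relation (.prod _ _ _
    (specOverMap (Algebra.TensorProduct.includeLeft))
    (specOverMap (Algebra.TensorProduct.includeRight)) ?_)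
  exact isPullback_SpecMap_of_isPushout _ _ _ _ (CommRingCat.isPushout_tensorProduct k A (Polynomial k))

theorem K0.cls_mvPolynomial {A : Type u} [CommRing A] [Algebra k A]
    [_root_.IsReduced A] [Algebra.FiniteType k A] (d : ℕ) :
    K0.cls k (specOver k (MvPolynomial (Fin d) A)) = K0.L k ^ d * K0.cls k (specOver k A) := by
  have hred : ∀ d, _root_.IsReduced (MvPolynomial (Fin d) A) := fun d => inferInstance
  have hft : ∀ d, Algebra.FiniteType k (MvPolynomial (Fin d) A) := fun d =>
    Algebra.FiniteType.trans (S := A) inferInstance inferInstance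
  induction d with
  | zero =>
    rw [pow_zero, one_mul]
    exact K0.cls_specOver_congr ((MvPolynomial.isEmptyAlgEquiv A (Fin 0)).restrictScalars k)
  | succ d ih =>
    rw [K0.cls_specOver_congr ((MvPolynomial.finSuccEquiv A d).restrictScalars k),
      K0.cls_polynomial, ih, pow_succ']
    ring

theorem M.coe_L : ((M.L k : (M k)ˣ) : M k) = algebraMap (K0 k) (M k) (K0.L k) := rfl

theorem M.cls_specOver_congr {A B : Type u} [CommRing A] [CommRing B] [Algebra k A] [Algebra k B]
    [_root_.IsReduced A] [Algebra.FiniteType k A] (e : A ≃ₐ[k] B) :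
    M.cls k (specOver k A) = M.cls k (specOver k B) := by
  rw [M.cls, K0.cls_specOver_congr e, ← M.cls]

theorem M.cls_mvPolynomial {A : Type u} [CommRing A] [Algebra k A]
    [_root_.IsReduced A] [Algebra.FiniteType k A] (d : ℕ) :
    M.cls k (specOver k (MvPolynomial (Fin d) A)) =
      ((M.L k ^ d : (M k)ˣ) : M k) * M.cls k (specOver k A) := by
  rw [M.cls, K0.cls_mvPolynomial, map_mul, map_pow, Units.val_pow_eq_pow_val, M.coe_L, ← M.cls]

theorem M.cls_mul_mem_F {A : Type u} [CommRing A] [Algebra k A]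
    [_root_.IsReduced A] [Algebra.FiniteType k A] {m r : ℤ}
    (h : castDim (ringKrullDim A) ≤ ((m + r : ℤ) : WithBot (WithTop ℤ))) :
    M.cls k (specOver k A) * ((M.L k ^ (-r) : (M k)ˣ) : M k) ∈ M.F k m := by
  refine AddSubgroup.subset_closure ⟨specOver k A, r, isVariety_specOver A, ?_, rfl⟩
  change castDim (topologicalKrullDim (PrimeSpectrum A)) ≤ _
  rwa [PrimeSpectrum.topologicalKrullDim_eq_ringKrullDim]

end AffineClasses

/-! ### Affine algebras of functions -/

section FunctionAlgebras

variable {k : Type u} [Field k]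

/-- Precomposition with a map, as a homomorphism of algebras of functions. -/
def pull (k : Type u) [Field k] {S T : Type u} (ι : S → T) : (T → k) →ₐ[k] (S → k) where
  toFun f := f ∘ ι
  map_one' := rfl
  map_mul' _ _ := rfl
  map_zero' := rfl
  map_add' _ _ := rfl
  commutes' _ := rfl

@[simp] theorem pull_apply {S T : Type u} (ι : S → T) (f : T → k) (s : S) :
    pull k ι f s = f (ι s) := rfl

/-- Evaluation at a point. -/
def evalAt {T : Type u} (R : Subalgebra k (T → k)) (x : T) : R →ₐ[k] k :=
  (Pi.evalAlgHom k (fun _ : T => k) x).comp R.val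

@[simp] theorem evalAt_apply {T : Type u} (R : Subalgebra k (T → k)) (x : T) (f : R) :
    evalAt R x f = f.1 x := rfl

/-- An algebra of functions on a set that makes the set an affine variety: it is finitely generated
and its characters are the evaluations at the points of the set. -/
structure IsAffineAlgebra {T : Type u} (R : Subalgebra k (T → k)) : Prop where
  fg : R.FG
  point : ∀ χ : R →ₐ[k] k, ∃ x, ∀ f : R, χ f = f.1 x

/-- The functions on `S` generated by the functions in `R` and the inverse of `h`. -/
def locAlg {S T : Type u} (ι : S → T) (R : Subalgebra k (T → k)) (h : T → k) :
    Subalgebra k (S → k) :=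
  Algebra.adjoin k (pull k ι '' R ∪ {fun s => (h (ι s))⁻¹})

theorem isReduced_functions {T : Type u} (R : Subalgebra k (T → k)) : _root_.IsReduced R :=
  isReduced_of_injective R.val Subtype.val_injective

theorem locAlg_adjoin {S T : Type u} (ι : S → T) (G : Set (T → k)) (h : T → k) :
    locAlg ι (Algebra.adjoin k G) h =
      Algebra.adjoin k (pull k ι '' G ∪ {fun s => (h (ι s))⁻¹}) := by
  apply le_antisymm
  · refine Algebra.adjoin_le (Set.union_subset ?_ ?_)
    · rintro _ ⟨g, hg, rfl⟩
      have : pull k ι g ∈ (Algebra.adjoin k G).map (pull k ι) := ⟨g, hg, rfl⟩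
      rw [AlgHom.map_adjoin] at this
      exact Algebra.adjoin_mono Set.subset_union_left this
    · exact Set.subset_union_right.trans Algebra.subset_adjoin
  · exact Algebra.adjoin_mono (Set.union_subset_union_left _
      (Set.image_mono Algebra.subset_adjoin))

section locAlg

variable {S T : Type u} {ι : S → T} {R : Subalgebra k (T → k)} {h : T → k}

theorem pull_mem_locAlg {f : T → k} (hf : f ∈ R) : pull k ι f ∈ locAlg ι R h :=
  Algebra.subset_adjoin (Or.inl ⟨f, hf, rfl⟩)

theorem inv_mem_locAlg : (fun s => (h (ι s))⁻¹) ∈ locAlg ι R h :=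
  Algebra.subset_adjoin (Or.inr rfl)

theorem mem_locAlg_iff (hh : h ∈ R) (hι : ∀ s, h (ι s) ≠ 0) {f : S → k} :
    f ∈ locAlg ι R h ↔ ∃ a ∈ R, ∃ N : ℕ, ∀ s, f s = a (ι s) / h (ι s) ^ N := by
  constructor
  · intro hf
    induction hf using Algebra.adjoin_induction with
    | mem x hx =>
      rcases hx with ⟨a, ha, rfl⟩ | rfl
      · exact ⟨a, ha, 0, fun s => by simp⟩
      · exact ⟨1, R.one_mem, 1, fun s => by simp⟩
    | algebraMap r => exact ⟨algebraMap k _ r, R.algebraMap_mem r, 0, fun s => by simp⟩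
    | add x y _ _ hx hy =>
      obtain ⟨a, ha, N, hN⟩ := hx
      obtain ⟨b, hb, M, hM⟩ := hy
      refine ⟨a * h ^ M + b * h ^ N, R.add_mem (R.mul_mem ha (R.pow_mem hh _))
        (R.mul_mem hb (R.pow_mem hh _)), N + M, fun s => ?_⟩
      simp only [Pi.add_apply, Pi.mul_apply, Pi.pow_apply, hN, hM]
      have := hι s
      field_simp
      ring
    | mul x y _ _ hx hy =>
      obtain ⟨a, ha, N, hN⟩ := hx
      obtain ⟨b, hb, M, hM⟩ := hy
      refine ⟨a * b, R.mul_mem ha hb, N + M, fun s => ?_⟩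
      simp only [Pi.mul_apply, hN, hM]
      rw [pow_add, div_mul_div_comm]
  · rintro ⟨a, ha, N, hN⟩
    have : f = pull k ι a * (fun s => (h (ι s))⁻¹) ^ N := by
      ext s; simp [hN, div_eq_mul_inv]
    rw [this]
    exact mul_mem (pull_mem_locAlg ha) (pow_mem inv_mem_locAlg N)

theorem locAlg_fg (hR : R.FG) : (locAlg ι R h).FG := by
  obtain ⟨G, hG⟩ := hR
  rw [← hG, locAlg_adjoin]
  classical
  refine ⟨G.image (pull k ι) ∪ {fun s => (h (ι s))⁻¹}, ?_⟩
  simp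

/-- A character of the larger algebra restricts to a character of `R`, hence to a point `x`. There
`h` is nonzero because it has become invertible, and the functions in `E` vanish because they
restrict to zero; so `x` comes from `S`. -/
theorem IsAffineAlgebra.locAlg (hR : IsAffineAlgebra R) (hh : h ∈ R) (E : Set (T → k))
    (hE : E ⊆ R) (hι : Set.range ι = {x | (∀ e ∈ E, e x = 0) ∧ h x ≠ 0}) :
    IsAffineAlgebra (locAlg ι R h) := by
  have hι0 : ∀ s, h (ι s) ≠ 0 := fun s => by
    have : ι s ∈ Set.range ι := ⟨s, rfl⟩
    rw [hι] at this; exact this.2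
  have hιE : ∀ s, ∀ e ∈ E, e (ι s) = 0 := fun s => by
    have : ι s ∈ Set.range ι := ⟨s, rfl⟩
    rw [hι] at this; exact this.1
  refine ⟨locAlg_fg hR.fg, fun χ => ?_⟩
  let ρ : R →ₐ[k] Motivic.locAlg ι R h :=
    ((pull k ι).comp R.val).codRestrict _ (fun f => pull_mem_locAlg f.2)
  obtain ⟨x, hx⟩ := hR.point (χ.comp ρ)
  let v : Motivic.locAlg ι R h := ⟨_, inv_mem_locAlg⟩
  have hv : ρ ⟨h, hh⟩ * v = 1 := by
    apply Subtype.ext; ext s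
    exact mul_inv_cancel₀ (hι0 s)
  have hxv : h x * χ v = 1 := by
    have := congrArg χ hv
    rw [map_mul, map_one] at this
    rw [← this]; congr 1
    exact (hx ⟨h, hh⟩).symm
  have hxr : x ∈ Set.range ι := by
    rw [hι]
    refine ⟨fun e he => ?_, left_ne_zero_of_mul_eq_one hxv⟩
    have h1 : ρ ⟨e, hE he⟩ = 0 := by
      apply Subtype.ext; ext s; exact hιE s e he
    have := hx ⟨e, hE he⟩
    rw [AlgHom.comp_apply, h1, map_zero] at this
    exact this.symm
  obtain ⟨s, rfl⟩ := hxr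
  refine ⟨s, fun f => ?_⟩
  obtain ⟨a, ha, N, hN⟩ := (mem_locAlg_iff hh hι0).mp f.2
  have hf : f = ρ ⟨a, ha⟩ * v ^ N := by
    apply Subtype.ext; ext s
    simp only [hN, div_eq_mul_inv]
    change _ = a (ι s) * ((h (ι s))⁻¹) ^ N
    rw [inv_pow]
  rw [hf, map_mul, map_pow]
  have : χ v = (h (ι s))⁻¹ := eq_inv_of_mul_eq_one_right hxv
  rw [this]
  have := hx ⟨a, ha⟩
  rw [AlgHom.comp_apply] at this
  rw [this]
  rfl

end locAlg

variable {T : Type u} {R : Subalgebra k (T → k)}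

theorem IsAffineAlgebra.finiteType (hR : IsAffineAlgebra R) : Algebra.FiniteType k R :=
  (Subalgebra.fg_iff_finiteType R).mp hR.fg

theorem IsAffineAlgebra.isNoetherianRing (hR : IsAffineAlgebra R) : IsNoetherianRing R :=
  have := hR.finiteType
  Algebra.FiniteType.isNoetherianRing k R

/-- The restriction of functions in `R`. -/
def toLocAlg {S T : Type u} (ι : S → T) (R : Subalgebra k (T → k)) (h : T → k) :
    R →ₐ[k] Motivic.locAlg ι R h :=
  ((pull k ι).comp R.val).codRestrict _ (fun f => pull_mem_locAlg f.2)

/-- Inverting a function amounts to restricting to the principal open subset where it is nonzero. -/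
theorem isLocalization_locAlg {h : T → k} (hh : h ∈ R) {S : Type u} (ι : S → T)
    (hι : Set.range ι = {x | h x ≠ 0}) :
    let _ : Algebra R (Motivic.locAlg ι R h) := (toLocAlg ι R h).toRingHom.toAlgebra
    IsLocalization.Away (⟨h, hh⟩ : R) (Motivic.locAlg ι R h) := by
  have hι0 : ∀ s, h (ι s) ≠ 0 := fun s => by
    have : ι s ∈ Set.range ι := ⟨s, rfl⟩
    rwa [hι] at this
  intro _
  constructor
  · constructor
    · rintro ⟨_, N, rfl⟩
      refine IsUnit.of_mul_eq_one
        (⟨_, pow_mem (inv_mem_locAlg (ι := ι) (R := R) (h := h)) N⟩) ?_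
      apply Subtype.ext; ext s
      change (h ^ N) (ι s) * ((h (ι s))⁻¹) ^ N = 1
      rw [Pi.pow_apply, ← mul_pow, mul_inv_cancel₀ (hι0 s), one_pow]
    · rintro ⟨f, hf⟩
      obtain ⟨a, ha, N, hN⟩ := (mem_locAlg_iff hh hι0).mp hf
      refine ⟨⟨⟨a, ha⟩, ⟨_, N, rfl⟩⟩, Subtype.ext (funext fun s => ?_)⟩
      change f s * (h ^ N) (ι s) = a (ι s)
      rw [hN, Pi.pow_apply, div_mul_cancel₀ _ (pow_ne_zero _ (hι0 s))]
    · rintro ⟨a, ha⟩ ⟨b, hb⟩ hab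
      -- Two functions that agree where `h` is nonzero agree everywhere after multiplication by `h`.
      refine ⟨⟨_, 1, rfl⟩, Subtype.ext (funext fun x => ?_)⟩
      change (h ^ 1) x * a x = (h ^ 1) x * b x
      rw [pow_one]
      by_cases hx : h x = 0
      · simp [hx]
      · have : x ∈ Set.range ι := by rw [hι]; exact hx
        obtain ⟨s, rfl⟩ := this
        congr 1
        exact congrFun (congrArg Subtype.val hab) s

variable [IsAlgClosed k]

/-- Zariski's lemma: the residue field is finite over `k`, which is algebraically closed. -/
theorem bijective_algebraMap_quotient {A : Type*} [CommRing A] [Algebra k A]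
    [Algebra.FiniteType k A] (m : Ideal A) [hm : m.IsMaximal] :
    Function.Bijective (algebraMap k (A ⧸ m)) := by
  let _ : Field (A ⧸ m) := Ideal.Quotient.field m
  have h2 : Module.Finite k (A ⧸ m) := finite_of_finite_type_of_isJacobsonRing k (A ⧸ m)
  exact IsAlgClosed.algebraMap_bijective_of_isIntegral

theorem IsAffineAlgebra.exists_point (hR : IsAffineAlgebra R) (m : Ideal R) [hm : m.IsMaximal] :
    ∃ x, ∀ f : R, f ∈ m ↔ f.1 x = 0 := by
  have := hR.finiteType
  have h3 := bijective_algebraMap_quotient (k := k) m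
  let e : k ≃ₐ[k] (R ⧸ m) := AlgEquiv.ofBijective (Algebra.ofId k _) h3
  obtain ⟨x, hx⟩ := hR.point (e.symm.toAlgHom.comp (Ideal.Quotient.mkₐ k m))
  refine ⟨x, fun f => ?_⟩
  rw [← hx, ← Ideal.Quotient.eq_zero_iff_mem]
  exact (EmbeddingLike.map_eq_zero_iff (f := e.symm)).symm

/-- The Nullstellensatz. -/
theorem IsAffineAlgebra.mem_radical (hR : IsAffineAlgebra R) (J : Ideal R) (h : R)
    (H : ∀ x, (∀ j ∈ J, j.1 x = 0) → h.1 x = 0) : h ∈ J.radical := by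
  have := hR.finiteType
  have : IsJacobsonRing R := isJacobsonRing_of_finiteType (A := k)
  rw [Ideal.radical_eq_jacobson, Ideal.jacobson, Ideal.mem_sInf]
  rintro M ⟨hJM, hM⟩
  obtain ⟨x, hx⟩ := hR.exists_point M
  rw [hx]
  exact H x fun j hj => (hx j).mp (hJM hj)

/-- A function that is locally a quotient of functions in `R` is globally such a quotient. -/
theorem IsAffineAlgebra.mem_locAlg_of_regular (hR : IsAffineAlgebra R) {S : Type u} {ι : S → T}
    {h : T → k} (hh : h ∈ R) (E : Set (T → k)) (hE : E ⊆ R)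
    (hι : Set.range ι = {x | (∀ e ∈ E, e x = 0) ∧ h x ≠ 0}) (f : S → k)
    (hf : ∀ s, ∃ a ∈ R, ∃ b ∈ R, b (ι s) ≠ 0 ∧ ∀ s', b (ι s') ≠ 0 → f s' = a (ι s') / b (ι s')) :
    f ∈ Motivic.locAlg ι R h := by
  have hι0 : ∀ s, h (ι s) ≠ 0 := fun s => by
    have : ι s ∈ Set.range ι := ⟨s, rfl⟩
    rw [hι] at this; exact this.2
  have hιE : ∀ s, ∀ e ∈ E, e (ι s) = 0 := fun s => by
    have : ι s ∈ Set.range ι := ⟨s, rfl⟩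
    rw [hι] at this; exact this.1
  -- The ideal of denominators of `f`. Its zeros avoid the image of `S`, so by the Nullstellensatz
  -- some power of `h` is a denominator.
  let J : Ideal R :=
    { carrier := {q | ∃ r ∈ R, ∀ s, q.1 (ι s) * f s = r (ι s)}
      add_mem' := by
        rintro q q' ⟨r, hr, h1⟩ ⟨r', hr', h2⟩
        refine ⟨r + r', add_mem hr hr', fun s => ?_⟩
        simp [← h1, ← h2, add_mul]
      zero_mem' := ⟨0, zero_mem _, fun s => by simp⟩
      smul_mem' := by
        rintro c q ⟨r, hr, h1⟩
        refine ⟨c.1 * r, mul_mem c.2 hr, fun s => ?_⟩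
        simp [← h1, mul_assoc] }
  have hrad : (⟨h, hh⟩ : R) ∈ J.radical := by
    refine hR.mem_radical J _ fun x hx => ?_
    by_contra hhx
    have hxr : x ∈ Set.range ι := by
      rw [hι]
      refine ⟨fun e he => hx ⟨e, hE he⟩ ⟨0, zero_mem _, fun s => ?_⟩, hhx⟩
      simp [hιE s e he]
    obtain ⟨s, rfl⟩ := hxr
    obtain ⟨a, ha, b, hb, hbs, hab⟩ := hf s
    -- The denominator is `b * b` and not `b`: nothing is known of `f` where `b` vanishes, and the
    -- extra factor makes both sides zero there.
    have := hx ⟨b * b, mul_mem hb hb⟩ ⟨b * a, mul_mem hb ha, fun s' => ?_⟩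
    · simp [hbs] at this
    · by_cases h0 : b (ι s') = 0
      · simp [h0]
      · simp only [Pi.mul_apply, hab s' h0]; field_simp
  obtain ⟨N, r, hr, hN⟩ := hrad
  rw [mem_locAlg_iff hh hι0]
  refine ⟨r, hr, N, fun s => ?_⟩
  rw [eq_div_iff (pow_ne_zero _ (hι0 s)), ← hN s, mul_comm]
  rfl

/-- An affine variety is the disjoint union of a principal open subset and of its complement. -/
theorem IsAffineAlgebra.cls_eq_add (hR : IsAffineAlgebra R) {h : T → k} (hh : h ∈ R)
    {S Z : Type u} (ι : S → T) (κ : Z → T)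
    (hι : Set.range ι = {x | h x ≠ 0}) (hκ : Set.range κ = {x | h x = 0}) :
    M.cls k (specOver k R) =
      M.cls k (specOver k (Motivic.locAlg κ R 1)) + M.cls k (specOver k (Motivic.locAlg ι R h)) := by
  have hι0 : ∀ s, h (ι s) ≠ 0 := fun s => by
    have : ι s ∈ Set.range ι := ⟨s, rfl⟩
    rwa [hι] at this
  have hκ0 : ∀ s, h (κ s) = 0 := fun s => by
    have : κ s ∈ Set.range κ := ⟨s, rfl⟩
    rwa [hκ] at this
  have := hR.finiteType
  have := isReduced_functions R
  have := isReduced_functions (Motivic.locAlg κ R 1)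
  have := isReduced_functions (Motivic.locAlg ι R h)
  have : Algebra.FiniteType k (Motivic.locAlg κ R 1) :=
    (Subalgebra.fg_iff_finiteType _).mp (locAlg_fg hR.fg)
  have : Algebra.FiniteType k (Motivic.locAlg ι R h) :=
    (Subalgebra.fg_iff_finiteType _).mp (locAlg_fg hR.fg)
  let φ := toLocAlg κ R 1
  let ψ := toLocAlg ι R h
  rw [M.cls, M.cls, M.cls, ← map_add]
  congr 1
  refine K0.cls_scissor φ ?_ ψ ⟨h, hh⟩ ?_ ?_
  · rintro ⟨f, hf⟩
    obtain ⟨a, ha, N, hN⟩ := (mem_locAlg_iff R.one_mem (by simp)).mp hf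
    refine ⟨⟨a, ha⟩, Subtype.ext (funext fun s => ?_)⟩
    change a (κ s) = f s
    rw [hN]; simp
  · exact isLocalization_locAlg hh ι hι
  · have hle : Ideal.span {(⟨h, hh⟩ : R)} ≤ RingHom.ker φ := by
      rw [Ideal.span_singleton_le_iff_mem, RingHom.mem_ker]
      apply Subtype.ext; ext s; exact hκ0 s
    apply le_antisymm _ (Ideal.radical_mono hle)
    rw [Ideal.radical_le_radical_iff]
    intro f hf
    refine hR.mem_radical _ _ fun x hx => ?_
    have hx0 := hx _ (Ideal.mem_span_singleton_self _)
    have : x ∈ Set.range κ := by rw [hκ]; exact hx0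
    obtain ⟨s, rfl⟩ := this
    exact congrFun (congrArg Subtype.val ((RingHom.mem_ker).mp hf)) s

/-- The homomorphism of algebras of functions induced by a bijection. -/
def algEquivOfEquiv {S T : Type u} (R : Subalgebra k (S → k)) (R' : Subalgebra k (T → k))
    (e : S ≃ T) (H : ∀ g : T → k, g ∈ R' ↔ g ∘ e ∈ R) : R' ≃ₐ[k] R :=
  AlgEquiv.ofBijective (((pull k e).comp R'.val).codRestrict R fun f => (H f).mp f.2) (by
    constructor
    · intro a b hab
      apply Subtype.ext; ext t
      have := congrFun (congrArg Subtype.val hab) (e.symm t)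
      change a.1 (e (e.symm t)) = b.1 (e (e.symm t)) at this
      simpa using this
    · rintro ⟨f, hf⟩
      refine ⟨⟨f ∘ e.symm, (H _).mpr (by simpa [Function.comp_assoc] using hf)⟩, ?_⟩
      apply Subtype.ext; ext s
      change f (e.symm (e s)) = f s
      simp)

end FunctionAlgebras

/-! ### The Zariski topology and the Krull dimension of an affine algebra of functions -/

section FunctionTopology

variable {k : Type u} [Field k] {T : Type u}

/-- The point of the spectrum given by a point of the set. -/
def toSpec (R : Subalgebra k (T → k)) (x : T) : PrimeSpectrum R :=
  ⟨RingHom.ker (evalAt R x), RingHom.ker_isPrime _⟩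

theorem IsAffineAlgebra.mem_prime [IsAlgClosed k] {R : Subalgebra k (T → k)}
    (hR : IsAffineAlgebra R) (p : PrimeSpectrum R) (f : R)
    (H : ∀ x, (∀ g ∈ p.asIdeal, g.1 x = 0) → f.1 x = 0) : f ∈ p.asIdeal := by
  have := hR.mem_radical p.asIdeal f H
  rwa [p.2.radical] at this

variable [TopologicalSpace T]

/-- The closed sets are the zero sets of subsets of the algebra `R` of functions. -/
def IsZariskiFor (R : Subalgebra k (T → k)) : Prop :=
  ∀ Z : Set T, IsClosed Z ↔ ∃ E ⊆ (R : Set (T → k)), Z = {x | ∀ e ∈ E, e x = 0}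

variable {R : Subalgebra k (T → k)}

theorem IsZariskiFor.isInducing (h : IsZariskiFor R) : IsInducing (toSpec R) := by
  refine ⟨TopologicalSpace.ext_iff_isClosed.mpr fun Z => ?_⟩
  rw [h, isClosed_induced_iff]
  constructor
  · rintro ⟨E, hE, rfl⟩
    refine ⟨_, PrimeSpectrum.isClosed_zeroLocus (Subtype.val ⁻¹' E), ?_⟩
    ext x
    constructor
    · exact fun hx e he => hx (a := ⟨e, hE he⟩) he
    · exact fun hx e he => hx _ he
  · rintro ⟨W, hW, rfl⟩
    obtain ⟨E, rfl⟩ := (PrimeSpectrum.isClosed_iff_zeroLocus _).mp hW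
    refine ⟨Subtype.val '' E, ?_, ?_⟩
    · rintro _ ⟨e, -, rfl⟩; exact e.2
    · ext x
      constructor
      · rintro hx _ ⟨e, he, rfl⟩; exact hx he
      · exact fun hx e he => hx _ ⟨e, he, rfl⟩

theorem IsZariskiFor.noetherianSpace (h : IsZariskiFor R) (hR : IsAffineAlgebra R) :
    TopologicalSpace.NoetherianSpace T := by
  have := hR.isNoetherianRing
  exact h.isInducing.noetherianSpace

theorem IsZariskiFor.isOpen_ne (h : IsZariskiFor R) {f : T → k} (hf : f ∈ R) :
    IsOpen {x | f x ≠ 0} := by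
  rw [← isClosed_compl_iff, h]
  exact ⟨{f}, by simpa using hf, by ext; simp⟩

theorem IsZariskiFor.isDomain (h : IsZariskiFor R) [IrreducibleSpace T] : IsDomain R := by
  have : Nontrivial R := by
    obtain ⟨x⟩ := (inferInstance : Nonempty T)
    exact ⟨0, 1, fun h => by
      have := congrFun (congrArg Subtype.val h) x
      simp at this⟩
  have : NoZeroDivisors R := by
    refine ⟨fun {a b} hab => ?_⟩
    by_contra! hc
    have ha : {x | a.1 x ≠ 0}.Nonempty := by
      by_contra! h0
      refine hc.1 (Subtype.ext (funext fun x => ?_))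
      by_contra hx
      exact Set.notMem_empty x (h0 ▸ hx)
    have hb : {x | b.1 x ≠ 0}.Nonempty := by
      by_contra! h0
      refine hc.2 (Subtype.ext (funext fun x => ?_))
      by_contra hx
      exact Set.notMem_empty x (h0 ▸ hx)
    obtain ⟨x, hx1, hx2⟩ := nonempty_preirreducible_inter (h.isOpen_ne a.2) (h.isOpen_ne b.2) ha hb
    have := congrFun (congrArg Subtype.val hab) x
    exact mul_ne_zero hx1 hx2 this
  exact NoZeroDivisors.to_isDomain _

variable [IsAlgClosed k]

/-- The irreducible closed set of a prime ideal. -/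
def irredZeros (h : IsZariskiFor R) (hR : IsAffineAlgebra R) (p : PrimeSpectrum R) :
    TopologicalSpace.IrreducibleCloseds T where
  carrier := {x | ∀ f ∈ p.asIdeal, f.1 x = 0}
  isIrreducible' := by
    constructor
    · by_contra! h0
      apply p.2.ne_top
      rw [Ideal.eq_top_iff_one]
      refine hR.mem_prime p 1 fun x hx => ?_
      exact absurd hx (fun hx => Set.notMem_empty x (h0 ▸ hx))
    · rw [isPreirreducible_iff_isClosed_union_isClosed]
      intro Z₁ Z₂ h1 h2 hsub
      rw [h] at h1 h2
      obtain ⟨E₁, hE₁, rfl⟩ := h1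
      obtain ⟨E₂, hE₂, rfl⟩ := h2
      by_contra! hc
      obtain ⟨⟨x, hx, hx1⟩, y, hy, hy1⟩ := And.imp Set.not_subset.mp Set.not_subset.mp hc
      simp only [Set.mem_ofPred_eq, not_forall] at hx1 hy1
      obtain ⟨e, he, hex⟩ := hx1
      obtain ⟨e', he', hey⟩ := hy1
      have : (⟨e, hE₁ he⟩ * ⟨e', hE₂ he'⟩ : R) ∈ p.asIdeal := by
        refine hR.mem_prime p _ fun z hz => ?_
        rcases hsub hz with h1 | h1
        · simp [h1 e he]
        · simp [h1 e' he']
      rcases p.2.mem_or_mem this with h1 | h1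
      · exact hex (hx _ h1)
      · exact hey (hy _ h1)
  isClosed' := by
    rw [h]
    refine ⟨Subtype.val '' (p.asIdeal : Set R), ?_, ?_⟩
    · rintro _ ⟨e, -, rfl⟩; exact e.2
    · ext x; simp

/-- `T` carries the topology induced from the spectrum, which gives one inequality. For the other, a
prime goes to its zero set in `T`; by the Nullstellensatz this reverses inclusions strictly. -/
theorem IsZariskiFor.topologicalKrullDim_eq (h : IsZariskiFor R) (hR : IsAffineAlgebra R) :
    topologicalKrullDim T = ringKrullDim R := by
  apply le_antisymm
  · rw [← PrimeSpectrum.topologicalKrullDim_eq_ringKrullDim]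
    exact h.isInducing.topologicalKrullDim_le
  · rw [ringKrullDim, ← Order.krullDim_orderDual]
    refine Order.krullDim_le_of_strictMono (fun p => irredZeros h hR (OrderDual.ofDual p)) ?_
    intro p q hpq
    have hle : ∀ p q : PrimeSpectrum R, p ≤ q → irredZeros h hR q ≤ irredZeros h hR p :=
      fun p q hpq x hx f hf => hx f (hpq hf)
    refine lt_of_le_not_ge (hle _ _ (le_of_lt hpq)) fun hge => ?_
    have : OrderDual.ofDual p ≤ OrderDual.ofDual q := by
      intro f hf
      exact hR.mem_prime _ f fun x hx => hge hx f hf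
    exact absurd this (not_le_of_gt hpq)

end FunctionTopology

namespace Atlas

/-! ### Atlases whose charts are affine varieties -/

section Good

variable {k : Type u} [Field k] {V W : Type u}

/-- The coordinate algebra of a chart, as an algebra of functions on its domain. -/
def chartRing (𝔸 : Atlas k V) (i : 𝔸.ι) : Subalgebra k (𝔸.dom i → k) :=
  (𝔸.poly i).map (pull k (Subtype.val : 𝔸.dom i → V))

/-- The charts are affine varieties, finitely many of them cover, and they are glued along principal
open subsets. -/
structure Good (𝔸 : Atlas k V) : Prop where
  affine : ∀ i, IsAffineAlgebra (𝔸.chartRing i)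
  sep : ∀ i, ∀ x ∈ 𝔸.dom i, ∀ y ∈ 𝔸.dom i, (∀ c ∈ 𝔸.coord i, c x = c y) → x = y
  compat : ∀ i j, ∀ x ∈ 𝔸.dom i, x ∈ 𝔸.dom j → ∃ g ∈ 𝔸.poly i, g x ≠ 0 ∧
    (∀ y ∈ 𝔸.dom i, g y ≠ 0 → y ∈ 𝔸.dom j) ∧
    ∀ c ∈ 𝔸.coord j, ∃ a ∈ 𝔸.poly i, ∃ N : ℕ, ∀ y ∈ 𝔸.dom i, g y ≠ 0 → c y = a y / g y ^ N
  cover : ∃ s : Finset 𝔸.ι, ∀ x, ∃ i ∈ s, x ∈ 𝔸.dom i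

variable {𝔸 : Atlas k V}

theorem Good.compat_poly (hA : 𝔸.Good) (i j : 𝔸.ι) (x : V) (hi : x ∈ 𝔸.dom i)
    (hj : x ∈ 𝔸.dom j) : ∃ g ∈ 𝔸.poly i, g x ≠ 0 ∧
    (∀ y ∈ 𝔸.dom i, g y ≠ 0 → y ∈ 𝔸.dom j) ∧
    ∀ c ∈ 𝔸.poly j, ∃ a ∈ 𝔸.poly i, ∃ N : ℕ, ∀ y ∈ 𝔸.dom i, g y ≠ 0 → c y = a y / g y ^ N := by
  obtain ⟨g, hg, hgx, h1, h2⟩ := hA.compat i j x hi hj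
  refine ⟨g, hg, hgx, h1, fun c hc => ?_⟩
  induction hc using Algebra.adjoin_induction with
  | mem c hc => exact h2 c hc
  | algebraMap r => exact ⟨algebraMap k _ r, Subalgebra.algebraMap_mem _ r, 0, fun y _ _ => by simp⟩
  | add x y _ _ hx hy =>
    obtain ⟨a, ha, N, hN⟩ := hx
    obtain ⟨b, hb, M, hM⟩ := hy
    refine ⟨a * g ^ M + b * g ^ N, add_mem (mul_mem ha (pow_mem hg _))
      (mul_mem hb (pow_mem hg _)), N + M, fun s hs hgs => ?_⟩
    simp only [Pi.add_apply, Pi.mul_apply, Pi.pow_apply, hN s hs hgs, hM s hs hgs]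
    field_simp
    ring
  | mul x y _ _ hx hy =>
    obtain ⟨a, ha, N, hN⟩ := hx
    obtain ⟨b, hb, M, hM⟩ := hy
    refine ⟨a * b, mul_mem ha hb, N + M, fun s hs hgs => ?_⟩
    simp only [Pi.mul_apply, hN s hs hgs, hM s hs hgs]
    rw [pow_add, div_mul_div_comm]

theorem isOpen_basic (𝔸 : Atlas k V) {i : 𝔸.ι} {g : V → k} (hg : g ∈ 𝔸.poly i) :
    IsOpen[𝔸.zariski] {x | x ∈ 𝔸.dom i ∧ g x ≠ 0} :=
  TopologicalSpace.isOpen_generateFrom_of_mem ⟨i, g, hg, rfl⟩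

theorem isOpen_dom (𝔸 : Atlas k V) (i : 𝔸.ι) : IsOpen[𝔸.zariski] (𝔸.dom i) := by
  convert! 𝔸.isOpen_basic (i := i) (g := 1) (one_mem _)
  simp

/-- The principal open subsets of a chart form a basis of its topology. -/
theorem Good.exists_basic (hA : 𝔸.Good) {O : Set V} (hO : IsOpen[𝔸.zariski] O) {i : 𝔸.ι} {x : V}
    (hi : x ∈ 𝔸.dom i) (hx : x ∈ O) :
    ∃ g ∈ 𝔸.poly i, g x ≠ 0 ∧ ∀ y ∈ 𝔸.dom i, g y ≠ 0 → y ∈ O := by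
  induction hO with
  | basic D hD =>
    obtain ⟨j, c, hc, rfl⟩ := hD
    obtain ⟨g, hg, hgx, h1, h2⟩ := hA.compat_poly i j x hi hx.1
    obtain ⟨a, ha, N, hN⟩ := h2 c hc
    refine ⟨g * a, mul_mem hg ha, mul_ne_zero hgx fun h0 => ?_, fun y hy hgy => ?_⟩
    · have := hx.2; rw [hN x hi hgx, h0] at this; simp at this
    · have h3 : g y ≠ 0 := left_ne_zero_of_mul hgy
      have h4 : a y ≠ 0 := right_ne_zero_of_mul hgy
      refine ⟨h1 y hy h3, ?_⟩
      rw [hN y hy h3]; positivity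
  | univ => exact ⟨1, one_mem _, one_ne_zero, fun _ _ _ => trivial⟩
  | inter O₁ O₂ _ _ h1 h2 =>
    obtain ⟨g₁, hg₁, hx₁, h₁⟩ := h1 hx.1
    obtain ⟨g₂, hg₂, hx₂, h₂⟩ := h2 hx.2
    exact ⟨g₁ * g₂, mul_mem hg₁ hg₂, mul_ne_zero hx₁ hx₂, fun y hy hgy =>
      ⟨h₁ y hy (left_ne_zero_of_mul hgy), h₂ y hy (right_ne_zero_of_mul hgy)⟩⟩
  | sUnion S _ ih =>
    obtain ⟨O, hO, hxO⟩ := hx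
    obtain ⟨g, hg, hgx, h⟩ := ih O hO hxO
    exact ⟨g, hg, hgx, fun y hy hgy => ⟨O, hO, h y hy hgy⟩⟩

/-! ### Regular functions -/

theorem RegularOn.mono {S S' : Set V} {f : V → k} (hf : 𝔸.RegularOn S f) (h : S' ⊆ S) :
    𝔸.RegularOn S' f := fun x hx => by
  obtain ⟨i, hi, a, ha, b, hb, hbx, hab⟩ := hf x (h hx)
  exact ⟨i, hi, a, ha, b, hb, hbx, fun y hy => hab y ⟨h hy.1, hy.2⟩⟩

theorem RegularOn.congr {S : Set V} {f f' : V → k} (hf : 𝔸.RegularOn S f)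
    (h : ∀ x ∈ S, f x = f' x) : 𝔸.RegularOn S f' := fun x hx => by
  obtain ⟨i, hi, a, ha, b, hb, hbx, hab⟩ := hf x hx
  exact ⟨i, hi, a, ha, b, hb, hbx, fun y hy hby => (h y hy.1).symm.trans (hab y hy hby)⟩

theorem RegularOn.inv {S : Set V} {f : V → k} (hf : 𝔸.RegularOn S f)
    (h : ∀ x ∈ S, f x ≠ 0) : 𝔸.RegularOn S (fun x => (f x)⁻¹) := fun x hx => by
  obtain ⟨i, hi, a, ha, b, hb, hbx, hab⟩ := hf x hx
  have hax : a x ≠ 0 := fun h0 => h x hx (by rw [hab x ⟨hx, hi⟩ hbx, h0, zero_div])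
  refine ⟨i, hi, b * b, mul_mem hb hb, a * b, mul_mem ha hb, mul_ne_zero hax hbx,
    fun y hy hby => ?_⟩
  have h1 : a y ≠ 0 := left_ne_zero_of_mul hby
  have h2 : b y ≠ 0 := right_ne_zero_of_mul hby
  simp only [hab y hy h2, Pi.mul_apply]
  field_simp

theorem regularOn_poly {S : Set V} {i : 𝔸.ι} (hS : S ⊆ 𝔸.dom i) {f : V → k} (hf : f ∈ 𝔸.poly i) :
    𝔸.RegularOn S f := fun x hx =>
  ⟨i, hS hx, f, hf, 1, one_mem _, one_ne_zero, fun y _ _ => by simp⟩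

/-- Regularity can be checked in any chart. -/
theorem RegularOn.chart (hA : 𝔸.Good) {S : Set V} {f : V → k} (hf : 𝔸.RegularOn S f) {i : 𝔸.ι}
    {x : V} (hx : x ∈ S) (hi : x ∈ 𝔸.dom i) :
    ∃ a ∈ 𝔸.poly i, ∃ b ∈ 𝔸.poly i, b x ≠ 0 ∧ ∀ y ∈ S ∩ 𝔸.dom i, b y ≠ 0 → f y = a y / b y := by
  obtain ⟨j, hj, a, ha, b, hb, hbx, hab⟩ := hf x hx
  obtain ⟨g, hg, hgx, h1, h2⟩ := hA.compat_poly i j x hi hj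
  obtain ⟨α, hα, N, hN⟩ := h2 a ha
  obtain ⟨β, hβ, M, hM⟩ := h2 b hb
  have key : ∀ y ∈ 𝔸.dom i, g y ≠ 0 → b y ≠ 0 → β y ≠ 0 := fun y hy hgy hby h0 =>
    hby (by rw [hM y hy hgy, h0, zero_div])
  -- The quotient of `α / g ^ N` by `β / g ^ M`, with one more factor `g` above and below: a nonzero
  -- denominator must force `g y ≠ 0` even for `N = 0`.
  refine ⟨α * g ^ (M + 1), mul_mem hα (pow_mem hg _), β * g ^ (N + 1),
    mul_mem hβ (pow_mem hg _), mul_ne_zero (key x hi hgx hbx) (pow_ne_zero _ hgx),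
    fun y hy hy0 => ?_⟩
  have hβy : β y ≠ 0 := left_ne_zero_of_mul hy0
  have hgy : g y ≠ 0 := fun h0 => right_ne_zero_of_mul hy0 (by simp [h0])
  have hby : b y ≠ 0 := by rw [hM y hy.2 hgy]; positivity
  rw [hab y ⟨hy.1, h1 y hy.2 hgy⟩ hby, hN y hy.2 hgy, hM y hy.2 hgy]
  simp only [Pi.mul_apply, Pi.pow_apply]
  field_simp
  ring

/-- Regularity is a local property. -/
theorem regularOn_of_local (hA : 𝔸.Good) {S : Set V} {f : V → k}
    (h : ∀ x ∈ S, ∃ O, IsOpen[𝔸.zariski] O ∧ x ∈ O ∧ 𝔸.RegularOn (S ∩ O) f) :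
    𝔸.RegularOn S f := fun x hx => by
  obtain ⟨O, hO, hxO, hf⟩ := h x hx
  obtain ⟨i, hi, a, ha, b, hb, hbx, hab⟩ := hf x ⟨hx, hxO⟩
  obtain ⟨g, hg, hgx, hgO⟩ := hA.exists_basic hO hi hxO
  refine ⟨i, hi, a * g, mul_mem ha hg, b * g, mul_mem hb hg, mul_ne_zero hbx hgx,
    fun y hy hy0 => ?_⟩
  have h1 : b y ≠ 0 := left_ne_zero_of_mul hy0
  have h2 : g y ≠ 0 := right_ne_zero_of_mul hy0
  rw [hab y ⟨⟨hy.1, hgO y hy.2 h2⟩, hy.2⟩ h1]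
  simp only [Pi.mul_apply]
  field_simp

/-! ### Affine pieces -/

namespace AffinePiece

variable (P : 𝔸.AffinePiece)

/-- The inclusion of an affine piece in the domain of its chart. -/
def incl : P.carrier → 𝔸.dom P.i := fun x => ⟨x.1, x.2.1⟩

theorem coordRing_eq : P.coordRing = locAlg P.incl (𝔸.chartRing P.i) (P.h ∘ Subtype.val) := by
  rw [chartRing, poly, AlgHom.map_adjoin, locAlg_adjoin, coordRing]
  congr 2
  ext g
  constructor
  · rintro ⟨c, hc, rfl⟩; exact ⟨_, ⟨c, hc, rfl⟩, rfl⟩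
  · rintro ⟨_, ⟨c, hc, rfl⟩, rfl⟩; exact ⟨c, hc, rfl⟩

theorem range_incl : Set.range P.incl =
    {x | (∀ e ∈ pull k (Subtype.val : 𝔸.dom P.i → V) '' P.eqs, e x = 0) ∧
      (P.h ∘ Subtype.val) x ≠ 0} := by
  ext ⟨x, hx⟩
  constructor
  · rintro ⟨⟨y, hy⟩, h⟩
    obtain rfl : y = x := congrArg Subtype.val h
    refine ⟨?_, hy.2.2⟩
    rintro _ ⟨e, he, rfl⟩
    exact hy.2.1 e he
  · rintro ⟨h1, h2⟩
    exact ⟨⟨x, hx, fun e he => h1 _ ⟨e, he, rfl⟩, h2⟩, rfl⟩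

theorem image_eqs_subset :
    pull k (Subtype.val : 𝔸.dom P.i → V) '' P.eqs ⊆ 𝔸.chartRing P.i := by
  rintro _ ⟨e, he, rfl⟩; exact ⟨e, P.eqs_subset he, rfl⟩

theorem h_mem_chartRing : P.h ∘ Subtype.val ∈ 𝔸.chartRing P.i := ⟨P.h, P.h_mem, rfl⟩

theorem isAffineAlgebra (hA : 𝔸.Good) : IsAffineAlgebra P.coordRing := by
  rw [coordRing_eq]
  exact (hA.affine P.i).locAlg P.h_mem_chartRing _ P.image_eqs_subset P.range_incl

theorem h_ne_zero (x : P.carrier) : P.h x ≠ 0 := x.2.2.2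

theorem mem_coordRing_iff {f : P.carrier → k} : f ∈ P.coordRing ↔
    ∃ a ∈ 𝔸.poly P.i, ∃ N : ℕ, ∀ x : P.carrier, f x = a x / P.h x ^ N := by
  rw [coordRing_eq, mem_locAlg_iff P.h_mem_chartRing (fun s => s.2.2.2)]
  constructor
  · rintro ⟨_, ⟨a, ha, rfl⟩, N, h⟩; exact ⟨a, ha, N, h⟩
  · rintro ⟨a, ha, N, h⟩; exact ⟨_, ⟨a, ha, rfl⟩, N, h⟩

/-- The coordinate ring of an affine piece is the algebra of its regular functions. -/
theorem mem_coordRing_iff_regularOn [IsAlgClosed k] (hA : 𝔸.Good) {f : V → k} :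
    (fun x : P.carrier => f x) ∈ P.coordRing ↔ 𝔸.RegularOn P.carrier f := by
  constructor
  · intro hf
    obtain ⟨a, ha, N, h⟩ := P.mem_coordRing_iff.mp hf
    intro x hx
    refine ⟨P.i, hx.1, a, ha, P.h ^ N, pow_mem P.h_mem N, pow_ne_zero _ hx.2.2, fun y hy _ => ?_⟩
    exact h ⟨y, hy.1⟩
  · intro hf
    rw [coordRing_eq]
    refine (hA.affine P.i).mem_locAlg_of_regular P.h_mem_chartRing _ P.image_eqs_subset
      P.range_incl _ fun s => ?_
    obtain ⟨a, ha, b, hb, hbx, hab⟩ := hf.chart hA s.2 s.2.1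
    exact ⟨_, ⟨a, ha, rfl⟩, _, ⟨b, hb, rfl⟩, hbx, fun s' hs' => hab s' ⟨s'.2, s'.2.1⟩ hs'⟩

theorem isZariskiFor (hA : 𝔸.Good) :
    letI := 𝔸.zariski
    IsZariskiFor P.coordRing := by
  let _ := 𝔸.zariski
  intro Z
  constructor
  · intro hZ
    refine ⟨{f | f ∈ P.coordRing ∧ ∀ x ∈ Z, f x = 0}, fun f hf => hf.1, ?_⟩
    ext x
    refine ⟨fun hx e he => he.2 x hx, fun hx => ?_⟩
    by_contra hxZ
    obtain ⟨O, hO, hOZ⟩ := isOpen_induced_iff.mp hZ.isOpen_compl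
    have hmem : ∀ y : P.carrier, y.1 ∈ O ↔ y ∉ Z := fun y => by
      have := congrArg (fun S => y ∈ S) hOZ
      exact iff_of_eq this
    obtain ⟨g, hg, hgx, hgO⟩ := hA.exists_basic hO x.2.1 ((hmem x).mpr hxZ)
    refine hgx (hx (fun y => g y) ⟨P.mem_coordRing_iff.mpr ⟨g, hg, 0, fun y => by simp⟩,
      fun y hy => ?_⟩)
    by_contra h0
    exact (hmem y).mp (hgO y y.2.1 h0) hy
  · rintro ⟨E, hE, rfl⟩
    rw [show {x : P.carrier | ∀ e ∈ E, e x = 0} = ⋂ e ∈ E, {x | e x = 0} by ext; simp]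
    refine isClosed_biInter fun e he => ?_
    obtain ⟨a, ha, N, h⟩ := P.mem_coordRing_iff.mp (hE he)
    rw [← isOpen_compl_iff]
    convert! (𝔸.isOpen_basic ha).preimage continuous_subtype_val using 1
    ext x
    have h1 := P.h_ne_zero x
    have h2 := x.2.1
    simp [h x, h1, h2]

end AffinePiece

end Good

end Atlas

namespace Atlas

/-! ### Classes of affine pieces -/

section Classes

variable {k : Type u} [Field k] {V W : Type u} {𝔸 : Atlas k V} {𝔹 : Atlas k W}

/-- Coordinate rings consist of functions on a subset, whereas `RegularOn` speaks of functions on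
all of `V`; extension by zero passes from the former to the latter. -/
theorem exists_extension {S : Set V} (f : S → k) : ∃ F : V → k, f = fun x : S => F x :=
  ⟨Function.extend Subtype.val f 0, by
    ext x; exact (Subtype.val_injective.extend_apply f 0 x).symm⟩

variable (𝔸) in
/-- A set that is an affine piece. -/
def IsAffineSet (S : Set V) : Prop := ∃ P : 𝔸.AffinePiece, P.carrier = S

theorem AffinePiece.isAffineSet (P : 𝔸.AffinePiece) : 𝔸.IsAffineSet P.carrier := ⟨P, rfl⟩

/-- Adding all functions of the chart that vanish on `Z` to the equations suffices, because
principal open sets form a basis: a point of the chart outside `Z` is detected by one of these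
functions. -/
theorem IsAffineSet.inter_closed (hA : 𝔸.Good) {S Z : Set V} (hS : 𝔸.IsAffineSet S)
    (hZ : IsClosed[𝔸.zariski] Z) : 𝔸.IsAffineSet (S ∩ Z) := by
  obtain ⟨P, rfl⟩ := hS
  refine ⟨⟨P.i, P.eqs ∪ {g | g ∈ 𝔸.poly P.i ∧ ∀ x ∈ 𝔸.dom P.i ∩ Z, g x = 0},
    Set.union_subset P.eqs_subset fun g hg => hg.1, P.h, P.h_mem⟩, ?_⟩
  ext x
  constructor
  · rintro ⟨h1, h2, h3⟩
    refine ⟨⟨h1, fun g hg => h2 g (Or.inl hg), h3⟩, ?_⟩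
    by_contra hx
    obtain ⟨g, hg, hgx, hgO⟩ := hA.exists_basic
      ((@isOpen_compl_iff _ _ 𝔸.zariski).mpr hZ) h1 hx
    refine hgx (h2 g (Or.inr ⟨hg, fun y hy => ?_⟩))
    by_contra h0
    exact hgO y hy.1 h0 hy.2
  · rintro ⟨⟨h1, h2, h3⟩, hx⟩
    refine ⟨h1, ?_, h3⟩
    rintro g (hg | hg)
    · exact h2 g hg
    · exact hg.2 x ⟨h1, hx⟩

section

variable [IsAlgClosed k]

/-- On an affine piece a regular function is globally of the form `a / h ^ N`, so it is nonzero
exactly where `a` is. -/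
theorem IsAffineSet.inter_ne (hA : 𝔸.Good) {S : Set V} (hS : 𝔸.IsAffineSet S) {f : V → k}
    (hf : 𝔸.RegularOn S f) : 𝔸.IsAffineSet (S ∩ {x | f x ≠ 0}) := by
  obtain ⟨P, rfl⟩ := hS
  obtain ⟨a, ha, N, hN⟩ := P.mem_coordRing_iff.mp ((P.mem_coordRing_iff_regularOn hA).mpr hf)
  refine ⟨⟨P.i, P.eqs, P.eqs_subset, P.h * a, mul_mem P.h_mem ha⟩, ?_⟩
  ext x
  constructor
  · rintro ⟨h1, h2, h3⟩
    have h4 : P.h x ≠ 0 := left_ne_zero_of_mul h3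
    have h5 : a x ≠ 0 := right_ne_zero_of_mul h3
    have hx : x ∈ P.carrier := ⟨h1, h2, h4⟩
    refine ⟨hx, ?_⟩
    have := hN ⟨x, hx⟩
    simp only at this
    change f x ≠ 0
    rw [this]; positivity
  · rintro ⟨hx, h0⟩
    refine ⟨hx.1, hx.2.1, mul_ne_zero hx.2.2 fun h => h0 ?_⟩
    have := hN ⟨x, hx⟩
    simp only at this
    rw [this, h, zero_div]

theorem IsAffineSet.inter_eq (hA : 𝔸.Good) {S : Set V} (hS : 𝔸.IsAffineSet S) {f : V → k}
    (hf : 𝔸.RegularOn S f) : 𝔸.IsAffineSet (S ∩ {x | f x = 0}) := by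
  obtain ⟨P, rfl⟩ := hS
  obtain ⟨a, ha, N, hN⟩ := P.mem_coordRing_iff.mp ((P.mem_coordRing_iff_regularOn hA).mpr hf)
  refine ⟨⟨P.i, P.eqs ∪ {a}, Set.union_subset P.eqs_subset (by simpa using ha), P.h, P.h_mem⟩, ?_⟩
  ext x
  constructor
  · rintro ⟨h1, h2, h3⟩
    have hx : x ∈ P.carrier := ⟨h1, fun g hg => h2 g (Or.inl hg), h3⟩
    refine ⟨hx, ?_⟩
    have := hN ⟨x, hx⟩
    simp only at this
    change f x = 0
    rw [this, h2 a (Or.inr rfl), zero_div]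
  · rintro ⟨hx, h0⟩
    refine ⟨hx.1, ?_, hx.2.2⟩
    rintro g (hg | rfl)
    · exact hx.2.1 g hg
    · have := hN ⟨x, hx⟩
      simp only at this
      have h0' : f x = 0 := h0
      rw [this, div_eq_zero_iff] at h0'
      exact h0'.resolve_right (pow_ne_zero _ hx.2.2)

/-- Both sides consist of the regular functions on the smaller piece. This characterization does not
see the charts, so `P` and `Q` may be given in different ones. -/
theorem AffinePiece.coordRing_eq_locAlg (hA : 𝔸.Good) (P Q : 𝔸.AffinePiece)
    (ι : Q.carrier → P.carrier) (hι : ∀ x, (ι x).1 = x.1) (E : Set (P.carrier → k))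
    (hE : E ⊆ P.coordRing) {h : P.carrier → k} (hh : h ∈ P.coordRing)
    (hr : Set.range ι = {x | (∀ e ∈ E, e x = 0) ∧ h x ≠ 0}) :
    Q.coordRing = locAlg ι P.coordRing h := by
  have hι0 : ∀ s, h (ι s) ≠ 0 := fun s => by
    have : ι s ∈ Set.range ι := ⟨s, rfl⟩
    rw [hr] at this; exact this.2
  have hsub : Q.carrier ⊆ P.carrier := fun x hx => by
    have := (ι ⟨x, hx⟩).2
    rwa [hι] at this
  apply le_antisymm
  · intro f hf
    obtain ⟨f, rfl⟩ := exists_extension f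
    rw [Q.mem_coordRing_iff_regularOn hA] at hf
    refine (P.isAffineAlgebra hA).mem_locAlg_of_regular hh E hE hr _ fun s => ?_
    obtain ⟨a, ha, b, hb, hbx, hab⟩ := hf.chart hA s.2 (hsub s.2).1
    refine ⟨fun x => a x, P.mem_coordRing_iff.mpr ⟨a, ha, 0, by simp⟩, fun x => b x,
      P.mem_coordRing_iff.mpr ⟨b, hb, 0, by simp⟩, ?_, fun s' hs' => ?_⟩
    · simpa [hι] using hbx
    · simp only [hι] at hs' ⊢
      exact hab s' ⟨s'.2, (hsub s'.2).1⟩ hs'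
  · refine Algebra.adjoin_le (Set.union_subset ?_ ?_)
    · rintro _ ⟨g, hg, rfl⟩
      obtain ⟨g, rfl⟩ := exists_extension g
      have : pull k ι (fun x : P.carrier => g x) = fun x : Q.carrier => g x := by
        ext x; simp [hι]
      rw [this]
      exact (Q.mem_coordRing_iff_regularOn hA).mpr
        (((P.mem_coordRing_iff_regularOn hA).mp hg).mono hsub)
    · rw [Set.singleton_subset_iff]
      obtain ⟨g, rfl⟩ := exists_extension h
      have : (fun s => (g (ι s))⁻¹) = fun x : Q.carrier => (g x)⁻¹ := by
        ext x; simp [hι]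
      rw [this]
      refine (Q.mem_coordRing_iff_regularOn (f := fun x => (g x)⁻¹) hA).mpr
        ((((P.mem_coordRing_iff_regularOn hA).mp hh).mono hsub).inv fun x hx => ?_)
      have := hι0 ⟨x, hx⟩
      simpa [hι] using this

/-- Isomorphic affine pieces have the same class. -/
theorem AffinePiece.cls_congr (hA : 𝔸.Good) (hB : 𝔹.Good) (P : 𝔸.AffinePiece) (Q : 𝔹.AffinePiece)
    (φ : V → W) (ψ : W → V) (hφ : Set.MapsTo φ P.carrier Q.carrier)
    (hψ : Set.MapsTo ψ Q.carrier P.carrier) (h1 : Set.LeftInvOn ψ φ P.carrier)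
    (h2 : Set.RightInvOn ψ φ Q.carrier)
    (hreg : ∀ g, 𝔹.RegularOn Q.carrier g → 𝔸.RegularOn P.carrier (g ∘ φ))
    (hreg' : ∀ g, 𝔸.RegularOn P.carrier g → 𝔹.RegularOn Q.carrier (g ∘ ψ)) :
    M.cls k (specOver k P.coordRing) = M.cls k (specOver k Q.coordRing) := by
  let e : P.carrier ≃ Q.carrier :=
    { toFun := fun x => ⟨φ x, hφ x.2⟩
      invFun := fun y => ⟨ψ y, hψ y.2⟩
      left_inv := fun x => Subtype.ext (h1 x.2)
      right_inv := fun y => Subtype.ext (h2 y.2) }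
  have := isReduced_functions Q.coordRing
  have := (Q.isAffineAlgebra hB).finiteType
  refine (M.cls_specOver_congr (algEquivOfEquiv P.coordRing Q.coordRing e fun g => ?_)).symm
  obtain ⟨g, rfl⟩ := exists_extension g
  have h3 : (fun x : Q.carrier => g x) ∘ e = fun x : P.carrier => (g ∘ φ) x := rfl
  rw [h3, P.mem_coordRing_iff_regularOn hA, Q.mem_coordRing_iff_regularOn hB]
  refine ⟨hreg g, fun h => (hreg' _ h).congr fun y hy => ?_⟩
  simp only [Function.comp_apply, h2 hy]

open Classical in
variable (𝔸) in
/-- The class of a set that is an affine piece. -/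
def affineCls (S : Set V) : M k :=
  if h : 𝔸.IsAffineSet S then M.cls k (specOver k h.choose.coordRing) else 0

/-- Two presentations of one set as an affine piece are isomorphic through the identity, so the
choice made in `affineCls` is harmless. -/
theorem affineCls_carrier (hA : 𝔸.Good) (P : 𝔸.AffinePiece) :
    𝔸.affineCls P.carrier = M.cls k (specOver k P.coordRing) := by
  have h : 𝔸.IsAffineSet P.carrier := P.isAffineSet
  rw [affineCls, dif_pos h]
  have hc := h.choose_spec
  refine AffinePiece.cls_congr hA hA _ _ id id ?_ ?_ ?_ ?_ ?_ ?_
  · rw [hc]; exact Set.mapsTo_id _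
  · rw [hc]; exact Set.mapsTo_id _
  · exact fun _ _ => rfl
  · exact fun _ _ => rfl
  · rw [hc]; exact fun g hg => hg
  · rw [hc]; exact fun g hg => hg

theorem affineCls_eq_add (hA : 𝔸.Good) {S : Set V} (hS : 𝔸.IsAffineSet S) {f : V → k}
    (hf : 𝔸.RegularOn S f) :
    𝔸.affineCls S = 𝔸.affineCls (S ∩ {x | f x ≠ 0}) + 𝔸.affineCls (S ∩ {x | f x = 0}) := by
  obtain ⟨Q, hQ⟩ := hS.inter_ne hA hf
  obtain ⟨Z, hZ⟩ := hS.inter_eq hA hf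
  obtain ⟨P, rfl⟩ := hS
  have hfm := (P.mem_coordRing_iff_regularOn hA).mpr hf
  let ι : Q.carrier → P.carrier := fun x => ⟨x.1, (hQ.le x.2).1⟩
  let κ : Z.carrier → P.carrier := fun x => ⟨x.1, (hZ.le x.2).1⟩
  have hι : Set.range ι = {x : P.carrier | f x ≠ 0} := by
    ext x
    constructor
    · rintro ⟨y, rfl⟩; exact (hQ.le y.2).2
    · intro hx; exact ⟨⟨x.1, hQ.ge ⟨x.2, hx⟩⟩, rfl⟩
  have hκ : Set.range κ = {x : P.carrier | f x = 0} := by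
    ext x
    constructor
    · rintro ⟨y, rfl⟩; exact (hZ.le y.2).2
    · intro hx; exact ⟨⟨x.1, hZ.ge ⟨x.2, hx⟩⟩, rfl⟩
  rw [← hQ, ← hZ, affineCls_carrier hA, affineCls_carrier hA, affineCls_carrier hA,
    (P.isAffineAlgebra hA).cls_eq_add hfm ι κ hι hκ, add_comm,
    ← AffinePiece.coordRing_eq_locAlg hA P Q ι (fun _ => rfl) ∅ (Set.empty_subset _) hfm
      (by simp [hι]),
    ← AffinePiece.coordRing_eq_locAlg hA P Z κ (fun _ => rfl) {fun x : P.carrier => f x}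
      (by simpa using hfm) (one_mem _) (by simp [hκ])]

/-- The scissor relation for the empty set says that its class is twice itself. -/
theorem affineCls_empty (hA : 𝔸.Good) : 𝔸.affineCls ∅ = 0 := by
  by_cases h : 𝔸.IsAffineSet ∅
  · have := affineCls_eq_add hA h (f := 0) (fun x hx => absurd hx (Set.notMem_empty x))
    simpa using this
  · rw [affineCls, dif_neg h]

end

end Classes

end Atlas

namespace Atlas

/-! ### Noetherian induction and finite decompositions into affine pieces -/

section Cells

variable {k : Type u} [Field k] {V W : Type u} {𝔸 : Atlas k V} {𝔹 : Atlas k W}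

/-- A chart as an affine piece. -/
def chartPiece (𝔸 : Atlas k V) (i : 𝔸.ι) : 𝔸.AffinePiece := ⟨i, ∅, Set.empty_subset _, 1, one_mem _⟩

@[simp] theorem chartPiece_carrier (i : 𝔸.ι) : (𝔸.chartPiece i).carrier = 𝔸.dom i := by
  ext x; simp [AffinePiece.carrier, chartPiece]

theorem isAffineSet_dom (i : 𝔸.ι) : 𝔸.IsAffineSet (𝔸.dom i) := ⟨_, chartPiece_carrier i⟩

theorem Good.exists_mem_dom (hA : 𝔸.Good) (x : V) : ∃ i, x ∈ 𝔸.dom i := by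
  obtain ⟨s, hs⟩ := hA.cover
  obtain ⟨i, -, hi⟩ := hs x
  exact ⟨i, hi⟩

theorem Good.isAffineSet_singleton (hA : 𝔸.Good) (x : V) : 𝔸.IsAffineSet {x} := by
  obtain ⟨i, hi⟩ := hA.exists_mem_dom x
  refine ⟨⟨i, {g | ∃ c ∈ 𝔸.coord i, g = c - algebraMap k (V → k) (c x)}, ?_, 1, one_mem _⟩, ?_⟩
  · rintro _ ⟨c, hc, rfl⟩
    exact sub_mem (Algebra.subset_adjoin hc) (Subalgebra.algebraMap_mem _ _)
  · ext y
    constructor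
    · rintro ⟨h1, h2, -⟩
      refine hA.sep i y h1 x hi fun c hc => ?_
      have := h2 _ ⟨c, hc, rfl⟩
      simpa [sub_eq_zero] using this
    · rintro rfl
      refine ⟨hi, ?_, one_ne_zero⟩
      rintro _ ⟨c, hc, rfl⟩
      simp

theorem IsAffineSet.locClosed {S : Set V} (hS : 𝔸.IsAffineSet S) :
    𝔸.LocClosed S := by
  obtain ⟨P, rfl⟩ := hS
  refine ⟨{x | x ∈ 𝔸.dom P.i ∧ P.h x ≠ 0},
    (⋃ g ∈ P.eqs, {x | x ∈ 𝔸.dom P.i ∧ g x ≠ 0})ᶜ, 𝔸.isOpen_basic P.h_mem, ?_, ?_⟩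
  · let _ := 𝔸.zariski
    exact (isOpen_biUnion fun g hg => 𝔸.isOpen_basic (P.eqs_subset hg)).isClosed_compl
  · ext x
    simp only [AffinePiece.carrier, Set.mem_ofPred_eq, Set.mem_inter_iff, Set.mem_compl_iff,
      Set.mem_iUnion, not_exists, not_and, not_not]
    tauto

/-- Nonempty finite unions of locally closed sets have a nonempty relatively open subset that is
contained in one of them. -/
theorem exists_isOpen_inter_subset {X ι : Type*} [TopologicalSpace X] (L : ι → Set X) (s : Finset ι)
    (hL : ∀ i ∈ s, IsLocallyClosed (L i)) {K : Set X} (hK : K.Nonempty)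
    (hs : K ⊆ ⋃ i ∈ s, L i) :
    ∃ i ∈ s, ∃ O, IsOpen O ∧ (O ∩ K).Nonempty ∧ O ∩ K ⊆ L i := by
  classical
  have key : ∀ s : Finset ι, (∀ i ∈ s, IsLocallyClosed (L i)) → ∀ O', IsOpen O' →
      (O' ∩ K).Nonempty → O' ∩ K ⊆ ⋃ i ∈ s, L i →
      ∃ i ∈ s, ∃ O, IsOpen O ∧ (O ∩ K).Nonempty ∧ O ∩ K ⊆ L i := by
    intro s
    induction s using Finset.induction_on with
    | empty =>
      intro _ O' _ hne hsub
      obtain ⟨x, hx⟩ := hne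
      simpa using hsub hx
    | insert a s _ ih =>
      intro hL O' hO' hne hsub
      -- Either a nonempty relatively open part of `O' ∩ K` avoids `L a`, and `a` can be dropped; or
      -- `L a` is dense in `O' ∩ K`, and then the closed factor `Z` of `L a = U ∩ Z` contains all of
      -- `O' ∩ K`.
      by_cases h : ∃ O'', IsOpen O'' ∧ (O'' ∩ O' ∩ K).Nonempty ∧ ∀ x ∈ O'' ∩ O' ∩ K, x ∉ L a
      · obtain ⟨O'', hO'', hne', hdis⟩ := h
        obtain ⟨i, hi, h⟩ := ih (fun i hi => hL i (Finset.mem_insert_of_mem hi)) (O'' ∩ O')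
          (hO''.inter hO') hne' (fun x hx => by
            have := hsub ⟨hx.1.2, hx.2⟩
            simp only [Finset.mem_insert, Set.iUnion_iUnion_eq_or_left, Set.mem_union] at this
            exact this.resolve_left (hdis x hx))
        exact ⟨i, Finset.mem_insert_of_mem hi, h⟩
      · push Not at h
        obtain ⟨U, Z, hU, hZ, hUZ⟩ := hL a (Finset.mem_insert_self _ _)
        have hsubZ : O' ∩ K ⊆ Z := by
          intro x hx
          by_contra hxZ
          obtain ⟨y, hy, hya⟩ := h Zᶜ hZ.isOpen_compl ⟨x, ⟨hxZ, hx.1⟩, hx.2⟩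
          rw [hUZ] at hya
          exact hy.1.1 hya.2
        obtain ⟨x, hx, hxa⟩ := h Set.univ isOpen_univ (by simpa using hne)
        refine ⟨a, Finset.mem_insert_self _ _, O' ∩ U, hO'.inter hU,
          ⟨x, ⟨hx.1.2, (hUZ.le hxa).1⟩, hx.2⟩, fun y hy => ?_⟩
        rw [hUZ]
        exact ⟨hy.1.2, hsubZ ⟨hy.1.1, hy.2⟩⟩
  exact key s hL Set.univ isOpen_univ (by simpa using hK) (by simpa using hs)

theorem Good.noetherianSpace (hA : 𝔸.Good) : @TopologicalSpace.NoetherianSpace V 𝔸.zariski := by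
  let _ := 𝔸.zariski
  obtain ⟨s, hs⟩ := hA.cover
  rw [← TopologicalSpace.noetherian_univ_iff]
  have h1 : ∀ i : s, TopologicalSpace.NoetherianSpace (𝔸.dom i) := fun i => by
    rw [← chartPiece_carrier]
    exact ((𝔸.chartPiece i.1).isZariskiFor hA).noetherianSpace
      ((𝔸.chartPiece i.1).isAffineAlgebra hA)
  have h2 : (Set.univ : Set V) = ⋃ i : s, 𝔸.dom i := by
    ext x
    obtain ⟨i, hi, hx⟩ := hs x
    simp only [Set.mem_univ, Set.mem_iUnion, true_iff]
    exact ⟨⟨i, hi⟩, hx⟩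
  rw [h2]
  exact TopologicalSpace.NoetherianSpace.iUnion _

/-- Noetherian induction on closed sets; it replaces any discussion of how affine pieces of
different charts intersect. -/
theorem Good.closed_induction (hA : 𝔸.Good) (p : Set V → Prop)
    (h : ∀ Z, IsClosed[𝔸.zariski] Z → (∀ Z', IsClosed[𝔸.zariski] Z' → Z' ⊂ Z → p Z') → p Z) :
    ∀ Z, IsClosed[𝔸.zariski] Z → p Z := by
  let _ := 𝔸.zariski
  have := hA.noetherianSpace
  have hwf : WellFoundedLT (TopologicalSpace.Closeds V) :=
    (TopologicalSpace.noetherianSpace_TFAE V).out 0 1 |>.mp this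
  intro Z hZ
  have key : ∀ Z : TopologicalSpace.Closeds V, p Z := fun Z => by
    induction Z using hwf.induction with
    | _ Z ih => exact h Z Z.2 fun Z' hZ' hlt => ih ⟨Z', hZ'⟩ hlt
  exact key ⟨Z, hZ⟩

section

variable [IsAlgClosed k]

/-- The class of an affine piece is the sum of the classes of the members of a finite decomposition
into affine pieces, of whatever charts. -/
theorem affineCls_eq_sum (hA : 𝔸.Good) {ι : Type*} [Fintype ι] {S : Set V} (hS : 𝔸.IsAffineSet S)
    (R : ι → Set V) (hR : ∀ i, 𝔸.IsAffineSet (R i)) (hdis : Pairwise (Function.onFun Disjoint R))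
    (hSR : S = ⋃ i, R i) : 𝔸.affineCls S = ∑ i, 𝔸.affineCls (R i) := by
  -- The equality is proved for the intersections with every closed `Z`. Some nonempty principal
  -- open part of `S ∩ Z` lies in a single `R i₀`, where the equality is trivial; what remains is
  -- cut out by a smaller closed set.
  have key := hA.closed_induction
    (fun Z => 𝔸.affineCls (S ∩ Z) = ∑ i, 𝔸.affineCls (R i ∩ Z)) ?_
  · have := key Set.univ (@isClosed_univ _ 𝔸.zariski)
    simpa using this
  intro Z hZ ih
  have hsub : ∀ i, R i ⊆ S := fun i => hSR ▸ Set.subset_iUnion R i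
  by_cases hne : (S ∩ Z).Nonempty
  swap
  · have h1 : S ∩ Z = ∅ := Set.not_nonempty_iff_eq_empty.mp hne
    have h2 : ∀ i, R i ∩ Z = ∅ := fun i =>
      Set.subset_empty_iff.mp (h1 ▸ Set.inter_subset_inter_left Z (hsub i))
    simp [h1, h2, affineCls_empty hA]
  obtain ⟨i₀, -, O, hO, ⟨x, hxO, hx⟩, hOR⟩ := @exists_isOpen_inter_subset V ι 𝔸.zariski R
    Finset.univ (fun i _ => (hR i).locClosed) (S ∩ Z) hne
    (fun x hx => by simpa [hSR] using hx.1)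
  obtain ⟨P, hP⟩ := hS
  have hSdom : S ⊆ 𝔸.dom P.i := fun y hy => (hP.ge hy).1
  obtain ⟨g, hg, hgx, hgO⟩ := hA.exists_basic hO (hSdom hx.1) hxO
  have hZ' : IsClosed[𝔸.zariski] (Z \ {y | y ∈ 𝔸.dom P.i ∧ g y ≠ 0}) := by
    let _ := 𝔸.zariski
    exact hZ.sdiff (𝔸.isOpen_basic hg)
  have ih' := ih _ hZ' ⟨Set.sdiff_subset, fun h => (h hx.2).2 ⟨hSdom hx.1, hgx⟩⟩
  have heq : ∀ A ⊆ S, A ∩ Z ∩ {x | g x = 0} = A ∩ (Z \ {y | y ∈ 𝔸.dom P.i ∧ g y ≠ 0}) := by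
    intro A hA
    ext y
    simp only [Set.mem_inter_iff, Set.mem_ofPred_eq, Set.mem_sdiff, not_and, not_not]
    constructor
    · rintro ⟨⟨h1, h2⟩, h3⟩; exact ⟨h1, h2, fun _ => h3⟩
    · rintro ⟨h1, h2, h3⟩; exact ⟨⟨h1, h2⟩, h3 (hSdom (hA h1))⟩
  have hreg : ∀ A ⊆ S, 𝔸.RegularOn (A ∩ Z) g := fun A hA =>
    regularOn_poly (fun y hy => hSdom (hA hy.1)) hg
  have hopen : S ∩ Z ∩ {x | g x ≠ 0} ⊆ R i₀ := fun y hy =>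
    hOR ⟨hgO y (hSdom hy.1.1) hy.2, hy.1⟩
  rw [affineCls_eq_add hA (IsAffineSet.inter_closed hA ⟨P, hP⟩ hZ) (hreg S subset_rfl),
    heq S subset_rfl, ih',
    Finset.sum_congr rfl fun i _ => affineCls_eq_add hA ((hR i).inter_closed hA hZ)
      (hreg (R i) (hsub i)), Finset.sum_add_distrib,
    Finset.sum_congr rfl fun i _ => congrArg 𝔸.affineCls (heq (R i) (hsub i))]
  congr 1
  rw [Finset.sum_eq_single i₀]
  · congr 1
    ext y
    exact ⟨fun hy => ⟨⟨hopen hy, hy.1.2⟩, hy.2⟩, fun hy => ⟨⟨hsub i₀ hy.1.1, hy.1.2⟩, hy.2⟩⟩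
  · intro i _ hi
    convert! affineCls_empty hA
    rw [Set.eq_empty_iff_forall_notMem]
    intro y hy
    exact Set.disjoint_left.mp (hdis hi) hy.1.1 (hopen ⟨⟨hsub i hy.1.1, hy.1.2⟩, hy.2⟩)
  · intro h; exact absurd (Finset.mem_univ _) h

end

variable (𝔸) in
/-- Finite disjoint unions of affine pieces. -/
inductive Cells : Set V → Prop
  | empty : Cells ∅
  | piece (P : 𝔸.AffinePiece) : Cells P.carrier
  | union {A B : Set V} : Disjoint A B → Cells A → Cells B → Cells (A ∪ B)

theorem IsAffineSet.cells {S : Set V} (hS : 𝔸.IsAffineSet S) : 𝔸.Cells S := by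
  obtain ⟨P, rfl⟩ := hS; exact .piece P

theorem Cells.inter_closed (hA : 𝔸.Good) {S Z : Set V} (hS : 𝔸.Cells S)
    (hZ : IsClosed[𝔸.zariski] Z) : 𝔸.Cells (S ∩ Z) := by
  induction hS with
  | empty => rw [Set.empty_inter]; exact .empty
  | piece P => exact (P.isAffineSet.inter_closed hA hZ).cells
  | union h _ _ h1 h2 =>
    rw [Set.union_inter_distrib_right]
    exact .union (h.mono Set.inter_subset_left Set.inter_subset_left) h1 h2

theorem Cells.exists_pieces {S : Set V} (hS : 𝔸.Cells S) :
    ∃ (ι : Type) (_ : Fintype ι) (P : ι → 𝔸.AffinePiece),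
      Pairwise (Function.onFun Disjoint fun j => (P j).carrier) ∧ S = ⋃ j, (P j).carrier := by
  induction hS with
  | empty => exact ⟨Empty, inferInstance, Empty.elim, fun i => i.elim, by simp⟩
  | piece P => exact ⟨Unit, inferInstance, fun _ => P, fun i j h => absurd rfl h, (Set.iUnion_const _).symm⟩
  | union hdis _ _ h1 h2 =>
    obtain ⟨ι, _, P, hP, rfl⟩ := h1
    obtain ⟨κ, _, Q, hQ, rfl⟩ := h2
    refine ⟨ι ⊕ κ, inferInstance, Sum.elim P Q, ?_, by simp [Set.iUnion_sum]⟩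
    simp only [Set.disjoint_iUnion_left, Set.disjoint_iUnion_right] at hdis
    rintro (i | i) (j | j) hij
    · exact hP (fun h => hij (h ▸ rfl))
    · exact hdis j i
    · exact (hdis i j).symm
    · exact hQ (fun h => hij (h ▸ rfl))

theorem Cells.exists_decomposition {S : Set V} (hS : 𝔸.Cells S) :
    ∃ D : (r : ℕ) × (Fin r → 𝔸.AffinePiece), 𝔸.IsDecomposition S D.1 D.2 := by
  obtain ⟨ι, _, P, hP, rfl⟩ := hS.exists_pieces
  let e := Fintype.equivFin ι
  refine ⟨⟨Fintype.card ι, P ∘ e.symm⟩, fun i j hij => hP (e.symm.injective.ne hij), ?_⟩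
  exact (e.symm.surjective.iUnion_comp (fun j => (P j).carrier)).symm

theorem Cells.constructible {S : Set V} (hS : 𝔸.Cells S) : 𝔸.Constructible S := by
  induction hS with
  | empty => exact ⟨0, Fin.elim0, fun j => j.elim0, by simp⟩
  | piece P => exact ⟨1, fun _ => P.carrier, fun _ => P.isAffineSet.locClosed,
    (Set.iUnion_const _).symm⟩
  | union _ _ _ h1 h2 =>
    obtain ⟨r, S, hS, rfl⟩ := h1
    obtain ⟨r', S', hS', rfl⟩ := h2
    refine ⟨r + r', Fin.append S S', fun j => ?_, ?_⟩
    · refine Fin.addCases (fun j => ?_) (fun j => ?_) j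
      · rw [Fin.append_left]; exact hS j
      · rw [Fin.append_right]; exact hS' j
    · ext x
      simp only [Set.mem_union, Set.mem_iUnion]
      constructor
      · rintro (⟨j, hj⟩ | ⟨j, hj⟩)
        · exact ⟨Fin.castAdd r' j, by rwa [Fin.append_left]⟩
        · exact ⟨Fin.natAdd r j, by rwa [Fin.append_right]⟩
      · rintro ⟨j, hj⟩
        revert hj
        refine Fin.addCases (fun j => ?_) (fun j => ?_) j
        · rw [Fin.append_left]; exact fun h => Or.inl ⟨j, h⟩
        · rw [Fin.append_right]; exact fun h => Or.inr ⟨j, h⟩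

variable [IsAlgClosed k]

/-- An open subset of an affine piece need not be affine. Noetherian induction removes one principal
open subset at a time. -/
theorem Cells.inter_open (hA : 𝔸.Good) {S O : Set V} (hS : 𝔸.Cells S)
    (hO : IsOpen[𝔸.zariski] O) : 𝔸.Cells (S ∩ O) := by
  induction hS with
  | empty => rw [Set.empty_inter]; exact .empty
  | union h _ _ h1 h2 =>
    rw [Set.union_inter_distrib_right]
    exact .union (h.mono Set.inter_subset_left Set.inter_subset_left) h1 h2
  | piece P =>
    have key := hA.closed_induction (fun Z => 𝔸.Cells (P.carrier ∩ O ∩ Z)) ?_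
    · have := key Set.univ (@isClosed_univ _ 𝔸.zariski)
      simpa using this
    intro Z hZ ih
    by_cases hne : (P.carrier ∩ O ∩ Z).Nonempty
    swap
    · rw [Set.not_nonempty_iff_eq_empty.mp hne]; exact .empty
    obtain ⟨x, ⟨hxP, hxO⟩, hxZ⟩ := hne
    obtain ⟨g, hg, hgx, hgO⟩ := hA.exists_basic hO hxP.1 hxO
    have hZ' : IsClosed[𝔸.zariski] (Z \ {y | y ∈ 𝔸.dom P.i ∧ g y ≠ 0}) := by
      let _ := 𝔸.zariski
      exact hZ.sdiff (𝔸.isOpen_basic hg)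
    have ih' := ih _ hZ' ⟨Set.sdiff_subset, fun h => (h hxZ).2 ⟨hxP.1, hgx⟩⟩
    have h1 : 𝔸.IsAffineSet (P.carrier ∩ Z ∩ {x | g x ≠ 0}) :=
      (P.isAffineSet.inter_closed hA hZ).inter_ne hA
        (regularOn_poly (fun y hy => hy.1.1) hg)
    have h2 : P.carrier ∩ O ∩ Z = (P.carrier ∩ Z ∩ {x | g x ≠ 0}) ∪
        (P.carrier ∩ O ∩ (Z \ {y | y ∈ 𝔸.dom P.i ∧ g y ≠ 0})) := by
      ext y
      by_cases hy : g y = 0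
      · simp [hy]
      · simp only [Set.mem_inter_iff, Set.mem_union, Set.mem_ofPred_eq, Set.mem_sdiff, hy,
          ne_eq, not_false_eq_true, and_true]
        constructor
        · rintro ⟨⟨h1, h2⟩, h3⟩; exact Or.inl ⟨h1, h3⟩
        · rintro (⟨h1, h2⟩ | ⟨⟨h1, h2⟩, h3, h4⟩)
          · exact ⟨⟨h1, hgO y h1.1 hy⟩, h2⟩
          · exact ⟨⟨h1, h2⟩, h3⟩
    rw [h2]
    refine .union ?_ h1.cells ih'
    rw [Set.disjoint_left]
    rintro y ⟨⟨hy, -⟩, hgy⟩ ⟨-, -, h3⟩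
    exact h3 ⟨hy.1, hgy⟩

theorem Cells.inter_locClosed (hA : 𝔸.Good) {S L : Set V} (hS : 𝔸.Cells S)
    (hL : 𝔸.LocClosed L) : 𝔸.Cells (S ∩ L) := by
  obtain ⟨U, Z, hU, hZ, rfl⟩ := hL
  rw [← Set.inter_assoc]
  exact (hS.inter_open hA hU).inter_closed hA hZ

theorem Cells.diff_locClosed (hA : 𝔸.Good) {S L : Set V} (hS : 𝔸.Cells S)
    (hL : 𝔸.LocClosed L) : 𝔸.Cells (S \ L) := by
  obtain ⟨U, Z, hU, hZ, rfl⟩ := hL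
  have : S \ (U ∩ Z) = (S ∩ Uᶜ) ∪ (S ∩ U ∩ Zᶜ) := by
    ext x; simp only [Set.mem_sdiff, Set.mem_inter_iff, Set.mem_union, Set.mem_compl_iff]; tauto
  rw [this]
  let _ := 𝔸.zariski
  refine .union ?_ (hS.inter_closed hA hU.isClosed_compl)
    ((hS.inter_open hA hU).inter_open hA hZ.isOpen_compl)
  rw [Set.disjoint_left]
  exact fun x h1 h2 => h1.2 h2.1.2

theorem Cells.inter_biUnion (hA : 𝔸.Good) {ι : Type*} (L : ι → Set V) (s : Finset ι)
    (hL : ∀ i ∈ s, 𝔸.LocClosed (L i)) {S : Set V} (hS : 𝔸.Cells S) :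
    𝔸.Cells (S ∩ ⋃ i ∈ s, L i) := by
  classical
  induction s using Finset.induction_on generalizing S with
  | empty => simpa using Cells.empty
  | insert a s _ ih =>
    have h1 := hL a (Finset.mem_insert_self _ _)
    have : S ∩ ⋃ i ∈ insert a s, L i = (S ∩ L a) ∪ ((S \ L a) ∩ ⋃ i ∈ s, L i) := by
      ext x
      by_cases hx : x ∈ L a <;> simp [hx]
    rw [this]
    refine .union ?_ (hS.inter_locClosed hA h1)
      (ih (fun i hi => hL i (Finset.mem_insert_of_mem hi)) (hS.diff_locClosed hA h1))
    rw [Set.disjoint_left]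
    exact fun x h1 h2 => h2.1.2 h1.2

theorem Cells.univ (hA : 𝔸.Good) : 𝔸.Cells Set.univ := by
  classical
  obtain ⟨s, hs⟩ := hA.cover
  have key : ∀ s : Finset 𝔸.ι, 𝔸.Cells (⋃ i ∈ s, 𝔸.dom i) := by
    intro s
    induction s using Finset.induction_on with
    | empty => simpa using Cells.empty
    | insert a s _ ih =>
      have : ⋃ i ∈ insert a s, 𝔸.dom i = 𝔸.dom a ∪ ((⋃ i ∈ s, 𝔸.dom i) \ 𝔸.dom a) := by
        simp
      rw [this]
      exact .union Set.disjoint_sdiff_right (isAffineSet_dom a).cells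
        (ih.diff_locClosed hA ((isAffineSet_dom a).locClosed))
  convert! key s
  ext x
  simpa using hs x

theorem LocClosed.cells (hA : 𝔸.Good) {S : Set V} (hS : 𝔸.LocClosed S) : 𝔸.Cells S := by
  simpa using (Cells.univ hA).inter_locClosed hA hS

theorem cells_iUnion (hA : 𝔸.Good) {ι : Type*} [Fintype ι] (L : ι → Set V)
    (hL : ∀ i, 𝔸.LocClosed (L i)) : 𝔸.Cells (⋃ i, L i) := by
  simpa using (Cells.univ hA).inter_biUnion hA L Finset.univ (fun i _ => hL i)

theorem Cells.diff (hA : 𝔸.Good) {S T : Set V} (hS : 𝔸.Cells S) (hT : 𝔸.Cells T) :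
    𝔸.Cells (S \ T) := by
  induction hT generalizing S with
  | empty => simpa using hS
  | piece P => exact hS.diff_locClosed hA (P.isAffineSet.locClosed)
  | union _ _ _ h1 h2 => rw [← Set.sdiff_sdiff]; exact h2 (h1 hS)

theorem Cells.sup (hA : 𝔸.Good) {S T : Set V} (hS : 𝔸.Cells S) (hT : 𝔸.Cells T) :
    𝔸.Cells (S ∪ T) := by
  rw [← Set.union_sdiff_self]
  exact .union Set.disjoint_sdiff_right hS (hT.diff hA hS)

end Cells

end Atlas

namespace Atlas

/-! ### Morphisms -/

section Morphisms

variable {k : Type u} [Field k] {V W : Type u} {𝔸 : Atlas k V} {𝔹 : Atlas k W}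

theorem MorphismOn.locClosed_preimage {φ : W → V} {T : Set W} {S L : Set V}
    (hφ : MorphismOn 𝔹 𝔸 φ T S) (hT : 𝔹.LocClosed T) (hL : 𝔸.LocClosed L) :
    𝔹.LocClosed (T ∩ φ ⁻¹' L) := by
  obtain ⟨U, Z, hU, hZ, rfl⟩ := hL
  let _ := 𝔸.zariski
  let _ := 𝔹.zariski
  obtain ⟨U', hU', h1⟩ := (continuousOn_iff'.mp hφ.2.1) U hU
  obtain ⟨Z', hZ', h2⟩ := (continuousOn_iff_isClosed.mp hφ.2.1) Z hZ
  have : T ∩ φ ⁻¹' (U ∩ Z) = T ∩ (U' ∩ Z') := by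
    ext x
    have h3 := congrArg (fun A => x ∈ A) h1
    have h4 := congrArg (fun A => x ∈ A) h2
    simp only [Set.mem_inter_iff, Set.mem_preimage, eq_iff_iff] at h3 h4 ⊢
    tauto
  rw [this]
  exact IsLocallyClosed.inter hT ⟨U', Z', hU', hZ', rfl⟩

theorem MorphismOn.exists_isClosed {φ : W → V} {T : Set W} {S Z : Set V}
    (hφ : MorphismOn 𝔹 𝔸 φ T S) (hZ : IsClosed[𝔸.zariski] Z) :
    ∃ Z', IsClosed[𝔹.zariski] Z' ∧ T ∩ φ ⁻¹' Z = T ∩ Z' := by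
  let _ := 𝔸.zariski
  let _ := 𝔹.zariski
  obtain ⟨Z', hZ', h2⟩ := (continuousOn_iff_isClosed.mp hφ.2.1) Z hZ
  exact ⟨Z', hZ', by rw [Set.inter_comm, h2, Set.inter_comm]⟩

theorem MorphismOn.exists_isOpen {φ : W → V} {T : Set W} {S O : Set V}
    (hφ : MorphismOn 𝔹 𝔸 φ T S) (hO : IsOpen[𝔸.zariski] O) :
    ∃ O', IsOpen[𝔹.zariski] O' ∧ T ∩ φ ⁻¹' O = T ∩ O' := by
  let _ := 𝔸.zariski
  let _ := 𝔹.zariski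
  obtain ⟨Z', hZ', h2⟩ := (continuousOn_iff'.mp hφ.2.1) O hO
  exact ⟨Z', hZ', by rw [Set.inter_comm, h2, Set.inter_comm]⟩

theorem MorphismOn.regularOn {φ : W → V} {T : Set W} {S : Set V}
    (hφ : MorphismOn 𝔹 𝔸 φ T S) {g : V → k} (hg : 𝔸.RegularOn S g) : 𝔹.RegularOn T (g ∘ φ) := by
  let _ := 𝔸.zariski
  have := hφ.2.2 Set.univ g isOpen_univ (by simpa using hg)
  simpa using this

/-- Morphisms restrict to subsets. -/
theorem MorphismOn.restrict (hB : 𝔹.Good) {φ : W → V} {T T' : Set W} {S S' : Set V}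
    (hφ : MorphismOn 𝔹 𝔸 φ T S) (hT : T' ⊆ T) (hm : Set.MapsTo φ T' S') :
    MorphismOn 𝔹 𝔸 φ T' S' := by
  refine ⟨hm, ?_, fun D g hD hg => ?_⟩
  · let _ := 𝔸.zariski
    let _ := 𝔹.zariski
    exact hφ.2.1.mono hT
  refine regularOn_of_local hB fun x hx => ?_
  obtain ⟨i, hi, a, ha, b, hb, hbx, hab⟩ := hg (φ x) ⟨hm hx.1, hx.2⟩
  let D' : Set V := {y | y ∈ 𝔸.dom i ∧ b y ≠ 0}
  have hD' : IsOpen[𝔸.zariski] D' := 𝔸.isOpen_basic hb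
  have hDD' : IsOpen[𝔸.zariski] (D ∩ D') := by
    let _ := 𝔸.zariski
    exact hD.inter hD'
  -- `g` is regular on a part of `S'` only, while `hφ` pulls back functions that are regular on open
  -- parts of `S`. The local expression `a / b` is such a function and agrees with `g` on `S'`.
  have hreg : 𝔸.RegularOn (S ∩ (D ∩ D')) (fun y => a y / b y) := by
    intro y hy
    exact ⟨i, hy.2.2.1, a, ha, b, hb, hy.2.2.2, fun _ _ _ => rfl⟩
  have h1 := hφ.2.2 _ _ hDD' hreg
  obtain ⟨O, hO, hOD⟩ := hφ.exists_isOpen hDD'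
  have hmem : ∀ y ∈ T, y ∈ O ↔ φ y ∈ D ∩ D' := fun y hy => by
    have := congrArg (fun A => y ∈ A) hOD
    simp only [Set.mem_inter_iff, Set.mem_preimage, hy, true_and, eq_iff_iff] at this ⊢
    exact this.symm
  refine ⟨O, hO, (hmem x (hT hx.1)).mpr ⟨hx.2, hi, hbx⟩, ?_⟩
  refine (h1.mono fun y hy => ?_).congr fun y hy => ?_
  · exact ⟨hT hy.1.1, (hmem y (hT hy.1.1)).mp hy.2⟩
  · have h2 := (hmem y (hT hy.1.1)).mp hy.2
    exact (hab (φ y) ⟨⟨hm hy.1.1, h2.1⟩, h2.2.1⟩ h2.2.2).symm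

end Morphisms

/-! ### Independence, additivity and isomorphism invariance of the class of a constructible set -/

section ClassOfCells

variable {k : Type u} [Field k] [IsAlgClosed k] {V W : Type u} {𝔸 : Atlas k V} {𝔹 : Atlas k W}

/-- Common refinement: each `P i ∩ Q j` is cut into affine pieces, and the resulting sum can be
grouped by `i` or by `j`. -/
theorem sum_affineCls_eq (hA : 𝔸.Good) {ι κ : Type*} [Fintype ι] [Fintype κ] (P : ι → Set V)
    (Q : κ → Set V) (hP : ∀ i, 𝔸.IsAffineSet (P i)) (hQ : ∀ i, 𝔸.IsAffineSet (Q i))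
    (hPd : Pairwise (Function.onFun Disjoint P)) (hQd : Pairwise (Function.onFun Disjoint Q))
    (h : ⋃ i, P i = ⋃ j, Q j) : ∑ i, 𝔸.affineCls (P i) = ∑ j, 𝔸.affineCls (Q j) := by
  have hex : ∀ i j, ∃ (ν : Type) (_ : Fintype ν) (R : ν → 𝔸.AffinePiece),
      Pairwise (Function.onFun Disjoint fun l => (R l).carrier) ∧
        P i ∩ Q j = ⋃ l, (R l).carrier := fun i j =>
    ((hP i).cells.inter_locClosed hA (hQ j).locClosed).exists_pieces
  choose ν hν R hRd hR using hex
  have hRP : ∀ i j l, (R i j l).carrier ⊆ P i := fun i j l x hx =>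
    ((hR i j).ge (Set.mem_iUnion.mpr ⟨l, hx⟩)).1
  have hRQ : ∀ i j l, (R i j l).carrier ⊆ Q j := fun i j l x hx =>
    ((hR i j).ge (Set.mem_iUnion.mpr ⟨l, hx⟩)).2
  have h1 : ∀ i, 𝔸.affineCls (P i) = ∑ j, ∑ l, 𝔸.affineCls (R i j l).carrier := fun i => by
    rw [← Fintype.sum_sigma']
    refine affineCls_eq_sum hA (hP i) (fun x : (j : κ) × ν i j => (R i x.1 x.2).carrier)
      (fun x => (R i x.1 x.2).isAffineSet) ?_ ?_
    · rintro ⟨j, l⟩ ⟨j', l'⟩ hne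
      by_cases hj : j = j'
      · subst hj
        exact hRd i j (fun h => hne (by rw [show l = l' from h]))
      · exact (hQd hj).mono (hRQ i j l) (hRQ i j' l')
    · rw [Set.iUnion_sigma]
      calc P i = P i ∩ ⋃ j, Q j := by
            rw [← h, Set.inter_eq_left.mpr (Set.subset_iUnion P i)]
        _ = _ := by rw [Set.inter_iUnion]; exact Set.iUnion_congr fun j => hR i j
  have h2 : ∀ j, 𝔸.affineCls (Q j) = ∑ i, ∑ l, 𝔸.affineCls (R i j l).carrier := fun j => by
    rw [← Fintype.sum_sigma']
    refine affineCls_eq_sum hA (hQ j) (fun x : (i : ι) × ν i j => (R x.1 j x.2).carrier)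
      (fun x => (R x.1 j x.2).isAffineSet) ?_ ?_
    · rintro ⟨i, l⟩ ⟨i', l'⟩ hne
      by_cases hi : i = i'
      · subst hi
        exact hRd i j (fun h => hne (by rw [show l = l' from h]))
      · exact (hPd hi).mono (hRP i j l) (hRP i' j l')
    · rw [Set.iUnion_sigma]
      calc Q j = (⋃ i, P i) ∩ Q j := by
            rw [h, Set.inter_eq_right.mpr (Set.subset_iUnion Q j)]
        _ = _ := by rw [Set.iUnion_inter]; exact Set.iUnion_congr fun i => hR i j
  rw [Finset.sum_congr rfl fun i _ => h1 i, Finset.sum_congr rfl fun j _ => h2 j, Finset.sum_comm]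

theorem cls_eq_sum (hA : 𝔸.Good) {ι : Type*} [Fintype ι] (P : ι → Set V)
    (hP : ∀ i, 𝔸.IsAffineSet (P i)) (hPd : Pairwise (Function.onFun Disjoint P)) :
    𝔸.cls (⋃ i, P i) = ∑ i, 𝔸.affineCls (P i) := by
  have hex : ∃ D : (r : ℕ) × (Fin r → 𝔸.AffinePiece), 𝔸.IsDecomposition (⋃ i, P i) D.1 D.2 := by
    have : 𝔸.Cells (⋃ i, P i) := cells_iUnion hA P fun i => (hP i).locClosed
    exact this.exists_decomposition
  rw [cls, dif_pos hex]
  obtain ⟨h1, h2⟩ := hex.choose_spec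
  rw [sum_affineCls_eq hA P (fun j => (hex.choose.2 j).carrier) hP
    (fun j => (hex.choose.2 j).isAffineSet) hPd h1 h2]
  exact Finset.sum_congr rfl fun j _ => (affineCls_carrier hA _).symm

theorem cls_of_isAffineSet (hA : 𝔸.Good) {S : Set V} (hS : 𝔸.IsAffineSet S) :
    𝔸.cls S = 𝔸.affineCls S := by
  have := cls_eq_sum hA (fun _ : Unit => S) (fun _ => hS) (fun i j h => absurd rfl h)
  rwa [Set.iUnion_const, Fintype.sum_unique] at this

theorem cls_empty (hA : 𝔸.Good) : 𝔸.cls ∅ = 0 := by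
  have := cls_eq_sum hA (fun i : Empty => i.elim) (fun i => i.elim) (fun i => i.elim)
  simpa using this

theorem cls_union (hA : 𝔸.Good) {S T : Set V} (hS : 𝔸.Cells S) (hT : 𝔸.Cells T)
    (h : Disjoint S T) : 𝔸.cls (S ∪ T) = 𝔸.cls S + 𝔸.cls T := by
  obtain ⟨ι, _, P, hP, rfl⟩ := hS.exists_pieces
  obtain ⟨κ, _, Q, hQ, rfl⟩ := hT.exists_pieces
  rw [cls_eq_sum hA _ (fun i => (P i).isAffineSet) hP,
    cls_eq_sum hA _ (fun i => (Q i).isAffineSet) hQ]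
  have := cls_eq_sum hA (Sum.elim (fun i => (P i).carrier) (fun j => (Q j).carrier))
    (by rintro (i | j); exacts [(P i).isAffineSet, (Q j).isAffineSet]) ?_
  · rw [Set.iUnion_sum, Fintype.sum_sum_type] at this
    exact this
  · simp only [Set.disjoint_iUnion_left, Set.disjoint_iUnion_right] at h
    rintro (i | i) (j | j) hij
    · exact hP (fun h => hij (h ▸ rfl))
    · exact h j i
    · exact (h i j).symm
    · exact hQ (fun h => hij (h ▸ rfl))

theorem cls_iUnion (hA : 𝔸.Good) {ι : Type*} [Fintype ι] (S : ι → Set V)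
    (hS : ∀ i, 𝔸.Cells (S i)) (hd : Pairwise (Function.onFun Disjoint S)) :
    𝔸.cls (⋃ i, S i) = ∑ i, 𝔸.cls (S i) := by
  classical
  have key : ∀ s : Finset ι, 𝔸.Cells (⋃ i ∈ s, S i) ∧ 𝔸.cls (⋃ i ∈ s, S i) = ∑ i ∈ s, 𝔸.cls (S i) := by
    intro s
    induction s using Finset.induction_on with
    | empty => simpa [cls_empty hA] using Cells.empty
    | insert a s ha ih =>
      have hdis : Disjoint (S a) (⋃ i ∈ s, S i) := by
        simp only [Set.disjoint_iUnion_right]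
        exact fun i hi => hd (fun h => ha (h ▸ hi))
      simp only [Finset.set_biUnion_insert]
      refine ⟨.union hdis (hS a) ih.1, ?_⟩
      rw [cls_union hA (hS a) ih.1 hdis, ih.2, Finset.sum_insert ha]
  simpa using (key Finset.univ).2

/-- A locally closed set that is isomorphic to an affine piece has the same class. -/
theorem cls_eq_of_iso (hA : 𝔸.Good) (hB : 𝔹.Good) {T : Set W} {Y : Set V} (hT : 𝔹.LocClosed T)
    (hY : 𝔸.IsAffineSet Y) (φ : W → V) (ψ : V → W) (hφ : MorphismOn 𝔹 𝔸 φ T Y)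
    (hψ : MorphismOn 𝔸 𝔹 ψ Y T) (h1 : Set.LeftInvOn ψ φ T) (h2 : Set.RightInvOn ψ φ Y) :
    𝔹.cls T = 𝔸.cls Y := by
  -- `T` need not be an affine piece, so the coordinate rings cannot be compared at once. Noetherian
  -- induction splits off an open part of `Y ∩ Z` over which the isomorphism is one of affine
  -- pieces.
  have key := hA.closed_induction (fun Z => 𝔹.cls (T ∩ φ ⁻¹' Z) = 𝔸.cls (Y ∩ Z)) ?_
  · have := key Set.univ (@isClosed_univ _ 𝔸.zariski)
    simpa using this
  intro Z hZ ih
  have hcellT : ∀ Z, IsClosed[𝔸.zariski] Z → 𝔹.Cells (T ∩ φ ⁻¹' Z) := fun Z hZ => by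
    obtain ⟨Z', hZ', h⟩ := hφ.exists_isClosed hZ
    rw [h]
    exact (hT.cells hB).inter_closed hB hZ'
  by_cases hne : (Y ∩ Z).Nonempty
  swap
  · have h3 : Y ∩ Z = ∅ := Set.not_nonempty_iff_eq_empty.mp hne
    have h4 : T ∩ φ ⁻¹' Z = ∅ := by
      rw [Set.eq_empty_iff_forall_notMem]
      exact fun x hx => Set.notMem_empty (φ x) (h3 ▸ ⟨hφ.1 hx.1, hx.2⟩)
    rw [h3, h4, cls_empty hA, cls_empty hB]
  obtain ⟨ι, _, Q, hQ, hTQ⟩ := (hT.cells hB).exists_pieces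
  -- The pieces of `T` pull back along `ψ` to locally closed sets covering `Y`, so `ψ` maps some
  -- nonempty open part of `Y ∩ Z` into a single piece `Q l`.
  have hLQ : ∀ l, 𝔸.LocClosed (Y ∩ ψ ⁻¹' (Q l).carrier) := fun l =>
    hψ.locClosed_preimage hY.locClosed (Q l).isAffineSet.locClosed
  obtain ⟨l, -, O, hO, ⟨y, hyO, hy⟩, hOl⟩ := @exists_isOpen_inter_subset V ι 𝔸.zariski
    (fun l => Y ∩ ψ ⁻¹' (Q l).carrier) Finset.univ (fun l _ => hLQ l) (Y ∩ Z) hne (by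
      intro y hy
      obtain ⟨l, hl⟩ := Set.mem_iUnion.mp (hTQ.le (hψ.1 hy.1))
      simp only [Finset.mem_univ, Set.iUnion_true, Set.mem_iUnion]
      exact ⟨l, hy.1, hl⟩)
  obtain ⟨P, hP⟩ := id hY
  have hYdom : Y ⊆ 𝔸.dom P.i := fun y hy => (hP.ge hy).1
  obtain ⟨g, hg, hgy, hgO⟩ := hA.exists_basic hO (hYdom hy.1) hyO
  have hZ' : IsClosed[𝔸.zariski] (Z \ {y | y ∈ 𝔸.dom P.i ∧ g y ≠ 0}) := by
    let _ := 𝔸.zariski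
    exact hZ.sdiff (𝔸.isOpen_basic hg)
  have ih' := ih _ hZ' ⟨Set.sdiff_subset, fun h => (h hy.2).2 ⟨hYdom hy.1, hgy⟩⟩
  have hgreg : 𝔸.RegularOn Y g := regularOn_poly hYdom hg
  have hB0 : 𝔸.IsAffineSet (Y ∩ Z ∩ {x | g x ≠ 0}) :=
    (hY.inter_closed hA hZ).inter_ne hA (hgreg.mono Set.inter_subset_left)
  obtain ⟨Z₁, hZ₁, hZZ₁⟩ := hφ.exists_isClosed hZ
  have hQT : (Q l).carrier ⊆ T := hTQ ▸ Set.subset_iUnion (fun l => (Q l).carrier) l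
  have hA0 : 𝔹.IsAffineSet ((Q l).carrier ∩ Z₁ ∩ {x | (g ∘ φ) x ≠ 0}) :=
    ((Q l).isAffineSet.inter_closed hB hZ₁).inter_ne hB
      ((hφ.regularOn hgreg).mono fun x hx => hQT hx.1)
  have hQl : ∀ x ∈ T, φ x ∈ Z → g (φ x) ≠ 0 → x ∈ (Q l).carrier := fun x hx hxZ hgx => by
    have := (hOl ⟨hgO _ (hYdom (hφ.1 hx)) hgx, hφ.1 hx, hxZ⟩).2
    rwa [Set.mem_preimage, h1 hx] at this
  have hmemZ : ∀ x ∈ T, φ x ∈ Z ↔ x ∈ Z₁ := fun x hx => by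
    have := congrArg (fun A => x ∈ A) hZZ₁
    simp only [Set.mem_inter_iff, Set.mem_preimage, hx, true_and, eq_iff_iff] at this
    exact this
  have e1 : T ∩ φ ⁻¹' Z = ((Q l).carrier ∩ Z₁ ∩ {x | (g ∘ φ) x ≠ 0}) ∪
      (T ∩ φ ⁻¹' (Z \ {y | y ∈ 𝔸.dom P.i ∧ g y ≠ 0})) := by
    ext x
    constructor
    · rintro ⟨hx, hxZ⟩
      by_cases hgx : g (φ x) = 0
      · exact Or.inr ⟨hx, hxZ, fun h => h.2 hgx⟩
      · exact Or.inl ⟨⟨hQl x hx hxZ hgx, (hmemZ x hx).mp hxZ⟩, hgx⟩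
    · rintro (⟨⟨hx, hxZ⟩, -⟩ | ⟨hx, hxZ, -⟩)
      · exact ⟨hQT hx, (hmemZ x (hQT hx)).mpr hxZ⟩
      · exact ⟨hx, hxZ⟩
  have e2 : Y ∩ Z = (Y ∩ Z ∩ {x | g x ≠ 0}) ∪ (Y ∩ (Z \ {y | y ∈ 𝔸.dom P.i ∧ g y ≠ 0})) := by
    ext x
    by_cases hgx : g x = 0
    · simp [hgx]
    · simp only [Set.mem_inter_iff, Set.mem_union, Set.mem_ofPred_eq, Set.mem_sdiff]
      tauto
  rw [e1, e2, cls_union hB hA0.cells (hcellT _ hZ'), cls_union hA hB0.cells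
    ((hY.inter_closed hA hZ').cells), ih', cls_of_isAffineSet hA hB0, cls_of_isAffineSet hB hA0]
  rotate_left
  · rw [Set.disjoint_left]
    rintro x ⟨⟨hx, -⟩, hgx⟩ ⟨-, -, h⟩
    exact h ⟨hYdom hx, hgx⟩
  · rw [Set.disjoint_left]
    rintro x ⟨⟨hx, -⟩, hgx⟩ ⟨-, -, h⟩
    exact h ⟨hYdom (hφ.1 (hQT hx)), hgx⟩
  congr 1
  obtain ⟨P₁, hP₁⟩ := hA0
  obtain ⟨P₂, hP₂⟩ := hB0
  rw [← hP₁, ← hP₂, affineCls_carrier hA, affineCls_carrier hB]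
  have hs1 : P₁.carrier ⊆ T := fun x hx => hQT (hP₁.le hx).1.1
  have hs2 : P₂.carrier ⊆ Y := fun x hx => (hP₂.le hx).1.1
  have hm1 : Set.MapsTo φ P₁.carrier P₂.carrier := fun x hx => hP₂.ge
    ⟨⟨hφ.1 (hs1 hx), (hmemZ x (hs1 hx)).mpr (hP₁.le hx).1.2⟩, (hP₁.le hx).2⟩
  have hm2 : Set.MapsTo ψ P₂.carrier P₁.carrier := fun x hx => by
    have hx' := hP₂.le hx
    have hT' : ψ x ∈ T := hψ.1 hx'.1.1
    have hx2 : φ (ψ x) = x := h2 hx'.1.1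
    have hZx : φ (ψ x) ∈ Z := by rw [hx2]; exact hx'.1.2
    have hgx : g (φ (ψ x)) ≠ 0 := by rw [hx2]; exact hx'.2
    exact hP₁.ge ⟨⟨hQl _ hT' hZx hgx, (hmemZ _ hT').mp hZx⟩, hgx⟩
  exact AffinePiece.cls_congr hB hA P₁ P₂ φ ψ hm1 hm2 (h1.mono hs1) (h2.mono hs2)
    (fun g hg => (hφ.restrict hB hs1 hm1).regularOn hg)
    (fun g hg => (hψ.restrict hA hs2 hm2).regularOn hg)

end ClassOfCells

end Atlas

/-! ### Products with affine spaces -/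

section ProdAlg

variable {k : Type u} [Field k] {S T : Type u}

/-- The functions on the product with an affine space that are polynomial in the functions in `R`
and the coordinates. -/
def prodAlg (d : ℕ) (R : Subalgebra k (T → k)) : Subalgebra k (T × (Fin d → k) → k) :=
  Algebra.adjoin k (pull k Prod.fst '' R ∪ Set.range fun (a : Fin d) (x : T × (Fin d → k)) => x.2 a)

theorem prodAlg_adjoin (d : ℕ) (G : Set (T → k)) : prodAlg d (Algebra.adjoin k G) =
    Algebra.adjoin k (pull k Prod.fst '' G ∪
      Set.range fun (a : Fin d) (x : T × (Fin d → k)) => x.2 a) := by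
  apply le_antisymm
  · refine Algebra.adjoin_le (Set.union_subset ?_ ?_)
    · rintro _ ⟨g, hg, rfl⟩
      have : pull k (Prod.fst : T × (Fin d → k) → T) g ∈ (Algebra.adjoin k G).map (pull k Prod.fst) :=
        ⟨g, hg, rfl⟩
      rw [AlgHom.map_adjoin] at this
      exact Algebra.adjoin_mono Set.subset_union_left this
    · exact Set.subset_union_right.trans Algebra.subset_adjoin
  · exact Algebra.adjoin_mono (Set.union_subset_union_left _
      (Set.image_mono Algebra.subset_adjoin))

theorem IsAffineAlgebra.of_equiv {R : Subalgebra k (T → k)} (hR : IsAffineAlgebra R) (e : S ≃ T) :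
    IsAffineAlgebra (R.map (pull k e)) := by
  refine ⟨hR.fg.map _, fun χ => ?_⟩
  let ρ : R →ₐ[k] R.map (pull k e) :=
    ((pull k e).comp R.val).codRestrict _ (fun f => ⟨f.1, f.2, rfl⟩)
  obtain ⟨x, hx⟩ := hR.point (χ.comp ρ)
  refine ⟨e.symm x, ?_⟩
  rintro ⟨_, f, hf, rfl⟩
  have := hx ⟨f, hf⟩
  change χ (ρ ⟨f, hf⟩) = f (e (e.symm x))
  rw [e.apply_symm_apply]
  exact this

/-- A character is determined by its restriction to `R`, which is a point of `T`, and by its values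
on the `d` coordinates, which form a point of the affine space. -/
theorem IsAffineAlgebra.prodAlg {R : Subalgebra k (T → k)} (hR : IsAffineAlgebra R) (d : ℕ) :
    IsAffineAlgebra (prodAlg d R) := by
  constructor
  · obtain ⟨G, hG⟩ := hR.fg
    rw [← hG, prodAlg_adjoin]
    exact Subalgebra.fg_def.mpr ⟨_, (G.finite_toSet.image _).union (Set.finite_range _), rfl⟩
  · intro χ
    let ρ : R →ₐ[k] Motivic.prodAlg d R :=
      ((pull k Prod.fst).comp R.val).codRestrict _
        (fun f => Algebra.subset_adjoin (Or.inl ⟨f.1, f.2, rfl⟩))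
    obtain ⟨x, hx⟩ := hR.point (χ.comp ρ)
    let c : Fin d → Motivic.prodAlg d R := fun a =>
      ⟨fun x => x.2 a, Algebra.subset_adjoin (Or.inr ⟨a, rfl⟩)⟩
    let y : T × (Fin d → k) := (x, fun a => χ (c a))
    refine ⟨y, fun f => ?_⟩
    have : ∀ f (hf : f ∈ Motivic.prodAlg d R), χ ⟨f, hf⟩ = f y := by
      intro f hf
      induction hf using Algebra.adjoin_induction with
      | mem g hg =>
        rcases hg with ⟨g, hg, rfl⟩ | ⟨a, rfl⟩
        · exact hx ⟨g, hg⟩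
        · rfl
      | algebraMap r => exact χ.commutes r
      | add g g' hg hg' h1 h2 =>
        have := map_add χ ⟨g, hg⟩ ⟨g', hg'⟩
        rw [h1, h2] at this
        exact this
      | mul g g' hg hg' h1 h2 =>
        have := map_mul χ ⟨g, hg⟩ ⟨g', hg'⟩
        rw [h1, h2] at this
        exact this
    exact this f.1 f.2

/-- The functions on the product of `T` with an affine space are the polynomials over the functions
on `T`. -/
theorem nonempty_mvPolynomial_equiv_prodAlg [Infinite k] (R : Subalgebra k (T → k)) (d : ℕ) :
    Nonempty (MvPolynomial (Fin d) R ≃ₐ[k] prodAlg d R) := by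
  let ρ : R →ₐ[k] (T × (Fin d → k) → k) := (pull k Prod.fst).comp R.val
  let _ : Algebra R (T × (Fin d → k) → k) := ρ.toRingHom.toAlgebra
  have : IsScalarTower k R (T × (Fin d → k) → k) := IsScalarTower.of_algebraMap_eq fun r => rfl
  let Φ : MvPolynomial (Fin d) R →ₐ[R] (T × (Fin d → k) → k) :=
    MvPolynomial.aeval fun a x => x.2 a
  have heval : ∀ F x y, Φ F (x, y) = MvPolynomial.eval y (MvPolynomial.map (evalAt R x).toRingHom F) := by
    intro F x y
    induction F using MvPolynomial.induction_on with
    | C r => simp [Φ]; rfl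
    | add p q hp hq => simp [hp, hq]
    | mul_X p a hp => simp [hp, Φ]
  -- Over each point of `T` this is the fact that a polynomial over an infinite field with only zero
  -- values is zero.
  have hinj : Function.Injective Φ := by
    rw [injective_iff_map_eq_zero]
    intro F hF
    ext m x
    have h1 : MvPolynomial.map (evalAt R x).toRingHom F = 0 := by
      apply MvPolynomial.funext
      intro y
      rw [← heval, hF]; simp
    have h2 := congrArg (MvPolynomial.coeff m) h1
    rw [MvPolynomial.coeff_map] at h2
    simpa using h2
  have hrange : (Φ.restrictScalars k).range = prodAlg d R := by
    apply le_antisymm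
    · rintro _ ⟨F, rfl⟩
      change Φ F ∈ _
      induction F using MvPolynomial.induction_on with
      | C r =>
        have : Φ (MvPolynomial.C r) = pull k Prod.fst r.1 := by
          simp [Φ]; rfl
        rw [this]
        exact Algebra.subset_adjoin (Or.inl ⟨r.1, r.2, rfl⟩)
      | add p q hp hq => rw [map_add]; exact add_mem hp hq
      | mul_X p a hp =>
        rw [map_mul]
        refine mul_mem hp (Algebra.subset_adjoin (Or.inr ⟨a, ?_⟩))
        simp [Φ]
    · refine Algebra.adjoin_le (Set.union_subset ?_ ?_)
      · rintro _ ⟨g, hg, rfl⟩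
        refine ⟨MvPolynomial.C ⟨g, hg⟩, ?_⟩
        change Φ _ = _
        simp [Φ]; rfl
      · rintro _ ⟨a, rfl⟩
        refine ⟨MvPolynomial.X a, ?_⟩
        change Φ _ = _
        simp [Φ]
  exact ⟨(AlgEquiv.ofInjective (Φ.restrictScalars k) hinj).trans
    (Subalgebra.equivOfEq _ _ hrange)⟩

end ProdAlg

namespace Atlas

section ProdAffine

variable {k : Type u} [Field k] {V W : Type u} {𝔸 : Atlas k V} {𝔹 : Atlas k W}

theorem poly_prodAffine_fst {d : ℕ} {i : 𝔸.ι} {g : V → k} (hg : g ∈ 𝔸.poly i) :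
    (fun x => g x.1) ∈ (𝔸.prodAffine d).poly i := by
  have : pull k (Prod.fst : V × (Fin d → k) → V) g ∈ (𝔸.poly i).map (pull k Prod.fst) := ⟨g, hg, rfl⟩
  rw [poly, AlgHom.map_adjoin] at this
  refine Algebra.adjoin_mono ?_ this
  rintro _ ⟨c, hc, rfl⟩
  exact Or.inl ⟨c, hc, rfl⟩

/-- The domain of a chart of the product with an affine space. -/
def domProdEquiv (𝔸 : Atlas k V) (d : ℕ) (i : 𝔸.ι) :
    (𝔸.prodAffine d).dom i ≃ 𝔸.dom i × (Fin d → k) where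
  toFun x := (⟨x.1.1, x.2⟩, x.1.2)
  invFun y := ⟨(y.1.1, y.2), y.1.2⟩
  left_inv _ := rfl
  right_inv _ := rfl

theorem chartRing_prodAffine (d : ℕ) (i : 𝔸.ι) : (𝔸.prodAffine d).chartRing i =
    (prodAlg d (𝔸.chartRing i)).map (pull k (𝔸.domProdEquiv d i)) := by
  change (Algebra.adjoin k ((𝔸.prodAffine d).coord i)).map (pull k Subtype.val) =
    (prodAlg d ((Algebra.adjoin k (𝔸.coord i)).map (pull k Subtype.val))).map _
  rw [AlgHom.map_adjoin, AlgHom.map_adjoin, prodAlg_adjoin,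
    AlgHom.map_adjoin]
  congr 1
  ext g
  constructor
  · rintro ⟨_, ⟨c, hc, rfl⟩ | ⟨a, rfl⟩, rfl⟩
    · exact ⟨_, Or.inl ⟨_, ⟨c, hc, rfl⟩, rfl⟩, rfl⟩
    · exact ⟨_, Or.inr ⟨a, rfl⟩, rfl⟩
  · rintro ⟨_, ⟨_, ⟨c, hc, rfl⟩, rfl⟩ | ⟨a, rfl⟩, rfl⟩
    · exact ⟨_, Or.inl ⟨c, hc, rfl⟩, rfl⟩
    · exact ⟨_, Or.inr ⟨a, rfl⟩, rfl⟩

theorem Good.prodAffine (hA : 𝔸.Good) (d : ℕ) : (𝔸.prodAffine d).Good where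
  affine i := Eq.mpr (congrArg IsAffineAlgebra (chartRing_prodAffine (𝔸 := 𝔸) d i))
    (((hA.affine i).prodAlg d).of_equiv (𝔸.domProdEquiv d i))
  sep i x hx y hy h := by
    refine Prod.ext (hA.sep i x.1 hx y.1 hy fun c hc => h _ (Or.inl ⟨c, hc, rfl⟩)) ?_
    ext a
    exact h _ (Or.inr ⟨a, rfl⟩)
  compat i j x hi hj := by
    obtain ⟨g, hg, hgx, h1, h2⟩ := hA.compat i j x.1 hi hj
    refine ⟨fun x => g x.1, poly_prodAffine_fst hg, hgx, fun y hy => h1 y.1 hy, ?_⟩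
    rintro _ (⟨c, hc, rfl⟩ | ⟨a, rfl⟩)
    · obtain ⟨a, ha, N, hN⟩ := h2 c hc
      exact ⟨fun x => a x.1, poly_prodAffine_fst ha, N, fun y hy hgy => hN y.1 hy hgy⟩
    · exact ⟨fun x => x.2 a, Algebra.subset_adjoin (Or.inr ⟨a, rfl⟩), 0, fun y _ _ => by simp⟩
  cover := by
    obtain ⟨s, hs⟩ := hA.cover
    exact ⟨s, fun x => hs x.1⟩

/-- The product of an affine piece with an affine space. -/
def AffinePiece.prod (P : 𝔸.AffinePiece) (d : ℕ) : (𝔸.prodAffine d).AffinePiece where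
  i := P.i
  eqs := {g | ∃ e ∈ P.eqs, g = fun x => e x.1}
  eqs_subset := by rintro _ ⟨e, he, rfl⟩; exact poly_prodAffine_fst (P.eqs_subset he)
  h := fun x => P.h x.1
  h_mem := poly_prodAffine_fst P.h_mem

theorem AffinePiece.carrier_prod (P : 𝔸.AffinePiece) (d : ℕ) :
    (P.prod d).carrier = {x | x.1 ∈ P.carrier} := by
  ext x
  constructor
  · rintro ⟨h1, h2, h3⟩; exact ⟨h1, fun g hg => h2 _ ⟨g, hg, rfl⟩, h3⟩
  · rintro ⟨h1, h2, h3⟩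
    refine ⟨h1, ?_, h3⟩
    rintro _ ⟨e, he, rfl⟩; exact h2 e he

theorem IsAffineSet.prod {S : Set V} (hS : 𝔸.IsAffineSet S) (d : ℕ) :
    (𝔸.prodAffine d).IsAffineSet {x | x.1 ∈ S} := by
  obtain ⟨P, rfl⟩ := hS
  exact ⟨P.prod d, P.carrier_prod d⟩

/-- The points of the product of an affine piece with an affine space. -/
def AffinePiece.prodEquiv (P : 𝔸.AffinePiece) (d : ℕ) :
    (P.prod d).carrier ≃ P.carrier × (Fin d → k) where
  toFun x := (⟨x.1.1, (P.carrier_prod d).le x.2⟩, x.1.2)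
  invFun y := ⟨(y.1.1, y.2), (P.carrier_prod d).ge y.1.2⟩
  left_inv _ := rfl
  right_inv _ := rfl

theorem AffinePiece.coordRing_prod (P : 𝔸.AffinePiece) (d : ℕ) :
    (P.prod d).coordRing = (prodAlg d P.coordRing).map (pull k (P.prodEquiv d)) := by
  rw [coordRing, coordRing, prodAlg_adjoin, AlgHom.map_adjoin]
  congr 1
  ext g
  constructor
  · rintro (⟨_, ⟨c, hc, rfl⟩ | ⟨a, rfl⟩, rfl⟩ | rfl)
    · exact ⟨_, Or.inl ⟨_, Or.inl ⟨c, hc, rfl⟩, rfl⟩, rfl⟩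
    · exact ⟨_, Or.inr ⟨a, rfl⟩, rfl⟩
    · exact ⟨_, Or.inl ⟨_, Or.inr rfl, rfl⟩, rfl⟩
  · rintro ⟨_, ⟨_, ⟨c, hc, rfl⟩ | rfl, rfl⟩ | ⟨a, rfl⟩, rfl⟩
    · exact Or.inl ⟨_, Or.inl ⟨c, hc, rfl⟩, rfl⟩
    · exact Or.inr rfl
    · exact Or.inl ⟨_, Or.inr ⟨a, rfl⟩, rfl⟩

theorem AffinePiece.nonempty_mvPolynomial_equiv [Infinite k] (P : 𝔸.AffinePiece) (d : ℕ) :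
    Nonempty (MvPolynomial (Fin d) P.coordRing ≃ₐ[k] (P.prod d).coordRing) := by
  obtain ⟨e⟩ := nonempty_mvPolynomial_equiv_prodAlg P.coordRing d
  refine ⟨e.trans (algEquivOfEquiv _ _ (P.prodEquiv d) fun g => ?_)⟩
  rw [P.coordRing_prod d]
  constructor
  · exact fun hg => ⟨g, hg, rfl⟩
  · rintro ⟨g', hg', h⟩
    have : g' = g := by
      ext y
      have := congrFun h ((P.prodEquiv d).symm y)
      simpa using this
    exact this ▸ hg'

variable [IsAlgClosed k]

theorem affineCls_prod (hA : 𝔸.Good) {S : Set V} (hS : 𝔸.IsAffineSet S) (d : ℕ) :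
    (𝔸.prodAffine d).affineCls {x | x.1 ∈ S} = ((M.L k ^ d : (M k)ˣ) : M k) * 𝔸.affineCls S := by
  obtain ⟨P, rfl⟩ := hS
  have : Infinite k := IsAlgClosed.instInfinite
  obtain ⟨e⟩ := P.nonempty_mvPolynomial_equiv d
  have := isReduced_functions P.coordRing
  have := (P.isAffineAlgebra hA).finiteType
  have h1 : Algebra.FiniteType k (MvPolynomial (Fin d) P.coordRing) :=
    Algebra.FiniteType.trans (S := P.coordRing) inferInstance inferInstance
  have h2 : _root_.IsReduced (MvPolynomial (Fin d) P.coordRing) := inferInstance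
  rw [← P.carrier_prod, affineCls_carrier (hA.prodAffine d), affineCls_carrier hA,
    ← M.cls_mvPolynomial]
  exact (M.cls_specOver_congr e).symm

/-- The total space `T` is only known to be locally closed, but the product it is isomorphic to is
an affine piece, so `cls_eq_of_iso` applies. -/
theorem TrivialOver.cls_eq (hA : 𝔸.Good) (hB : 𝔹.Good) {d : ℕ} {p : W → V} {T : Set W} {S : Set V}
    (h : TrivialOver 𝔸 𝔹 d p T S) (hT : 𝔹.LocClosed T) (hS : 𝔸.IsAffineSet S) :
    𝔹.cls T = ((M.L k ^ d : (M k)ˣ) : M k) * 𝔸.cls S := by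
  obtain ⟨φ, ψ, hφ, hψ, h1, h2, -⟩ := h
  rw [cls_eq_of_iso (hA.prodAffine d) hB hT (hS.prod d) φ ψ hφ hψ h1 h2,
    cls_of_isAffineSet (hA.prodAffine d) (hS.prod d), affineCls_prod hA hS, cls_of_isAffineSet hA hS]

end ProdAffine

end Atlas

/-! ### Dimension -/

section Topology

/-- Reduces comparisons of dimensions to chains of finite length, with no prior knowledge that the
dimensions are finite. -/
theorem le_of_forall_nat_le {a b : WithBot ℕ∞} (h : ∀ r : ℕ, (r : WithBot ℕ∞) ≤ a → (r : WithBot ℕ∞) ≤ b) :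
    a ≤ b := by
  induction a with
  | bot => exact bot_le
  | coe a =>
    induction a with
    | top =>
      induction b with
      | bot => exact absurd (h 0 (by exact_mod_cast le_top)) (by simp)
      | coe b =>
        induction b with
        | top => exact le_rfl
        | coe b =>
          have := h (b + 1) (by exact_mod_cast le_top)
          have h2 : (b + 1 : ℕ) ≤ b := by exact_mod_cast this
          omega
    | coe a => exact h a le_rfl

variable {X : Type*} [TopologicalSpace X]

theorem _root_.IsPreirreducible.inter_isOpen {S O : Set X} (hS : IsPreirreducible S) (hO : IsOpen O) :
    IsPreirreducible (S ∩ O) := by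
  rintro u v hu hv ⟨x, ⟨hx1, hx2⟩, hx3⟩ ⟨y, ⟨hy1, hy2⟩, hy3⟩
  obtain ⟨z, hz1, hz2, hz3⟩ := hS (O ∩ u) (O ∩ v) (hO.inter hu) (hO.inter hv) ⟨x, hx1, hx2, hx3⟩
    ⟨y, hy1, hy2, hy3⟩
  exact ⟨z, ⟨hz1, hz2.1⟩, hz2.2, hz3.2⟩

theorem isIrreducible_preimage_val {S W : Set X} (h : IsIrreducible (W ∩ S)) :
    IsIrreducible ((Subtype.val : S → X) ⁻¹' W) := by
  constructor
  · obtain ⟨x, hx⟩ := h.1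
    exact ⟨⟨x, hx.2⟩, hx.1⟩
  · rintro _ _ ⟨u, hu, rfl⟩ ⟨v, hv, rfl⟩ ⟨x, hx, hxu⟩ ⟨y, hy, hyv⟩
    obtain ⟨z, hz, hz2⟩ := h.2 u v hu hv ⟨x, ⟨hx, x.2⟩, hxu⟩ ⟨y, ⟨hy, y.2⟩, hyv⟩
    exact ⟨⟨z, hz.2⟩, hz.1, hz2⟩

/-- The Krull dimension of a subspace, in terms of irreducible closed subsets of the whole space in
which the subspace is dense. -/
theorem le_topologicalKrullDim_iff {S : Set X} {r : ℕ} :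
    (r : WithBot ℕ∞) ≤ topologicalKrullDim S ↔
      ∃ W : LTSeries (TopologicalSpace.IrreducibleCloseds X), W.length = r ∧
        ∀ l, (W l : Set X) ⊆ closure (W l ∩ S) := by
  constructor
  · intro h
    obtain ⟨l, hl⟩ := Order.le_krullDim_iff.mp h
    refine ⟨l.map (TopologicalSpace.IrreducibleCloseds.map Subtype.val continuous_subtype_val)
      (TopologicalSpace.IrreducibleCloseds.map_strictMono_of_isInducing IsInducing.subtypeVal), hl, fun i => ?_⟩
    change ((TopologicalSpace.IrreducibleCloseds.map Subtype.val continuous_subtype_val (l i)) : Set X) ⊆ closure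
      (((TopologicalSpace.IrreducibleCloseds.map Subtype.val continuous_subtype_val (l i)) : Set X) ∩ S)
    rw [TopologicalSpace.IrreducibleCloseds.coe_map]
    refine closure_mono fun x hx => ⟨subset_closure hx, ?_⟩
    obtain ⟨y, -, rfl⟩ := hx
    exact y.2
  · rintro ⟨W, rfl, hW⟩
    have heq : ∀ l, closure ((W l : Set X) ∩ S) = W l := fun l =>
      ((W l).isClosed'.closure_subset_iff.mpr Set.inter_subset_left).antisymm (hW l)
    refine Order.le_krullDim_iff.mpr ⟨⟨W.length, fun l => ⟨Subtype.val ⁻¹' (W l : Set X),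
      isIrreducible_preimage_val (isIrreducible_iff_closure.mp ?_),
      (W l).isClosed'.preimage continuous_subtype_val⟩, fun l => ?_⟩, rfl⟩
    · rw [heq]; exact (W l).isIrreducible'
    · have hlt : (W l.castSucc : Set X) ⊂ W l.succ := W.step l
      refine lt_of_le_not_ge (Set.preimage_mono hlt.1) fun hle => hlt.2 ?_
      rw [← heq l.succ]
      exact closure_minimal (fun x hx => hle (a := ⟨x, hx.2⟩) hx.1) (W l.castSucc).isClosed'

end Topology

namespace Atlas

section Dimension

variable {k : Type u} [Field k] {V W : Type u} {𝔸 : Atlas k V} {𝔹 : Atlas k W}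

theorem dim_mono {S T : Set V} (h : S ⊆ T) : 𝔸.dim S ≤ 𝔸.dim T := by
  let _ := 𝔸.zariski
  exact (IsEmbedding.inclusion h).isInducing.topologicalKrullDim_le

theorem dim_empty : 𝔸.dim ∅ = ⊥ := by
  let _ := 𝔸.zariski
  refine le_bot_iff.mp (le_of_forall_nat_le fun r hr => ?_)
  obtain ⟨W, -, h⟩ := le_topologicalKrullDim_iff.mp hr
  obtain ⟨x, hx⟩ := (W 0).isIrreducible'.1
  have := h 0 hx
  simp at this

theorem zero_le_dim {S : Set V} (h : S.Nonempty) : 0 ≤ 𝔸.dim S := by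
  let _ := 𝔸.zariski
  obtain ⟨x, hx⟩ := h
  have : Nonempty S := ⟨⟨x, hx⟩⟩
  have : Nonempty (TopologicalSpace.IrreducibleCloseds S) :=
    ⟨⟨closure {⟨x, hx⟩}, isIrreducible_singleton.closure, isClosed_closure⟩⟩
  exact Order.krullDim_nonneg

theorem MorphismOn.dim_eq {φ : W → V} {ψ : V → W} {T : Set W} {Y : Set V} (hφ : MorphismOn 𝔹 𝔸 φ T Y)
    (hψ : MorphismOn 𝔸 𝔹 ψ Y T) (h1 : Set.LeftInvOn ψ φ T) (h2 : Set.RightInvOn ψ φ Y) :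
    𝔹.dim T = 𝔸.dim Y := by
  let _ := 𝔸.zariski
  let _ := 𝔹.zariski
  have e : T ≃ₜ Y :=
    { toFun := hφ.1.restrict
      invFun := hψ.1.restrict
      left_inv x := Subtype.ext (h1 x.2)
      right_inv x := Subtype.ext (h2 x.2)
      continuous_toFun := hφ.2.1.mapsToRestrict hφ.1
      continuous_invFun := hψ.2.1.mapsToRestrict hψ.1 }
  exact e.isHomeomorph.topologicalKrullDim_eq

/-- An irreducible subvariety has an affine open subset of the same dimension. -/
theorem LocClosed.exists_isOpen_le_dim (hA : 𝔸.Good) {C : Set V} (hC : 𝔸.LocClosed C)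
    (hirr : @IsIrreducible V 𝔸.zariski C) {r : ℕ} (hr : r ≤ 𝔸.dim C) :
    ∃ O, IsOpen[𝔸.zariski] O ∧ 𝔸.IsAffineSet (C ∩ O) ∧
      @IsIrreducible V 𝔸.zariski (C ∩ O) ∧ r ≤ 𝔸.dim (C ∩ O) := by
  let _ := 𝔸.zariski
  obtain ⟨W, hl, hW⟩ := le_topologicalKrullDim_iff.mp hr
  obtain ⟨U, Z, hU, hZ, rfl⟩ := hC
  obtain ⟨y, hy⟩ := (W 0).isIrreducible'.1
  -- `x` lies in the smallest member of the chain, hence in all of them; any neighbourhood of `x` is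
  -- dense in each member, and the whole chain survives the restriction to it.
  obtain ⟨x, hx0, hxU, hxZ⟩ := closure_nonempty_iff.mp ⟨y, hW 0 hy⟩
  obtain ⟨i, hi⟩ := hA.exists_mem_dom x
  obtain ⟨g, hg, hgx, hgU⟩ := hA.exists_basic hU hi hxU
  have hopen := 𝔸.isOpen_basic hg
  have hQ : 𝔸.IsAffineSet {y | y ∈ 𝔸.dom i ∧ g y ≠ 0} :=
    ⟨⟨i, ∅, Set.empty_subset _, g, hg⟩, by ext; simp [AffinePiece.carrier]⟩
  have heq : U ∩ Z ∩ {y | y ∈ 𝔸.dom i ∧ g y ≠ 0} = {y | y ∈ 𝔸.dom i ∧ g y ≠ 0} ∩ Z := by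
    ext y
    exact ⟨fun h => ⟨h.2, h.1.2⟩, fun h => ⟨⟨hgU y h.1.1 h.1.2, h.2⟩, h.1⟩⟩
  refine ⟨_, hopen, heq ▸ hQ.inter_closed hA hZ,
    ⟨⟨x, ⟨hxU, hxZ⟩, hi, hgx⟩, hirr.2.inter_isOpen hopen⟩, ?_⟩
  refine le_topologicalKrullDim_iff.mpr ⟨W, hl, fun l => ?_⟩
  have hWl : closure ((W l : Set V) ∩ (U ∩ Z)) = W l :=
    ((W l).isClosed'.closure_subset_iff.mpr Set.inter_subset_left).antisymm (hW l)
  have h1 : IsPreirreducible ((W l : Set V) ∩ (U ∩ Z)) := by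
    rw [← isPreirreducible_iff_closure, hWl]; exact (W l).isIrreducible'.2
  refine (hW l).trans (closure_minimal ?_ isClosed_closure)
  rw [← Set.inter_assoc (W l : Set V) (U ∩ Z)]
  refine subset_closure_inter_of_isPreirreducible_of_isOpen h1 hopen ⟨x, ⟨?_, hxU, hxZ⟩, hi, hgx⟩
  exact W.monotone (Fin.zero_le l) hx0

variable [IsAlgClosed k]

theorem AffinePiece.dim_carrier (hA : 𝔸.Good) (P : 𝔸.AffinePiece) :
    𝔸.dim P.carrier = ringKrullDim P.coordRing := by
  let _ := 𝔸.zariski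
  exact (P.isZariskiFor hA).topologicalKrullDim_eq (P.isAffineAlgebra hA)

theorem dim_prod (hA : 𝔸.Good) {S : Set V} (hS : 𝔸.IsAffineSet S) (d : ℕ) :
    (𝔸.prodAffine d).dim {x | x.1 ∈ S} = 𝔸.dim S + d := by
  obtain ⟨P, rfl⟩ := hS
  have : Infinite k := IsAlgClosed.instInfinite
  obtain ⟨e⟩ := P.nonempty_mvPolynomial_equiv d
  have := (P.isAffineAlgebra hA).isNoetherianRing
  rw [← P.carrier_prod, (P.prod d).dim_carrier (hA.prodAffine d), P.dim_carrier hA,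
    ← ringKrullDim_eq_of_ringEquiv e.toRingEquiv, MvPolynomial.ringKrullDim_of_isNoetherianRing]
  simp

/-- A nonempty open subset of an irreducible affine variety contains a nonempty open affine subset
of the same dimension. -/
theorem exists_isOpen_le_dim (hA : 𝔸.Good) {E O : Set V} (hE : 𝔸.IsAffineSet E)
    (hirr : @IsIrreducible V 𝔸.zariski E) (hO : IsOpen[𝔸.zariski] O) (hne : (O ∩ E).Nonempty)
    {r : ℕ} (hr : r ≤ 𝔸.dim E) :
    ∃ O', IsOpen[𝔸.zariski] O' ∧ O' ⊆ O ∧ 𝔸.IsAffineSet (E ∩ O') ∧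
      @IsIrreducible V 𝔸.zariski (E ∩ O') ∧ r ≤ 𝔸.dim (E ∩ O') := by
  let _ := 𝔸.zariski
  obtain ⟨P, rfl⟩ := hE
  obtain ⟨x, hxO, hxP⟩ := hne
  obtain ⟨g, hg, hgx, hgO⟩ := hA.exists_basic hO hxP.1 hxO
  let Q : 𝔸.AffinePiece := ⟨P.i, P.eqs, P.eqs_subset, P.h * g, mul_mem P.h_mem hg⟩
  have hQ : Q.carrier = P.carrier ∩ {y | y ∈ 𝔸.dom P.i ∧ g y ≠ 0} := by
    ext y
    constructor
    · rintro ⟨h1, h2, h3⟩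
      exact ⟨⟨h1, h2, left_ne_zero_of_mul h3⟩, h1, right_ne_zero_of_mul h3⟩
    · rintro ⟨⟨h1, h2, h3⟩, -, h4⟩
      exact ⟨h1, h2, mul_ne_zero h3 h4⟩
  have hopen := 𝔸.isOpen_basic hg
  refine ⟨_, hopen, fun y hy => hgO y hy.1 hy.2, ⟨Q, hQ⟩,
    ⟨⟨x, hxP, hxP.1, hgx⟩, hirr.2.inter_isOpen hopen⟩, ?_⟩
  rw [← hQ, Q.dim_carrier hA]
  rw [P.dim_carrier hA] at hr
  have : IrreducibleSpace P.carrier := by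
    have := isIrreducible_preimage_val (S := P.carrier) (W := Set.univ) (by simpa using hirr)
    rw [Set.preimage_univ] at this
    exact irreducibleSpace_def _ |>.mpr this
  -- The open subset is prescribed here and may avoid a given chain, so the dimension is kept by
  -- algebra: inverting a nonzero element of a finitely generated domain does not lower it.
  have := (P.isZariskiFor hA).isDomain
  have := (P.isAffineAlgebra hA).finiteType
  let ι : Q.carrier → P.carrier := fun y => ⟨y.1, (hQ.le y.2).1⟩
  let h : P.carrier → k := fun y => g y
  have hh : h ∈ P.coordRing := P.mem_coordRing_iff.mpr ⟨g, hg, 0, fun y => by simp [h]⟩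
  have hrange : Set.range ι = {x | h x ≠ 0} := by
    ext y
    constructor
    · rintro ⟨z, rfl⟩; exact (hQ.le z.2).2.2
    · exact fun hy => ⟨⟨y.1, hQ.ge ⟨y.2, y.2.1, hy⟩⟩, rfl⟩
  let _ : Algebra P.coordRing (locAlg ι P.coordRing h) :=
    (toLocAlg ι P.coordRing h).toRingHom.toAlgebra
  have hloc := isLocalization_locAlg hh ι hrange
  have key := le_ringKrullDim_away k (g := (⟨h, hh⟩ : P.coordRing)) (fun h0 => hgx
    (congrFun (congrArg Subtype.val h0) ⟨x, hxP⟩)) (locAlg ι P.coordRing h) hr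
  rwa [P.coordRing_eq_locAlg hA Q ι (fun _ => rfl) ∅ (Set.empty_subset _) hh (by simpa using hrange)]

/-- The dimension of a finite union of subvarieties is attained on an irreducible affine subvariety
of one of them. -/
theorem exists_affine_of_le_dim (hA : 𝔸.Good) {ι : Type*} (L : ι → Set V) (s : Finset ι)
    (hL : ∀ i ∈ s, 𝔸.LocClosed (L i)) {C : Set V} (hC : C ⊆ ⋃ i ∈ s, L i) {r : ℕ} (hr : r ≤ 𝔸.dim C) :
    ∃ i ∈ s, ∃ E ⊆ L i, 𝔸.IsAffineSet E ∧ @IsIrreducible V 𝔸.zariski E ∧ r ≤ 𝔸.dim E := by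
  let _ := 𝔸.zariski
  obtain ⟨W, hl, hW⟩ := le_topologicalKrullDim_iff.mp hr
  obtain ⟨y, hy⟩ := (W 0).isIrreducible'.1
  obtain ⟨x, hx0, hxC⟩ := closure_nonempty_iff.mp ⟨y, hW 0 hy⟩
  obtain ⟨i, hi⟩ := hA.exists_mem_dom x
  have hopen := 𝔸.isOpen_dom i
  have hxl : ∀ l, x ∈ (W l : Set V) := fun l => W.monotone (Fin.zero_le l) hx0
  -- `T` is the top of a chain of irreducible closed sets in each of which `C` is dense. The chart
  -- around a point of the bottom member meets the whole chain, so the affine set `E₀` still has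
  -- dimension at least `r`.
  let T : Set V := W (Fin.last _)
  have hT : IsIrreducible T := (W (Fin.last _)).isIrreducible'
  let E₀ := 𝔸.dom i ∩ T
  have hE₀ : 𝔸.IsAffineSet E₀ := (𝔸.isAffineSet_dom i).inter_closed hA (W (Fin.last _)).isClosed'
  have hirr₀ : IsIrreducible E₀ := by
    refine ⟨⟨x, hi, hxl _⟩, ?_⟩
    have := hT.2.inter_isOpen hopen
    rwa [Set.inter_comm] at this
  have hr₀ : r ≤ 𝔸.dim E₀ := by
    refine le_topologicalKrullDim_iff.mpr ⟨W, hl, fun l => ?_⟩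
    refine (subset_closure_inter_of_isPreirreducible_of_isOpen (W l).isIrreducible'.2 hopen
      ⟨x, hxl l, hi⟩).trans (closure_mono fun z hz => ⟨hz.1, hz.2, ?_⟩)
    exact W.monotone (Fin.le_last l) hz.1
  obtain ⟨j, hj, O, hO, hne, hsub⟩ := exists_isOpen_inter_subset (K := T ∩ C ∩ 𝔸.dom i) L s hL
    ⟨x, ⟨hxl _, hxC⟩, hi⟩ (fun z hz => hC hz.1.2)
  obtain ⟨U, Z, hU, hZ, hUZ⟩ := hL j hj
  obtain ⟨z, hzO, ⟨hzT, hzC⟩, hzi⟩ := hne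
  -- Only points of `C` are known to lie in `L j`. As `C` is dense in `T`, the closed factor of `L
  -- j` nevertheless contains all of `O ∩ E₀`; intersecting with the open factor `U` then ends in `L
  -- j`.
  have hsubZ : O ∩ E₀ ⊆ Z := by
    rintro y ⟨hyO, hyi, hyT⟩
    refine hZ.closure_subset_iff.mpr (fun w hw => ?_) ((hO.inter hopen).inter_closure
      ⟨⟨hyO, hyi⟩, hW _ hyT⟩)
    exact (hUZ.le (hsub ⟨hw.1.1, hw.2, hw.1.2⟩)).2
  have hzU : z ∈ U := (hUZ.le (hsub ⟨hzO, ⟨hzT, hzC⟩, hzi⟩)).1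
  obtain ⟨O', hO', hsub', h1, h2, h3⟩ := Atlas.exists_isOpen_le_dim hA hE₀ hirr₀ (hO.inter hU)
    ⟨z, ⟨hzO, hzU⟩, hzi, hzT⟩ hr₀
  refine ⟨j, hj, _, ?_, h1, h2, h3⟩
  rintro y ⟨hy1, hy2⟩
  exact hUZ.ge ⟨(hsub' hy2).2, hsubZ ⟨(hsub' hy2).1, hy1⟩⟩

/-- A constructible set of smaller dimension misses a nonempty open subset of an irreducible affine
variety. -/
theorem exists_isOpen_disjoint (hA : 𝔸.Good) {E K : Set V} (hE : 𝔸.IsAffineSet E)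
    (hirr : @IsIrreducible V 𝔸.zariski E) (hK : 𝔸.Cells K) {r : ℕ} (hr : r ≤ 𝔸.dim E)
    (hd : 𝔸.dim K < r) :
    ∃ O, IsOpen[𝔸.zariski] O ∧ (O ∩ E).Nonempty ∧ ∀ x ∈ O ∩ E, x ∉ K := by
  let _ := 𝔸.zariski
  obtain ⟨a, L, hL, hLK⟩ := hK.constructible
  obtain ⟨b, L', hL', hLK'⟩ := ((Cells.univ hA).diff hA hK).constructible
  -- Some locally closed piece of `K` or of its complement contains a nonempty open part of `E`. It
  -- cannot be a piece of `K`, since such an open part has dimension at least `r`.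
  obtain ⟨j, -, O, hO, hne, hsub⟩ := exists_isOpen_inter_subset (K := E) (Sum.elim L L') Finset.univ
    (by rintro (i | i) -; exacts [hL i, hL' i]) hirr.1 (fun x _ => by
      by_cases hx : x ∈ K
      · rw [hLK] at hx
        obtain ⟨i, hi⟩ := Set.mem_iUnion.mp hx
        exact Set.mem_biUnion (Finset.mem_univ (Sum.inl i)) hi
      · have hx' : x ∈ Set.univ \ K := ⟨trivial, hx⟩
        rw [hLK'] at hx'
        obtain ⟨i, hi⟩ := Set.mem_iUnion.mp hx'
        exact Set.mem_biUnion (Finset.mem_univ (Sum.inr i)) hi)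
  rcases j with j | j
  · obtain ⟨O', hO', hsub', -, -, h3⟩ := Atlas.exists_isOpen_le_dim hA hE hirr hO hne hr
    refine absurd (h3.trans (dim_mono fun x hx => ?_)) (not_le_of_gt hd)
    rw [hLK]
    exact Set.mem_iUnion.mpr ⟨j, hsub ⟨hsub' hx.2, hx.1⟩⟩
  · refine ⟨O, hO, hne, fun x hx => ?_⟩
    have : x ∈ Set.univ \ K := by
      rw [hLK']; exact Set.mem_iUnion.mpr ⟨j, hsub hx⟩
    exact this.2

end Dimension

end Atlas

namespace Atlas

/-! ### Products with affine spaces, topologically -/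

section ProdTopology

variable {k : Type u} [Field k] {V W : Type u} {𝔸 : Atlas k V} {𝔹 : Atlas k W}

theorem continuous_fst_prodAffine (d : ℕ) :
    @Continuous _ _ (𝔸.prodAffine d).zariski 𝔸.zariski Prod.fst := by
  let _ := 𝔸.zariski
  let _ := (𝔸.prodAffine d).zariski
  refine continuous_generateFrom_iff.mpr ?_
  rintro _ ⟨i, g, hg, rfl⟩
  exact (𝔸.prodAffine d).isOpen_basic (i := i) (poly_prodAffine_fst hg)

theorem poly_slice {d : ℕ} {i : 𝔸.ι} {g : V × (Fin d → k) → k} (hg : g ∈ (𝔸.prodAffine d).poly i)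
    (a : Fin d → k) : (fun x => g (x, a)) ∈ 𝔸.poly i := by
  induction hg using Algebra.adjoin_induction with
  | mem c hc =>
    rcases hc with ⟨c, hc, rfl⟩ | ⟨b, rfl⟩
    · exact Algebra.subset_adjoin hc
    · exact Subalgebra.algebraMap_mem _ (a b)
  | algebraMap r => exact Subalgebra.algebraMap_mem _ r
  | add x y _ _ hx hy => exact add_mem hx hy
  | mul x y _ _ hx hy => exact mul_mem hx hy

theorem exists_eval_eq {d : ℕ} {i : 𝔸.ι} {g : V × (Fin d → k) → k}
    (hg : g ∈ (𝔸.prodAffine d).poly i) (x : V) :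
    ∃ F : MvPolynomial (Fin d) k, ∀ a, MvPolynomial.eval a F = g (x, a) := by
  induction hg using Algebra.adjoin_induction with
  | mem c hc =>
    rcases hc with ⟨c, hc, rfl⟩ | ⟨b, rfl⟩
    · exact ⟨MvPolynomial.C (c x), by simp⟩
    · exact ⟨MvPolynomial.X b, by simp⟩
  | algebraMap r => exact ⟨MvPolynomial.C r, fun a => by simp⟩
  | add y z _ _ hy hz =>
    obtain ⟨F, hF⟩ := hy
    obtain ⟨G, hG⟩ := hz
    exact ⟨F + G, fun a => by simp [hF, hG]⟩
  | mul y z _ _ hy hz =>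
    obtain ⟨F, hF⟩ := hy
    obtain ⟨G, hG⟩ := hz
    exact ⟨F * G, fun a => by simp [hF, hG]⟩

/-- The image of an open set is the union of its preimages under the continuous sections `x ↦ (x,
a)`. -/
theorem isOpenMap_fst_prodAffine (d : ℕ) :
    @IsOpenMap _ _ (𝔸.prodAffine d).zariski 𝔸.zariski Prod.fst := by
  let _ := 𝔸.zariski
  let _ := (𝔸.prodAffine d).zariski
  intro O hO
  have hc : ∀ a : Fin d → k, Continuous fun x : V => (x, a) := fun a => by
    refine continuous_generateFrom_iff.mpr ?_
    rintro _ ⟨i, g, hg, rfl⟩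
    exact 𝔸.isOpen_basic (i := i) (poly_slice hg a)
  have : Prod.fst '' O = ⋃ a, (fun x : V => (x, a)) ⁻¹' O := by
    ext x
    simp
  rw [this]
  exact isOpen_iUnion fun a => hO.preimage (hc a)

/-- The projection is open, so two open sets that meet the product both meet the fiber over some
common `z ∈ E`. That fiber is an affine space over an infinite field, where two nonzero polynomials
are nonzero at a common point. -/
theorem isIrreducible_prod [Infinite k] (hA : 𝔸.Good) (d : ℕ) {E : Set V}
    (hE : @IsIrreducible V 𝔸.zariski E) :
    @IsIrreducible _ (𝔸.prodAffine d).zariski {x : V × (Fin d → k) | x.1 ∈ E} := by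
  let _ := 𝔸.zariski
  let _ := (𝔸.prodAffine d).zariski
  constructor
  · obtain ⟨x, hx⟩ := hE.1
    exact ⟨(x, 0), hx⟩
  · rintro u v hu hv ⟨x, hxE, hxu⟩ ⟨y, hyE, hyv⟩
    obtain ⟨z, hzE, ⟨⟨_, a⟩, ha, rfl⟩, ⟨⟨_, b⟩, hb, rfl⟩⟩ := hE.2 _ _
      (𝔸.isOpenMap_fst_prodAffine d u hu) (𝔸.isOpenMap_fst_prodAffine d v hv)
      ⟨x.1, hxE, x, hxu, rfl⟩ ⟨y.1, hyE, y, hyv, rfl⟩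
    rename_i z
    obtain ⟨i, hi⟩ := hA.exists_mem_dom z
    obtain ⟨g, hg, hga, hgu⟩ := (hA.prodAffine d).exists_basic hu (i := i) (x := (z, a)) hi ha
    obtain ⟨g', hg', hgb, hgv⟩ := (hA.prodAffine d).exists_basic hv (i := i) (x := (z, b)) hi hb
    obtain ⟨F, hF⟩ := exists_eval_eq hg z
    obtain ⟨G, hG⟩ := exists_eval_eq hg' z
    have hF0 : F ≠ 0 := by rintro rfl; exact hga (by simp [← hF])
    have hG0 : G ≠ 0 := by rintro rfl; exact hgb (by simp [← hG])
    obtain ⟨c, hc⟩ : ∃ c, MvPolynomial.eval c (F * G) ≠ 0 := by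
      by_contra! h
      exact mul_ne_zero hF0 hG0 (MvPolynomial.funext fun c => by simpa using h c)
    rw [map_mul, hF, hG] at hc
    exact ⟨(z, c), hzE, hgu _ hi (left_ne_zero_of_mul hc), hgv _ hi (right_ne_zero_of_mul hc)⟩

end ProdTopology

/-! ### Trivial and piecewise trivial fibrations -/

section Fibrations

variable {k : Type u} [Field k] {V W : Type u} {𝔸 : Atlas k V} {𝔹 : Atlas k W} {d : ℕ} {p : W → V}

theorem TrivialOver.restrict (hA : 𝔸.Good) (hB : 𝔹.Good) {T : Set W} {S S' : Set V}
    (h : TrivialOver 𝔸 𝔹 d p T S) (hS : S' ⊆ S) : TrivialOver 𝔸 𝔹 d p (T ∩ p ⁻¹' S') S' := by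
  obtain ⟨φ, ψ, hφ, hψ, h1, h2, h3⟩ := h
  refine ⟨φ, ψ, hφ.restrict hB Set.inter_subset_left fun y hy => ?_,
    hψ.restrict (hA.prodAffine d) (fun x hx => hS hx) fun x hx => ?_,
    fun y hy => h1 hy.1, fun x hx => h2 (hS hx), fun y hy => h3 y hy.1⟩
  · change (φ y).1 ∈ S'
    rw [h3 y hy.1]; exact hy.2
  · have hT := hψ.1 (show x ∈ {x : V × (Fin d → k) | x.1 ∈ S} from hS hx)
    refine ⟨hT, ?_⟩
    change p (ψ x) ∈ S'
    rw [← h3 _ hT, h2 (show x ∈ {x : V × (Fin d → k) | x.1 ∈ S} from hS hx)]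
    exact hx

theorem TrivialOver.locClosed {T : Set W} {S L : Set V}
    (h : TrivialOver 𝔸 𝔹 d p T S) (hT : 𝔹.LocClosed T) (hL : 𝔸.LocClosed L) :
    𝔹.LocClosed (T ∩ p ⁻¹' L) := by
  obtain ⟨φ, ψ, hφ, -, -, -, h3⟩ := h
  let _ := 𝔸.zariski
  let _ := (𝔸.prodAffine d).zariski
  have h4 : (𝔸.prodAffine d).LocClosed (Prod.fst ⁻¹' L) :=
    IsLocallyClosed.preimage hL (continuous_fst_prodAffine d)
  have := hφ.locClosed_preimage hT h4
  convert this using 1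
  ext y
  constructor
  · rintro ⟨h, h'⟩; exact ⟨h, by change (φ y).1 ∈ L; rwa [h3 y h]⟩
  · rintro ⟨h, h'⟩; exact ⟨h, by change p y ∈ L; rw [← h3 y h]; exact h'⟩

theorem TrivialOver.isIrreducible [Infinite k] (hA : 𝔸.Good) {T : Set W} {S : Set V}
    (h : TrivialOver 𝔸 𝔹 d p T S) (hS : @IsIrreducible V 𝔸.zariski S) :
    @IsIrreducible W 𝔹.zariski T := by
  obtain ⟨φ, ψ, hφ, hψ, h1, h2, h3⟩ := h
  let _ := 𝔹.zariski
  let _ := (𝔸.prodAffine d).zariski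
  have : T = ψ '' {x | x.1 ∈ S} := by
    ext y
    constructor
    · exact fun hy => ⟨φ y, hφ.1 hy, h1 hy⟩
    · rintro ⟨x, hx, rfl⟩; exact hψ.1 hx
  rw [this]
  exact (isIrreducible_prod hA d hS).image ψ hψ.2.1

/-- A trivial fibration is an open map. -/
theorem TrivialOver.exists_isOpen {T O : Set W} {S : Set V}
    (h : TrivialOver 𝔸 𝔹 d p T S) (hO : IsOpen[𝔹.zariski] O) :
    ∃ O', IsOpen[𝔸.zariski] O' ∧ O' ∩ S = p '' (O ∩ T) := by
  obtain ⟨φ, ψ, hφ, hψ, h1, h2, h3⟩ := h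
  obtain ⟨O', hO', h⟩ := hψ.exists_isOpen hO
  refine ⟨_, 𝔸.isOpenMap_fst_prodAffine d O' hO', ?_⟩
  ext x
  constructor
  · rintro ⟨⟨⟨x, a⟩, hx, rfl⟩, hxS⟩
    have hxS' : (x, a) ∈ {x : V × (Fin d → k) | x.1 ∈ S} := hxS
    have hT := hψ.1 hxS'
    refine ⟨ψ (x, a), ⟨(h.ge ⟨hxS', hx⟩).2, hT⟩, ?_⟩
    rw [← h3 _ hT, h2 hxS']
  · rintro ⟨y, ⟨hyO, hyT⟩, rfl⟩
    rw [← h3 y hyT]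
    have := hφ.1 hyT
    refine ⟨⟨φ y, (h.le ⟨this, ?_⟩).2, rfl⟩, this⟩
    change ψ (φ y) ∈ O
    rwa [h1 hyT]

theorem TrivialOver.dim_eq [IsAlgClosed k] (hA : 𝔸.Good) {T : Set W} {S : Set V}
    (h : TrivialOver 𝔸 𝔹 d p T S) (hS : 𝔸.IsAffineSet S) : 𝔹.dim T = 𝔸.dim S + d := by
  obtain ⟨φ, ψ, hφ, hψ, h1, h2, -⟩ := h
  rw [hφ.dim_eq hψ h1 h2, dim_prod hA hS]

variable {B B' : Set W} {C C' : Set V}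

theorem PiecewiseTrivial.of_fintype {ι : Type*} [Fintype ι] (hp : Set.MapsTo p B C) (S : ι → Set V)
    (hd : Pairwise (Function.onFun Disjoint S)) (hC : C = ⋃ j, S j)
    (h : ∀ j, 𝔸.LocClosed (S j) ∧ 𝔹.LocClosed (B ∩ p ⁻¹' S j) ∧
      TrivialOver 𝔸 𝔹 d p (B ∩ p ⁻¹' S j) (S j)) : PiecewiseTrivial 𝔸 𝔹 d p B C := by
  let e := Fintype.equivFin ι
  refine ⟨hp, Fintype.card ι, S ∘ e.symm, fun i j hij => hd (e.symm.injective.ne hij), ?_,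
    fun j => h (e.symm j)⟩
  rw [hC]
  exact (e.symm.surjective.iUnion_comp S).symm

theorem PiecewiseTrivial.union (h : PiecewiseTrivial 𝔸 𝔹 d p B C)
    (h' : PiecewiseTrivial 𝔸 𝔹 d p B' C') (hd : Disjoint C C') :
    PiecewiseTrivial 𝔸 𝔹 d p (B ∪ B') (C ∪ C') := by
  obtain ⟨hp, r, S, hS, rfl, h⟩ := h
  obtain ⟨hp', r', S', hS', rfl, h'⟩ := h'
  have hSS : ∀ i j, Disjoint (S i) (S' j) := fun i j =>
    hd.mono (Set.subset_iUnion S i) (Set.subset_iUnion S' j)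
  refine .of_fintype (ι := Fin r ⊕ Fin r') ?_ (Sum.elim S S') ?_ ?_ ?_
  · rintro y (hy | hy)
    exacts [Or.inl (hp hy), Or.inr (hp' hy)]
  · rintro (i | i) (j | j) hij
    · exact hS fun h => hij (congrArg _ h)
    · exact hSS i j
    · exact (hSS j i).symm
    · exact hS' fun h => hij (congrArg _ h)
  · ext x; simp
  · rintro (j | j)
    · have : (B ∪ B') ∩ p ⁻¹' S j = B ∩ p ⁻¹' S j := by
        rw [Set.union_inter_distrib_right, Set.union_eq_left]
        rintro y ⟨hy, hyS⟩
        exact absurd (hp' hy) fun h =>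
          Set.disjoint_left.mp hd (Set.mem_iUnion.mpr ⟨j, hyS⟩) h
      change 𝔸.LocClosed (S j) ∧ 𝔹.LocClosed ((B ∪ B') ∩ p ⁻¹' S j) ∧
        TrivialOver 𝔸 𝔹 d p ((B ∪ B') ∩ p ⁻¹' S j) (S j)
      rw [this]
      exact h j
    · have : (B ∪ B') ∩ p ⁻¹' S' j = B' ∩ p ⁻¹' S' j := by
        rw [Set.union_inter_distrib_right, Set.union_eq_right]
        rintro y ⟨hy, hyS⟩
        exact absurd (hp hy) fun h =>
          Set.disjoint_left.mp hd h (Set.mem_iUnion.mpr ⟨j, hyS⟩)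
      change 𝔸.LocClosed (S' j) ∧ 𝔹.LocClosed ((B ∪ B') ∩ p ⁻¹' S' j) ∧
        TrivialOver 𝔸 𝔹 d p ((B ∪ B') ∩ p ⁻¹' S' j) (S' j)
      rw [this]
      exact h' j

variable [IsAlgClosed k]

/-- The base of a piecewise trivial fibration, or any constructible subset of it, is a finite
disjoint union of affine subvarieties over which the fibration is trivial. -/
theorem PiecewiseTrivial.exists_affine (hA : 𝔸.Good) (hB : 𝔹.Good)
    (h : PiecewiseTrivial 𝔸 𝔹 d p B C) (hC' : 𝔸.Cells C') (hsub : C' ⊆ C) :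
    ∃ (ι : Type) (_ : Fintype ι) (S : ι → Set V), Pairwise (Function.onFun Disjoint S) ∧
      C' = ⋃ j, S j ∧ ∀ j, 𝔸.IsAffineSet (S j) ∧ 𝔹.LocClosed (B ∩ p ⁻¹' S j) ∧
        TrivialOver 𝔸 𝔹 d p (B ∩ p ⁻¹' S j) (S j) := by
  obtain ⟨hp, r, S, hS, rfl, h⟩ := h
  choose ι hι P hP hPS using fun j => (hC'.inter_locClosed hA (h j).1).exists_pieces
  have hle : ∀ j l, (P j l).carrier ⊆ C' ∩ S j := fun j l => by
    rw [hPS j]; exact Set.subset_iUnion (fun l => (P j l).carrier) l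
  refine ⟨Σ j, ι j, inferInstance, fun x => (P x.1 x.2).carrier, ?_, ?_, ?_⟩
  · rintro ⟨i, a⟩ ⟨j, b⟩ hij
    by_cases hne : i = j
    · subst hne
      exact hP i fun h => hij (Sigma.ext rfl (heq_of_eq h))
    · exact (hS hne).mono ((hle i a).trans Set.inter_subset_right)
        ((hle j b).trans Set.inter_subset_right)
  · ext x
    rw [Set.mem_iUnion]
    constructor
    · intro hx
      obtain ⟨j, hj⟩ := Set.mem_iUnion.mp (hsub hx)
      have : x ∈ C' ∩ S j := ⟨hx, hj⟩
      rw [hPS j] at this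
      obtain ⟨l, hl⟩ := Set.mem_iUnion.mp this
      exact ⟨⟨j, l⟩, hl⟩
    · rintro ⟨⟨j, l⟩, hl⟩
      exact (hle j l hl).1
  · rintro ⟨j, l⟩
    have heq : B ∩ p ⁻¹' (P j l).carrier = B ∩ p ⁻¹' S j ∩ p ⁻¹' (P j l).carrier := by
      rw [Set.inter_assoc, ← Set.preimage_inter, Set.inter_eq_right.mpr
        ((hle j l).trans Set.inter_subset_right)]
    change _ ∧ 𝔹.LocClosed (B ∩ p ⁻¹' (P j l).carrier) ∧
      TrivialOver 𝔸 𝔹 d p (B ∩ p ⁻¹' (P j l).carrier) (P j l).carrier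
    rw [heq]
    exact ⟨(P j l).isAffineSet, (h j).2.2.locClosed (h j).2.1 (P j l).isAffineSet.locClosed,
      (h j).2.2.restrict hA hB ((hle j l).trans Set.inter_subset_right)⟩

theorem PiecewiseTrivial.base_cells (hA : 𝔸.Good) (h : PiecewiseTrivial 𝔸 𝔹 d p B C) :
    𝔸.Cells C := by
  obtain ⟨hp, r, S, hS, rfl, h⟩ := h
  exact cells_iUnion hA S fun j => (h j).1

theorem PiecewiseTrivial.restrict (hA : 𝔸.Good) (hB : 𝔹.Good)
    (h : PiecewiseTrivial 𝔸 𝔹 d p B C) (hC' : 𝔸.Cells C') (hsub : C' ⊆ C) :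
    PiecewiseTrivial 𝔸 𝔹 d p (B ∩ p ⁻¹' C') C' := by
  obtain ⟨ι, _, S, hS, rfl, h⟩ := h.exists_affine hA hB hC' hsub
  refine .of_fintype (fun y hy => hy.2) S hS rfl fun j => ?_
  have : B ∩ p ⁻¹' (⋃ j, S j) ∩ p ⁻¹' S j = B ∩ p ⁻¹' S j := by
    rw [Set.inter_assoc, ← Set.preimage_inter, Set.inter_eq_right.mpr (Set.subset_iUnion S j)]
  rw [this]
  exact ⟨(h j).1.locClosed, (h j).2⟩

theorem PiecewiseTrivial.eq_iUnion {ι : Type*} {S : ι → Set V} (hp : Set.MapsTo p B C)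
    (hC : C = ⋃ j, S j) : B = ⋃ j, B ∩ p ⁻¹' S j := by
  rw [← Set.inter_iUnion, ← Set.preimage_iUnion, ← hC]
  exact (Set.inter_eq_left.mpr hp).symm

/-- With `PiecewiseTrivial.dim_eq`, this makes the normalizations by `𝕃^{-nd}` and `-nd` independent
of the level `n`. -/
theorem PiecewiseTrivial.cls_eq (hA : 𝔸.Good) (hB : 𝔹.Good)
    (h : PiecewiseTrivial 𝔸 𝔹 d p B C) :
    𝔹.cls B = ((M.L k ^ d : (M k)ˣ) : M k) * 𝔸.cls C := by
  have hp := h.1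
  obtain ⟨ι, _, S, hS, hC, h⟩ := h.exists_affine hA hB (h.base_cells hA) subset_rfl
  rw [eq_iUnion hp hC, hC, cls_iUnion hB _ (fun j => (h j).2.1.cells hB),
    cls_iUnion hA _ (fun j => (h j).1.cells) hS, Finset.mul_sum]
  · exact Finset.sum_congr rfl fun j _ => (h j).2.2.cls_eq hA hB (h j).2.1 (h j).1
  · exact fun i j hij => Set.disjoint_left.mpr fun y hy hy' =>
      Set.disjoint_left.mp (hS hij) hy.2 hy'.2

theorem exists_dim_le (hA : 𝔸.Good) {ι : Type*} [Fintype ι] (S : ι → Set V)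
    (hS : ∀ i, 𝔸.LocClosed (S i)) (hne : (⋃ i, S i).Nonempty) :
    ∃ i, 𝔸.dim (⋃ i, S i) ≤ 𝔸.dim (S i) := by
  obtain ⟨x, hx⟩ := hne
  obtain ⟨i₀, -⟩ := Set.mem_iUnion.mp hx
  obtain ⟨i, -, hi⟩ := Finset.exists_max_image Finset.univ (fun i => 𝔸.dim (S i))
    ⟨i₀, Finset.mem_univ _⟩
  refine ⟨i, le_of_forall_nat_le fun r hr => ?_⟩
  obtain ⟨j, -, E, hE, -, -, h⟩ := exists_affine_of_le_dim hA S Finset.univ (fun i _ => hS i)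
    (by simp) hr
  exact (h.trans (dim_mono hE)).trans (hi j (Finset.mem_univ _))

theorem PiecewiseTrivial.dim_eq (hA : 𝔸.Good) (hB : 𝔹.Good) (h : PiecewiseTrivial 𝔸 𝔹 d p B C) :
    𝔹.dim B = 𝔸.dim C + d := by
  have hp := h.1
  obtain ⟨ι, _, S, hS, hC, h⟩ := h.exists_affine hA hB (h.base_cells hA) subset_rfl
  have hBS := eq_iUnion hp hC
  have hdim := fun j => (h j).2.2.dim_eq hA (h j).1
  apply le_antisymm
  · refine le_of_forall_nat_le fun r hr => ?_
    rcases B.eq_empty_or_nonempty with h0 | h0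
    · rw [h0, dim_empty] at hr; simp at hr
    · obtain ⟨j, hj⟩ := exists_dim_le hB (fun j => B ∩ p ⁻¹' S j) (fun j => (h j).2.1)
        (hBS ▸ h0)
      rw [← hBS, hdim] at hj
      refine (hr.trans hj).trans (add_le_add_left (dim_mono ?_) _)
      rw [hC]
      exact Set.subset_iUnion S j
  · rcases C.eq_empty_or_nonempty with h0 | h0
    · rw [h0, dim_empty]; simp
    · obtain ⟨j, hj⟩ := exists_dim_le hA S (fun j => (h j).1.locClosed) (hC ▸ h0)
      rw [← hC] at hj
      refine (add_le_add_left hj _).trans ?_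
      rw [← hdim]
      exact dim_mono Set.inter_subset_left

end Fibrations

end Atlas

/-! ### Points with values in a ring -/

section Points

variable {X : Scheme.{u}} {R S O : CommRingCat.{u}}

/-- The homomorphism of rings given by a point with values in a ring that lies in an open `U`. -/
def pointHom (γ : Spec R ⟶ X) (U : X.Opens) (h : ⊤ ≤ γ ⁻¹ᵁ U) : Γ(X, U) ⟶ R :=
  γ.appLE U ⊤ h ≫ (Scheme.ΓSpecIso R).hom

variable {U : X.Opens}

/-- With `pointHom_SpecMap`, this identifies the `R`-valued points in an affine open with the ring
homomorphisms from its functions to `R`. -/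
theorem SpecMap_pointHom (hU : IsAffineOpen U) (γ : Spec R ⟶ X) (h : ⊤ ≤ γ ⁻¹ᵁ U) :
    Spec.map (pointHom γ U h) ≫ hU.fromSpec = γ := by
  rw [pointHom, Spec.map_comp, Category.assoc,
    hU.SpecMap_appLE_fromSpec γ (isAffineOpen_top (Spec R)) h, IsAffineOpen.fromSpec_top,
    Scheme.isoSpec_Spec_inv, ← Spec.map_comp_assoc, Iso.inv_hom_id, Spec.map_id, Category.id_comp]

theorem pointHom_injective (hU : IsAffineOpen U) {γ γ' : Spec R ⟶ X} {h : ⊤ ≤ γ ⁻¹ᵁ U}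
    {h' : ⊤ ≤ γ' ⁻¹ᵁ U} (H : pointHom γ U h = pointHom γ' U h') : γ = γ' := by
  rw [← SpecMap_pointHom hU γ h, H, SpecMap_pointHom]

theorem top_le_preimage (hU : IsAffineOpen U) (θ : Γ(X, U) ⟶ R) :
    ⊤ ≤ (Spec.map θ ≫ hU.fromSpec) ⁻¹ᵁ U := by
  rw [Scheme.Hom.comp_preimage, hU.fromSpec_preimage_self]
  exact le_rfl

theorem pointHom_SpecMap (hU : IsAffineOpen U) (θ : Γ(X, U) ⟶ R) (h) :
    pointHom (Spec.map θ ≫ hU.fromSpec) U h = θ := by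
  apply Spec.map_injective
  rw [← cancel_mono hU.fromSpec, SpecMap_pointHom]

theorem pointHom_comp (γ : Spec R ⟶ X) (ψ : R ⟶ S) (h : ⊤ ≤ γ ⁻¹ᵁ U)
    (h' : ⊤ ≤ (Spec.map ψ ≫ γ) ⁻¹ᵁ U) :
    pointHom (Spec.map ψ ≫ γ) U h' = pointHom γ U h ≫ ψ := by
  rw [pointHom, pointHom, Category.assoc, ← Scheme.ΓSpecIso_naturality,
    ← Scheme.Hom.appLE_comp_appLE (Spec.map ψ) γ U ⊤ ⊤ h le_rfl, Category.assoc]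
  congr 2

theorem pointHom_res {W : X.Opens} (hW : W ≤ U) (γ : Spec R ⟶ X) (h : ⊤ ≤ γ ⁻¹ᵁ W)
    (h' : ⊤ ≤ γ ⁻¹ᵁ U) : X.presheaf.map (homOfLE hW).op ≫ pointHom γ W h = pointHom γ U h' := by
  rw [pointHom, pointHom, ← Category.assoc, Scheme.Hom.map_appLE]

theorem top_le_preimage_basicOpen_iff (hU : IsAffineOpen U) (γ : Spec R ⟶ X) (h : ⊤ ≤ γ ⁻¹ᵁ U)
    (s : Γ(X, U)) : ⊤ ≤ γ ⁻¹ᵁ X.basicOpen s ↔ IsUnit ((pointHom γ U h).hom s) := by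
  conv_lhs => rw [← SpecMap_pointHom hU γ h]
  rw [Scheme.Hom.comp_preimage, hU.fromSpec_preimage_basicOpen]
  rw [← not_iff_not, ← mem_nonunits_iff]
  constructor
  · intro H
    by_contra hu
    refine H fun x _ => ?_
    change (pointHom γ U h).hom s ∉ x.asIdeal
    exact fun hx => x.2.ne_top (Ideal.eq_top_of_isUnit_mem _ hx (by simpa using hu))
  · intro hu H
    obtain ⟨M, hM, hs⟩ := exists_max_ideal_of_mem_nonunits hu
    exact (H (x := ⟨M, hM.isPrime⟩) trivial) hs

/-- The structure of an algebra over `O` on the functions on an open of a scheme over `O`. -/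
def structureHom (f : X ⟶ Spec O) (U : X.Opens) : O ⟶ Γ(X, U) :=
  (Scheme.ΓSpecIso O).inv ≫ f.appLE ⊤ U le_top

theorem fromSpec_comp (f : X ⟶ Spec O) (hU : IsAffineOpen U) :
    hU.fromSpec ≫ f = Spec.map (structureHom f U) := by
  rw [structureHom, Spec.map_comp,
    ← (isAffineOpen_top (Spec O)).SpecMap_appLE_fromSpec f hU le_top, IsAffineOpen.fromSpec_top,
    Scheme.isoSpec_Spec_inv]

theorem comp_eq_SpecMap_iff (f : X ⟶ Spec O) (hU : IsAffineOpen U) (γ : Spec R ⟶ X)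
    (h : ⊤ ≤ γ ⁻¹ᵁ U) (ρ : O ⟶ R) :
    γ ≫ f = Spec.map ρ ↔ structureHom f U ≫ pointHom γ U h = ρ := by
  conv_lhs => rw [← SpecMap_pointHom hU γ h]
  rw [Category.assoc, fromSpec_comp, ← Spec.map_comp]
  exact Spec.map_injective.eq_iff

theorem finiteType_structureHom (f : X ⟶ Spec O) [LocallyOfFiniteType f] (hU : IsAffineOpen U) :
    (structureHom f U).hom.FiniteType := by
  have h1 := LocallyOfFiniteType.finiteType_appLE f (isAffineOpen_top (Spec O)) hU le_top
  rw [structureHom, CommRingCat.hom_comp]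
  exact h1.comp (.of_surjective _ (ConcreteCategory.bijective_of_isIso (Scheme.ΓSpecIso O).inv).2)

/-- A point with values in a local ring lies in an open if its closed point does. -/
theorem top_le_preimage_of_closedPoint [IsLocalRing R] (γ : Spec R ⟶ X)
    (h : γ (closedPoint R) ∈ U) : ⊤ ≤ γ ⁻¹ᵁ U := by
  have : γ ⁻¹ᵁ U = ⊤ := (IsLocalRing.closed_point_mem_iff (U := (γ ⁻¹ᵁ U))).mp h
  exact this.ge

end Points

/-! ### Functions with values in a finite-dimensional algebra -/

section Valued

variable {k : Type u} [Field k] {S : Type u} (F : Subalgebra k (S → k)) (R : Type u) [CommRing R]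
  [Algebra k R] [Module.Finite k R]

/-- The functions with values in a finite-dimensional algebra whose coefficients lie in a given
algebra of functions. -/
def valued : Subalgebra k (S → R) where
  carrier := {T | ∀ l : R →ₗ[k] k, (fun x => l (T x)) ∈ F}
  algebraMap_mem' c l := by
    have : (fun x : S => l (algebraMap k (S → R) c x)) = algebraMap k (S → k) (l (algebraMap k R c)) :=
      rfl
    rw [this]
    exact F.algebraMap_mem _
  add_mem' {T T'} h h' l := by
    have : (fun x => l ((T + T') x)) = (fun x => l (T x)) + fun x => l (T' x) := by
      ext x; simp
    rw [this]
    exact add_mem (h l) (h' l)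
  -- In a basis of `R`, the coefficients of a product are bilinear in those of the factors, with the
  -- structure constants in `k`.
  mul_mem' {T T'} h h' l := by
    let b := Module.finBasis k R
    have : (fun x => l ((T * T') x)) = ∑ i, ∑ j, l (b i * b j) •
        ((fun x => b.coord i (T x)) * fun x => b.coord j (T' x)) := by
      ext x
      have h1 : (T * T') x = ∑ i, ∑ j, (b.repr (T x) i * b.repr (T' x) j) • (b i * b j) := by
        conv_lhs => rw [Pi.mul_apply, ← b.sum_repr (T x), ← b.sum_repr (T' x)]
        simp_rw [Finset.sum_mul_sum, smul_mul_smul_comm]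
      rw [h1]
      simp only [map_sum, map_smul, smul_eq_mul, Finset.sum_apply, Pi.smul_apply, Pi.mul_apply,
        Module.Basis.coord_apply]
      exact Finset.sum_congr rfl fun i _ => Finset.sum_congr rfl fun j _ => mul_comm _ _
    rw [this]
    exact sum_mem fun i _ => sum_mem fun j _ => F.smul_mem (mul_mem (h _) (h' _)) _

variable {F R}

theorem const_mem_valued (r : R) : (fun _ : S => r) ∈ valued F R := fun l =>
  F.algebraMap_mem (l r)

theorem smul_mem_valued {g : S → k} (hg : g ∈ F) {T : S → R} (hT : T ∈ valued F R) :
    (fun x => g x • T x) ∈ valued F R := fun l => by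
  have : (fun x => l (g x • T x)) = g * fun x => l (T x) := by ext x; simp
  rw [this]
  exact mul_mem hg (hT l)

/-- A character of the algebra of functions evaluates the functions with values in a
finite-dimensional algebra. -/
theorem exists_valued_hom (χ : F →ₐ[k] k) : ∃ E : valued F R →+* R,
    (∀ (T : valued F R) (l : R →ₗ[k] k), l (E T) = χ ⟨_, T.2 l⟩) ∧
    ∀ r : R, E ⟨_, const_mem_valued r⟩ = r := by
  let b := Module.finBasis k R
  -- `χ` is applied to each coefficient. The result is multiplicative because the structure
  -- constants of `R` are scalars, which `χ` fixes.
  let e : valued F R → R := fun T => ∑ i, χ ⟨_, T.2 (b.coord i)⟩ • b i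
  have hsep : ∀ r r' : R, (∀ l : R →ₗ[k] k, l r = l r') → r = r' := fun r r' h =>
    b.ext_elem fun i => h (b.coord i)
  have he : ∀ (T : valued F R) (l : R →ₗ[k] k), l (e T) = χ ⟨_, T.2 l⟩ := by
    intro T l
    have : (⟨_, T.2 l⟩ : F) = ∑ i, l (b i) • (⟨_, T.2 (b.coord i)⟩ : F) := by
      apply Subtype.ext
      ext x
      have h1 : l (T.1 x) = ∑ i, b.repr (T.1 x) i * l (b i) := by
        conv_lhs => rw [← b.sum_repr (T.1 x), map_sum]
        simp only [map_smul, smul_eq_mul]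
      simp only [AddSubmonoidClass.coe_finsetSum, Finset.sum_apply]
      rw [h1]
      exact Finset.sum_congr rfl fun i _ => mul_comm _ _
    rw [this, map_sum, map_sum]
    simp only [map_smul, smul_eq_mul]
    exact Finset.sum_congr rfl fun i _ => mul_comm _ _
  have hconst : ∀ r : R, e ⟨_, const_mem_valued r⟩ = r := fun r => hsep _ _ fun l => by
    rw [he]
    exact χ.commutes (l r)
  have hmul : ∀ T T', e (T * T') = e T * e T' := by
    intro T T'
    refine hsep _ _ fun l => ?_
    rw [he]
    have h1 : (⟨_, (T * T').2 l⟩ : F) = ∑ i, ∑ j, l (b i * b j) •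
        ((⟨_, T.2 (b.coord i)⟩ : F) * ⟨_, T'.2 (b.coord j)⟩) := by
      apply Subtype.ext
      ext x
      have h1 : T.1 x * T'.1 x =
          ∑ i, ∑ j, (b.repr (T.1 x) i * b.repr (T'.1 x) j) • (b i * b j) := by
        conv_lhs => rw [← b.sum_repr (T.1 x), ← b.sum_repr (T'.1 x)]
        simp_rw [Finset.sum_mul_sum, smul_mul_smul_comm]
      simp only [AddSubmonoidClass.coe_finsetSum, Finset.sum_apply]
      change l (T.1 x * T'.1 x) = _
      rw [h1]
      simp only [map_sum, map_smul, smul_eq_mul]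
      exact Finset.sum_congr rfl fun i _ => Finset.sum_congr rfl fun j _ => mul_comm _ _
    rw [h1]
    have h2 : e T * e T' = ∑ i, ∑ j, (χ ⟨_, T.2 (b.coord i)⟩ * χ ⟨_, T'.2 (b.coord j)⟩) •
        (b i * b j) := by
      simp_rw [e, Finset.sum_mul_sum, smul_mul_smul_comm]
    rw [h2]
    simp only [map_sum, map_smul, map_mul, smul_eq_mul]
    exact Finset.sum_congr rfl fun i _ => Finset.sum_congr rfl fun j _ => mul_comm _ _
  refine ⟨{ toFun := e, map_one' := hconst 1, map_mul' := hmul, map_zero' := hconst 0,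
            map_add' := fun T T' => hsep _ _ fun l => ?_ }, he, hconst⟩
  rw [map_add, he, he, he, ← map_add]
  congr 1
  apply Subtype.ext; ext x
  exact map_add l _ _

end Valued

/-! ### The truncations of a complete discrete valuation ring -/

section Truncation

variable {k O : Type u} [Field k] [CommRing O] [Algebra k O]

/-- The truncation `O / 𝔪 ^ (n + 1)`. -/
abbrev Trunc (O : Type u) [CommRing O] [IsLocalRing O] (n : ℕ) : Type u :=
  O ⧸ maximalIdeal O ^ (n + 1)

/-- As `k` maps onto the residue field, every element is congruent modulo `ϖ ^ N` to a
`k`-combination of the lower powers of the uniformizer `ϖ`. -/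
theorem finite_trunc [IsDomain O] [IsDiscreteValuationRing O]
    (hk : Function.Bijective (algebraMap k (ResidueField O))) (n : ℕ) :
    Module.Finite k (Trunc O n) := by
  obtain ⟨ϖ, hϖ⟩ := IsDiscreteValuationRing.exists_irreducible O
  have hm : maximalIdeal O = Ideal.span {ϖ} := hϖ.maximalIdeal_eq
  have key : ∀ N, ∀ x : O, ∃ y ∈ Submodule.span k ((fun i => ϖ ^ i) '' Set.Iio N),
      ∃ z, x = y + ϖ ^ N * z := by
    intro N
    induction N with
    | zero => exact fun x => ⟨0, zero_mem _, x, by simp⟩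
    | succ N ih =>
      intro x
      obtain ⟨y, hy, z, hz⟩ := ih x
      obtain ⟨c, hc⟩ := hk.2 (residue O z)
      have h1 : z - algebraMap k O c ∈ maximalIdeal O := by
        rw [← residue_eq_zero_iff, map_sub, ← hc, sub_eq_zero]
        rfl
      rw [hm, Ideal.mem_span_singleton] at h1
      obtain ⟨w, hw⟩ := h1
      refine ⟨y + c • ϖ ^ N, add_mem (Submodule.span_mono (Set.image_mono
        (Set.Iio_subset_Iio (Nat.le_succ N))) hy) (Submodule.smul_mem _ _
        (Submodule.subset_span ⟨N, Nat.lt_succ_self N, rfl⟩)), w, ?_⟩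
      rw [hz, Algebra.smul_def, pow_succ]
      linear_combination ϖ ^ N * hw
  refine Module.Finite.of_surjective (M := Submodule.span k ((fun i => ϖ ^ i) '' Set.Iio (n + 1)))
    (hM := ?_) (((Ideal.Quotient.mkₐ k _).toLinearMap).comp (Submodule.subtype _)) ?_
  · exact Module.Finite.span_of_finite k ((Set.finite_Iio _).image _)
  · intro q
    obtain ⟨x, rfl⟩ := Ideal.Quotient.mk_surjective q
    obtain ⟨y, hy, z, rfl⟩ := key (n + 1) x
    refine ⟨⟨y, hy⟩, ?_⟩
    change Ideal.Quotient.mk _ y = Ideal.Quotient.mk _ _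
    rw [Ideal.Quotient.eq, hm, Ideal.span_singleton_pow, Ideal.mem_span_singleton]
    exact ⟨-z, by ring⟩

variable [IsLocalRing O]

instance (n : ℕ) : Nontrivial (Trunc O n) :=
  Ideal.Quotient.nontrivial_iff.mpr fun h => by
    have := Ideal.pow_le_self (I := maximalIdeal O) (Nat.succ_ne_zero n)
    rw [Nat.succ_eq_add_one, h, top_le_iff] at this
    exact Ideal.IsMaximal.ne_top inferInstance this

instance (n : ℕ) : IsLocalRing (Trunc O n) :=
  IsLocalRing.of_surjective' (Ideal.Quotient.mk _) Ideal.Quotient.mk_surjective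

/-- The residue class of an element of the truncation. -/
def truncResidue (hk : Function.Bijective (algebraMap k (ResidueField O))) (n : ℕ) :
    Trunc O n →ₐ[k] k :=
  (AlgEquiv.ofBijective (Algebra.ofId k (ResidueField O)) hk).symm.toAlgHom.comp
    (Ideal.Quotient.factorₐ k (Ideal.pow_le_self (Nat.succ_ne_zero n)))

theorem isUnit_trunc_iff (hk : Function.Bijective (algebraMap k (ResidueField O))) {n : ℕ}
    {x : Trunc O n} : IsUnit x ↔ truncResidue hk n x ≠ 0 := by
  obtain ⟨x, rfl⟩ := Ideal.Quotient.mk_surjective x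
  have h1 : truncResidue hk n (Ideal.Quotient.mk _ x) = 0 ↔ x ∈ maximalIdeal O := by
    rw [← residue_eq_zero_iff]
    exact EmbeddingLike.map_eq_zero_iff
      (f := (AlgEquiv.ofBijective (Algebra.ofId k (ResidueField O)) hk).symm)
  rw [Ne, h1, mem_maximalIdeal, mem_nonunits_iff, not_not]
  have : IsLocalHom (Ideal.Quotient.mk (maximalIdeal O ^ (n + 1))) :=
    .of_surjective _ Ideal.Quotient.mk_surjective
  exact isUnit_map_iff _ x

/-- The difference lies in the maximal ideal. Its nilpotency allows an inverse on jets to be written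
with denominators in `k`. -/
theorem sub_truncResidue_pow (hk : Function.Bijective (algebraMap k (ResidueField O))) {n : ℕ}
    (x : Trunc O n) : (algebraMap k _ (truncResidue hk n x) - x) ^ (n + 1) = 0 := by
  have h0 : truncResidue hk n (algebraMap k _ (truncResidue hk n x) - x) = 0 := by
    rw [map_sub, AlgHom.commutes]; simp
  generalize algebraMap k _ (truncResidue hk n x) - x = y at h0
  obtain ⟨y, rfl⟩ := Ideal.Quotient.mk_surjective y
  have h1 : y ∈ maximalIdeal O := by
    by_contra h
    have : IsUnit y := by simpa using h
    exact (isUnit_trunc_iff hk).mp (this.map (Ideal.Quotient.mk _)) h0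
  rw [← map_pow, Ideal.Quotient.eq_zero_iff_mem]
  exact Ideal.pow_mem_pow h1 _

end Truncation

/-! ### The charts of the spaces of jets -/

section JetCharts

theorem eq_eval_of_adjoin {k T : Type u} [Field k] {R : Subalgebra k (T → k)} {G : Set (T → k)}
    (hR : R = Algebra.adjoin k G) (χ : R →ₐ[k] k) (x : T)
    (h : ∀ g (hg : g ∈ R), g ∈ G → χ ⟨g, hg⟩ = g x) (f : R) : χ f = f.1 x := by
  have key : ∀ f (hf : f ∈ R), χ ⟨f, hf⟩ = f x := by
    subst hR
    intro f hf
    induction hf using Algebra.adjoin_induction with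
    | mem g hg => exact h g _ hg
    | algebraMap r => exact χ.commutes r
    | add g g' hg hg' h1 h2 =>
      have := map_add χ ⟨g, hg⟩ ⟨g', hg'⟩
      rw [h1, h2] at this
      exact this
    | mul g g' hg hg' h1 h2 =>
      have := map_mul χ ⟨g, hg⟩ ⟨g', hg'⟩
      rw [h1, h2] at this
      exact this
  exact key f.1 f.2

theorem mem_valued_of_basis {k S R : Type u} [Field k] {F : Subalgebra k (S → k)} [CommRing R]
    [Algebra k R] [Module.Finite k R] {ι : Type*} [Fintype ι] (b : Module.Basis ι k R) {T : S → R}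
    (h : ∀ i, (fun x => b.coord i (T x)) ∈ F) : T ∈ valued F R := fun l => by
  have : (fun x => l (T x)) = ∑ i, l (b i) • (fun x => b.coord i (T x)) := by
    ext x
    have h1 : l (T x) = ∑ i, b.repr (T x) i * l (b i) := by
      conv_lhs => rw [← b.sum_repr (T x), map_sum]
      simp only [map_smul, smul_eq_mul]
    simp only [Finset.sum_apply]
    rw [h1]
    exact Finset.sum_congr rfl fun i _ => mul_comm _ _
  rw [this]
  exact sum_mem fun i _ => F.smul_mem (h i) _

variable {k O : Type u} [Field k] [CommRing O] [IsLocalRing O] [Algebra k O] {X : Scheme.{u}}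
  {f : X ⟶ Spec (CommRingCat.of O)} {n : ℕ}

variable (f k n) in
/-- The pullback of functions on an affine open along the jets in that open. -/
def jetFun (U : X.affineOpens) : Γ(X, U.1) →+* ((jetAtlas f k n).dom U → Trunc O n) :=
  RingHom.pi fun γ => (pointHom γ.1.1 U.1 γ.2).hom

theorem jetFun_structureHom (U : X.affineOpens) (o : O) :
    jetFun k f n U ((structureHom f U.1).hom o) = fun _ => Ideal.Quotient.mk _ o := by
  ext γ
  have := (comp_eq_SpecMap_iff f U.2 γ.1.1 γ.2 _).mp γ.1.2
  exact congrArg (fun φ => φ.hom o) this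

theorem exists_mem_coord (U : X.affineOpens) (s : Γ(X, U.1)) (l : Trunc O n →ₗ[k] k) :
    ∃ c ∈ (jetAtlas f k n).coord U, ∀ γ, c γ.1 = l (jetFun k f n U s γ) := by
  obtain ⟨c, hc⟩ := Atlas.exists_extension
    (fun γ : (jetAtlas f k n).dom U => l (jetFun k f n U s γ))
  have hc' : ∀ γ, c γ.1 = l (jetFun k f n U s γ) := fun γ => (congrFun hc γ).symm
  exact ⟨c, ⟨s, l, fun γ h => hc' ⟨γ, h⟩⟩, hc'⟩

theorem exists_of_mem_coord {U : X.affineOpens} {c : Jets f n → k}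
    (hc : c ∈ (jetAtlas f k n).coord U) :
    ∃ s, ∃ l : Trunc O n →ₗ[k] k, ∀ γ, c γ.1 = l (jetFun k f n U s γ) := by
  obtain ⟨s, l, h⟩ := hc
  exact ⟨s, l, fun γ => h γ.1 γ.2⟩

theorem chartRing_jetAtlas (U : X.affineOpens) : (jetAtlas f k n).chartRing U =
    Algebra.adjoin k {g | ∃ (s : Γ(X, U.1)) (l : Trunc O n →ₗ[k] k),
      g = fun γ => l (jetFun k f n U s γ)} := by
  refine (AlgHom.map_adjoin _ _).trans ?_
  congr 1
  ext g
  constructor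
  · rintro ⟨c, hc, rfl⟩
    obtain ⟨s, l, h⟩ := exists_of_mem_coord hc
    exact ⟨s, l, funext h⟩
  · rintro ⟨s, l, rfl⟩
    obtain ⟨c, hc, h⟩ := exists_mem_coord U s l
    exact ⟨c, hc, funext h⟩

theorem ext_of_jetFun (U : X.affineOpens) {γ γ' : (jetAtlas f k n).dom U}
    (h : ∀ s, jetFun k f n U s γ = jetFun k f n U s γ') : γ = γ' :=
  Subtype.ext (Subtype.ext (pointHom_injective U.2 (CommRingCat.hom_ext (RingHom.ext h))))

theorem exists_jet (U : X.affineOpens) (θ : Γ(X, U.1) →+* Trunc O n)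
    (hθ : ∀ o, θ ((structureHom f U.1).hom o) = Ideal.Quotient.mk _ o) :
    ∃ γ : (jetAtlas f k n).dom U, ∀ s, jetFun k f n U s γ = θ s := by
  have h1 := top_le_preimage U.2 (CommRingCat.ofHom θ)
  have h2 := pointHom_SpecMap U.2 (CommRingCat.ofHom θ) h1
  refine ⟨⟨⟨Spec.map (CommRingCat.ofHom θ) ≫ U.2.fromSpec, ?_⟩, h1⟩, fun s => ?_⟩
  · rw [comp_eq_SpecMap_iff f U.2 _ h1, h2]
    ext o
    exact hθ o
  · exact congrArg (fun φ => φ.hom s) h2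

/-- The jets in an open of the form `D(s)`. -/
theorem mem_basicOpen_iff (hk : Function.Bijective (algebraMap k (ResidueField O)))
    (U : X.affineOpens) (s : Γ(X, U.1)) (γ : (jetAtlas f k n).dom U) :
    ⊤ ≤ γ.1.1 ⁻¹ᵁ X.basicOpen s ↔ truncResidue hk n (jetFun k f n U s γ) ≠ 0 := by
  rw [top_le_preimage_basicOpen_iff U.2 _ γ.2, ← isUnit_trunc_iff hk]
  rfl

section Finite

variable [Module.Finite k (Trunc O n)]

theorem jetFun_mem_valued (U : X.affineOpens) (s : Γ(X, U.1)) :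
    jetFun k f n U s ∈ valued ((jetAtlas f k n).chartRing U) (Trunc O n) := fun l => by
  rw [chartRing_jetAtlas]
  exact Algebra.subset_adjoin ⟨s, l, rfl⟩

/-- The functions on `U` are generated over `O` by a finite set `G`, and elements of `O` have
constant pullbacks. So the coefficients of the members of `G` in a basis of the truncation generate
the coefficients of all functions. -/
theorem fg_chartRing_jetAtlas [LocallyOfFiniteType f] (U : X.affineOpens) :
    ((jetAtlas f k n).chartRing U).FG := by
  classical
  let _ : Algebra O Γ(X, U.1) := (structureHom f U.1).hom.toAlgebra
  have hfin : Algebra.FiniteType O Γ(X, U.1) := finiteType_structureHom f U.2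
  obtain ⟨G, hG⟩ := hfin.out
  let b := Module.finBasis k (Trunc O n)
  let C : Set ((jetAtlas f k n).dom U → k) :=
    Set.range fun (x : G × Fin (Module.finrank k (Trunc O n))) γ =>
      b.coord x.2 (jetFun k f n U x.1.1 γ)
  have hval : ∀ s, jetFun k f n U s ∈ valued (Algebra.adjoin k C) (Trunc O n) := by
    intro s
    have hs : s ∈ Algebra.adjoin O (G : Set Γ(X, U.1)) := by rw [hG]; trivial
    induction hs using Algebra.adjoin_induction with
    | mem s hs =>
      exact mem_valued_of_basis b fun i => Algebra.subset_adjoin ⟨⟨⟨s, hs⟩, i⟩, rfl⟩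
    | algebraMap o =>
      have : jetFun k f n U (algebraMap O Γ(X, U.1) o) = _ := jetFun_structureHom U o
      rw [this]
      exact const_mem_valued _
    | add x y _ _ hx hy => rw [map_add]; exact add_mem hx hy
    | mul x y _ _ hx hy => rw [map_mul]; exact mul_mem hx hy
  have heq : (jetAtlas f k n).chartRing U = Algebra.adjoin k C := by
    apply le_antisymm
    · rw [chartRing_jetAtlas]
      refine Algebra.adjoin_le ?_
      rintro _ ⟨s, l, rfl⟩
      exact hval s l
    · refine Algebra.adjoin_le ?_
      rintro _ ⟨x, rfl⟩
      exact jetFun_mem_valued U _ (b.coord x.2)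
  rw [heq]
  exact Subalgebra.fg_def.mpr ⟨C, Set.finite_range _, rfl⟩

/-- A character evaluates functions with values in the truncation. Composed with the map `J`, which
sends a function on `U` to its pullbacks along all jets, it yields an `O`-homomorphism to the
truncation, that is, a jet in `U`. -/
theorem isAffineAlgebra_chartRing [LocallyOfFiniteType f] (U : X.affineOpens) :
    IsAffineAlgebra ((jetAtlas f k n).chartRing U) := by
  refine ⟨fg_chartRing_jetAtlas U, fun χ => ?_⟩
  obtain ⟨E, hE, hE'⟩ := exists_valued_hom (R := Trunc O n) χ
  let J : Γ(X, U.1) →+* valued ((jetAtlas f k n).chartRing U) (Trunc O n) :=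
    (jetFun k f n U).codRestrict (valued ((jetAtlas f k n).chartRing U) (Trunc O n)).toSubring
      (jetFun_mem_valued U)
  obtain ⟨γ, hγ⟩ := exists_jet (k := k) U (E.comp J) (fun o => by
    rw [← hE' (Ideal.Quotient.mk _ o)]
    exact congrArg E (Subtype.ext (jetFun_structureHom U o)))
  refine ⟨γ, eq_eval_of_adjoin (chartRing_jetAtlas U) χ γ ?_⟩
  rintro _ hg ⟨s, l, rfl⟩
  exact (hE (J s) l).symm.trans (congrArg l (hγ s).symm)

theorem valued_mem_poly {U : X.affineOpens} {T : (jetAtlas f k n).dom U → Trunc O n}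
    (hT : T ∈ valued ((jetAtlas f k n).chartRing U) (Trunc O n)) (l : Trunc O n →ₗ[k] k) :
    ∃ a ∈ (jetAtlas f k n).poly U, ∀ γ, a γ.1 = l (T γ) := by
  obtain ⟨a, ha, h⟩ := hT l
  exact ⟨a, ha, congrFun h⟩

/-- Around the image of the closed point there is a basic open `D(s)` of `U` inside `W`. The jets in
`D(s)` are those at which the residue `g` of the pullback of `s` is nonzero. There a function on `W`
is `a / s ^ N`, and the inverse of the pullback of `s` has coefficients in the chart ring of `U` up
to a power of `g`. -/
theorem compat_jetAtlas (hk : Function.Bijective (algebraMap k (ResidueField O)))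
    (U W : X.affineOpens) (γ : Jets f n) (hU : γ ∈ (jetAtlas f k n).dom U)
    (hW : γ ∈ (jetAtlas f k n).dom W) :
    ∃ g ∈ (jetAtlas f k n).poly U, g γ ≠ 0 ∧
      (∀ y ∈ (jetAtlas f k n).dom U, g y ≠ 0 → y ∈ (jetAtlas f k n).dom W) ∧
      ∀ c ∈ (jetAtlas f k n).coord W, ∃ a ∈ (jetAtlas f k n).poly U, ∃ N : ℕ,
        ∀ y ∈ (jetAtlas f k n).dom U, g y ≠ 0 → c y = a y / g y ^ N := by
  let x : X := γ.1 (closedPoint (Trunc O n))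
  obtain ⟨s, t, hst, hx⟩ := exists_basicOpen_le_affine_inter U.2 W.2 x
    ⟨hU (x := closedPoint (Trunc O n)) trivial, hW (x := closedPoint (Trunc O n)) trivial⟩
  obtain ⟨g, hg, hgs⟩ := exists_mem_coord (f := f) U s (truncResidue hk n).toLinearMap
  have hsW : X.basicOpen s ≤ W.1 := hst.le.trans (X.basicOpen_le t)
  have hgiff : ∀ y (hy : y ∈ (jetAtlas f k n).dom U), g y ≠ 0 ↔ ⊤ ≤ y.1 ⁻¹ᵁ X.basicOpen s :=
    fun y hy => by
      rw [mem_basicOpen_iff hk U s ⟨y, hy⟩, hgs ⟨y, hy⟩]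
      rfl
  have hdom : ∀ y ∈ (jetAtlas f k n).dom U, g y ≠ 0 → y ∈ (jetAtlas f k n).dom W :=
    fun y hy h => ((hgiff y hy).mp h).trans (fun z hz => hsW hz)
  refine ⟨g, Algebra.subset_adjoin hg, (hgiff γ hU).mpr
    (top_le_preimage_of_closedPoint γ.1 hx), hdom, fun c hc => ?_⟩
  obtain ⟨w, l, hcw⟩ := exists_of_mem_coord hc
  have := U.2.isLocalization_basicOpen s
  obtain ⟨⟨a, _, N, rfl⟩, ha⟩ := IsLocalization.surj (Submonoid.powers s)
    (X.presheaf.map (homOfLE hsW).op w)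
  let R := (jetAtlas f k n).chartRing U
  let g' : (jetAtlas f k n).dom U → k := fun y => g y.1
  have hg' : g' ∈ R := ⟨g, Algebra.subset_adjoin hg, rfl⟩
  let J := jetFun k f n U
  let v : (jetAtlas f k n).dom U → Trunc O n := fun y => algebraMap k _ (g' y) - J s y
  have hv : v ∈ valued R (Trunc O n) := by
    have h1 : (fun y => g' y • (1 : Trunc O n)) ∈ valued R (Trunc O n) :=
      smul_mem_valued hg' (const_mem_valued 1)
    have : v = (fun y => g' y • (1 : Trunc O n)) - J s := by
      ext y; simp [v, Algebra.smul_def]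
    rw [this]
    exact sub_mem h1 (jetFun_mem_valued U s)
  -- The cofactor in `g ^ (n + 1) - v ^ (n + 1) = (g - v) * P`. Since `g - v` is the pullback of `s`
  -- and `v ^ (n + 1) = 0`, `P / g ^ (n + 1)` inverts the pullback of `s`.
  let P : (jetAtlas f k n).dom U → Trunc O n :=
    ∑ i ∈ Finset.range (n + 1), (fun y => (g' y) ^ (n - i) • (v ^ i) y)
  have hP : P ∈ valued R (Trunc O n) :=
    sum_mem fun i _ => smul_mem_valued (pow_mem hg' (n - i)) (pow_mem hv i)
  have hPs : ∀ y, P y * J s y = algebraMap k _ (g' y ^ (n + 1)) := by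
    intro y
    have h1 : v y ^ (n + 1) = 0 := by
      have : g' y = truncResidue hk n (J s y) := hgs y
      simp only [v, this]
      exact sub_truncResidue_pow hk _
    have h2 := (Commute.all (v y) (algebraMap k (Trunc O n) (g' y))).geom_sum₂_mul (n + 1)
    have h3 : P y = ∑ i ∈ Finset.range (n + 1), v y ^ i * algebraMap k _ (g' y) ^ (n + 1 - 1 - i) := by
      simp only [P, Finset.sum_apply, Pi.pow_apply]
      refine Finset.sum_congr rfl fun i _ => ?_
      rw [Algebra.smul_def, map_pow, mul_comm]
      rfl
    rw [h1, ← h3] at h2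
    have h4 : J s y = algebraMap k _ (g' y) - v y := by simp [v]
    rw [h4, map_pow]
    linear_combination -h2
  have hfin : J a * P ^ N ∈ valued R (Trunc O n) :=
    mul_mem (jetFun_mem_valued U a) (pow_mem hP N)
  obtain ⟨α, hα, hαl⟩ := valued_mem_poly hfin l
  refine ⟨α, hα, (n + 1) * N, fun y hy hgy => ?_⟩
  have hyW := hdom y hy hgy
  have hyD := (hgiff y hy).mp hgy
  have e1 := pointHom_res hsW y.1 hyD hyW
  have e2 := pointHom_res (X.basicOpen_le s) y.1 hyD hy
  have e3 : jetFun k f n W w ⟨y, hyW⟩ * J s ⟨y, hy⟩ ^ N = J a ⟨y, hy⟩ := by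
    have h1 := congrArg (pointHom y.1 _ hyD).hom ha
    rw [map_mul] at h1
    have h2 : ∀ z, (pointHom y.1 _ hyD).hom (algebraMap Γ(X, U.1) Γ(X, X.basicOpen s) z) =
        J z ⟨y, hy⟩ := fun z => congrArg (fun φ => φ.hom z) e2
    have h3 : (pointHom y.1 _ hyD).hom (X.presheaf.map (homOfLE hsW).op w) =
        jetFun k f n W w ⟨y, hyW⟩ := congrArg (fun φ => φ.hom w) e1
    rw [h2, h2, h3, map_pow, Pi.pow_apply] at h1
    exact h1
  have e4 : (J a * P ^ N) ⟨y, hy⟩ = g y ^ ((n + 1) * N) • jetFun k f n W w ⟨y, hyW⟩ := by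
    rw [Pi.mul_apply, ← e3, Pi.pow_apply, mul_assoc, ← mul_pow, mul_comm (J s _), hPs,
      ← map_pow, ← pow_mul, Algebra.smul_def, mul_comm]
  have hα1 := hαl ⟨y, hy⟩
  rw [e4, map_smul, ← hcw ⟨y, hyW⟩, smul_eq_mul] at hα1
  rw [hα1, mul_div_cancel_left₀ _ (pow_ne_zero _ hgy)]

end Finite

theorem good_jetAtlas {k O : Type u} [Field k] [CommRing O] [IsDomain O]
    [IsDiscreteValuationRing O] [Algebra k O] {X : Scheme.{u}}
    (hk : Function.Bijective (algebraMap k (ResidueField O)))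
    (f : X ⟶ Spec (CommRingCat.of O)) [LocallyOfFiniteType f] [QuasiCompact f] (n : ℕ) :
    (jetAtlas f k n).Good := by
  have := finite_trunc hk n
  refine ⟨isAffineAlgebra_chartRing, fun U x hx y hy h => ?_, compat_jetAtlas hk, ?_⟩
  · refine congrArg Subtype.val (ext_of_jetFun (k := k) U (γ := ⟨x, hx⟩) (γ' := ⟨y, hy⟩) fun s => ?_)
    refine (Module.finBasis k (Trunc O n)).ext_elem fun i => ?_
    obtain ⟨c, hc, hcs⟩ := exists_mem_coord (f := f) U s ((Module.finBasis k (Trunc O n)).coord i)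
    have := h c hc
    rwa [hcs ⟨x, hx⟩, hcs ⟨y, hy⟩] at this
  · have : CompactSpace X := QuasiCompact.compactSpace_of_compactSpace f
    obtain ⟨s, hs⟩ := isCompact_univ.elim_finite_subcover (fun U : X.affineOpens => (U.1 : Set X))
      (fun U => U.1.2) (fun x _ => by
        have : x ∈ (⨆ U : X.affineOpens, U.1 : X.Opens) := by
          rw [iSup_affineOpens_eq_top]; trivial
        simpa using this)
    refine ⟨s, fun γ => ?_⟩
    obtain ⟨U, hU, hγ⟩ := Set.mem_iUnion₂.mp (hs (Set.mem_univ (γ.1 (closedPoint (Trunc O n)))))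
    exact ⟨U, hU, top_le_preimage_of_closedPoint γ.1 hγ⟩

end JetCharts

/-! ### Limits of jets -/

section Limits

variable {O : Type u} [CommRing O] [IsLocalRing O] {X : Scheme.{u}}
  {f : X ⟶ Spec (CommRingCat.of O)}

theorem forget_proj (n : ℕ) (γ : Arcs f) : forget f n (proj f (n + 1) γ) = proj f n γ := by
  apply Subtype.ext
  change Spec.map _ ≫ Spec.map _ ≫ γ.1 = Spec.map _ ≫ γ.1
  rw [← Spec.map_comp_assoc, ← CommRingCat.ofHom_comp, Ideal.Quotient.factor_comp_mk]

theorem top_le_preimage_of_forget {n : ℕ} {U : X.Opens} {γ : Jets f (n + 1)}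
    (h : ⊤ ≤ (forget f n γ).1 ⁻¹ᵁ U) : ⊤ ≤ γ.1 ⁻¹ᵁ U := by
  apply top_le_preimage_of_closedPoint (R := CommRingCat.of (Trunc O (n + 1)))
  let φ := Ideal.Quotient.factor (Ideal.pow_le_pow_right (I := maximalIdeal O) (Nat.le_succ (n + 1)))
  have : IsLocalHom φ := .of_surjective _ (Ideal.Quotient.factor_surjective _)
  have h1 : (forget f n γ).1 (closedPoint (Trunc O n)) ∈ U := h (x := closedPoint _) trivial
  have h2 : PrimeSpectrum.comap φ (closedPoint (Trunc O n)) = closedPoint (Trunc O (n + 1)) :=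
    comap_closedPoint φ
  have h3 : (forget f n γ).1 (closedPoint (Trunc O n)) =
      γ.1 (PrimeSpectrum.comap φ (closedPoint (Trunc O n))) := rfl
  rw [h3, h2] at h1
  exact h1

/-- Compatible jets have a limit. -/
theorem exists_arc [IsAdicComplete (maximalIdeal O) O] (j : ℕ) (u : ∀ i, Jets f (j + i))
    (hu : ∀ i, forget f (j + i) (u (i + 1)) = u i) : ∃ γ : Arcs f, ∀ i, proj f (j + i) γ = u i := by
  obtain ⟨U, hU⟩ : ∃ U : X.affineOpens, (u 0).1 (closedPoint (Trunc O j)) ∈ U.1 := by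
    have : (u 0).1 (closedPoint (Trunc O j)) ∈ (⨆ U : X.affineOpens, U.1 : X.Opens) := by
      rw [iSup_affineOpens_eq_top]; trivial
    simpa using this
  -- All the jets have the same image of the closed point, so one affine open contains them all.
  have hin : ∀ i, ⊤ ≤ (u i).1 ⁻¹ᵁ U.1 := by
    intro i
    induction i with
    | zero => exact top_le_preimage_of_closedPoint (R := CommRingCat.of (Trunc O j)) _ hU
    | succ i ih => exact top_le_preimage_of_forget (hu i ▸ ih)
  have ha : StrictMono fun i => j + i + 1 := fun a b h => by simpa using h
  let θ : ∀ i, Γ(X, U.1) →+* O ⧸ maximalIdeal O ^ (j + i + 1) := fun i =>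
    (pointHom (u i).1 U.1 (hin i)).hom
  have hθ : ∀ {i}, (Ideal.Quotient.factorPow (maximalIdeal O) (ha.monotone i.le_succ)).comp
      (θ (i + 1)) = θ i := by
    intro i
    have h1 : ⊤ ≤ (forget f (j + i) (u (i + 1))).1 ⁻¹ᵁ U.1 := (hu i).symm ▸ hin i
    have h2 := pointHom_comp (u (i + 1)).1 _ (hin (i + 1)) h1
    have h3 : pointHom (forget f (j + i) (u (i + 1))).1 U.1 h1 = pointHom (u i).1 U.1 (hin i) := by
      congr 1
      rw [hu i]
    have h4 := h3.symm.trans h2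
    exact (congrArg (fun φ => φ.hom) h4).symm
  -- Completeness is used here to lift the compatible homomorphisms to `O`; that the limit is a
  -- section is then checked modulo all powers of the maximal ideal.
  let Θ : Γ(X, U.1) →+* O := IsAdicComplete.StrictMono.liftRingHom (maximalIdeal O) ha θ hθ
  have hΘ : ∀ i, (Ideal.Quotient.mk _).comp Θ = θ i := fun i =>
    IsAdicComplete.StrictMono.mk_comp_liftRingHom (maximalIdeal O) ha θ hθ
  have hstr : Θ.comp (structureHom f U.1).hom = RingHom.id O := by
    apply DFunLike.coe_injective
    apply IsHausdorff.StrictMono.funext' (maximalIdeal O) ha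
    intro i o
    have h1 := (comp_eq_SpecMap_iff f U.2 (u i).1 (hin i) _).mp (u i).2
    have h2 := congrArg (fun φ => φ.hom o) h1
    have h3 := RingHom.congr_fun (hΘ i) ((structureHom f U.1).hom o)
    exact h3.trans h2
  have hUa : IsAffineOpen U.1 := U.2
  have htop := top_le_preimage hUa (CommRingCat.ofHom Θ)
  have hpt := pointHom_SpecMap hUa (CommRingCat.ofHom Θ) htop
  have hsec : (Spec.map (CommRingCat.ofHom Θ) ≫ hUa.fromSpec) ≫ f = 𝟙 _ := by
    rw [Category.assoc, fromSpec_comp, ← Spec.map_comp, ← Spec.map_id]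
    congr 1
    ext o
    exact RingHom.congr_fun hstr o
  refine ⟨⟨_, hsec⟩, fun i => Subtype.ext ?_⟩
  have h1 : ⊤ ≤ (proj f (j + i) ⟨_, hsec⟩).1 ⁻¹ᵁ U.1 := fun x _ => htop trivial
  refine pointHom_injective hUa (h := h1) (h' := hin i) ?_
  refine (pointHom_comp _ _ htop h1).trans ?_
  rw [hpt]
  exact congrArg CommRingCat.ofHom (hΘ i)

end Limits

/-! ### Stable sets -/

/-! ### Arithmetic of shifted dimensions -/

section CastDim

/-- For `m ≤ c` the truncated difference is `0`, and `x < 0` means `x = ⊥`, in agreement with the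
left side. -/
theorem castDim_add_lt_iff {x : WithBot ℕ∞} {c m : ℤ} :
    castDim x + (c : WithBot (WithTop ℤ)) < (m : WithBot (WithTop ℤ)) ↔
      x < ((m - c).toNat : WithBot ℕ∞) := by
  induction x with
  | bot => exact iff_of_true (WithBot.bot_lt_coe _) (WithBot.bot_lt_coe _)
  | coe x =>
    induction x with
    | top =>
      constructor
      · intro h
        have : (((⊤ : WithTop ℤ) + c : WithTop ℤ) : WithBot (WithTop ℤ)) < ((m : WithTop ℤ) : WithBot (WithTop ℤ)) := h
        rw [WithBot.coe_lt_coe, top_add] at this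
        exact absurd this not_top_lt
      · intro h
        have : ((⊤ : ℕ∞) : WithBot ℕ∞) < (((m - c).toNat : ℕ∞) : WithBot ℕ∞) := h
        rw [WithBot.coe_lt_coe] at this
        exact absurd this not_top_lt
    | coe x =>
      have h1 : castDim ((x : ℕ∞) : WithBot ℕ∞) + (c : WithBot (WithTop ℤ)) =
        (((x : ℤ) + c : ℤ) : WithBot (WithTop ℤ)) := rfl
      rw [h1]
      have h2 : ((((x : ℤ) + c : ℤ) : WithTop ℤ) : WithBot (WithTop ℤ)) < ((m : WithTop ℤ) : WithBot (WithTop ℤ)) ↔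
        (x : ℤ) + c < m := by rw [WithBot.coe_lt_coe, WithTop.coe_lt_coe]
      have h3 : (((x : ℕ∞) : WithBot ℕ∞) < (((m - c).toNat : ℕ∞) : WithBot ℕ∞)) ↔ x < (m - c).toNat := by
        rw [WithBot.coe_lt_coe, Nat.cast_lt]
      refine h2.trans (Iff.trans ?_ h3.symm)
      omega

theorem castDim_add_nat (x : WithBot ℕ∞) (r : ℕ) (c c' : ℤ) (h : c' = r + c) :
    castDim (x + r) + (c : WithBot (WithTop ℤ)) = castDim x + (c' : WithBot (WithTop ℤ)) := by
  subst h
  induction x with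
  | bot => rfl
  | coe x =>
    induction x with
    | top => rfl
    | coe x =>
      have h : ((x + r : ℕ) : ℤ) + c = (x : ℤ) + (r + c) := by push_cast; ring
      exact congrArg (fun z : ℤ => ((z : WithTop ℤ) : WithBot (WithTop ℤ))) h

theorem castDim_le_of_lt {x y : WithBot ℕ∞} {c m : ℤ} (hxy : x ≤ y)
    (h : castDim y + ((-c : ℤ) : WithBot (WithTop ℤ)) < (m : WithBot (WithTop ℤ))) :
    castDim x ≤ ((m + c : ℤ) : WithBot (WithTop ℤ)) := by
  have h1 : castDim x + ((0 : ℤ) : WithBot (WithTop ℤ)) < ((m + c : ℤ) : WithBot (WithTop ℤ)) := by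
    rw [castDim_add_lt_iff] at h ⊢
    refine lt_of_le_of_lt hxy (lt_of_lt_of_le h ?_)
    rw [sub_zero, sub_neg_eq_add]
  have h2 : castDim x + ((0 : ℤ) : WithBot (WithTop ℤ)) = castDim x := add_zero _
  rw [h2] at h1
  exact h1.le

end CastDim

section Stable

variable {k O : Type u} [Field k] [CommRing O] [IsLocalRing O] [Algebra k O] {X : Scheme.{u}}
  {f : X ⟶ Spec (CommRingCat.of O)} {d n m : ℕ} {A B : Set (Arcs f)}

theorem proj_eq_of_le (h : n ≤ m) {γ γ' : Arcs f} (hγ : proj f m γ = proj f m γ') :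
    proj f n γ = proj f n γ' := by
  induction m, h using Nat.le_induction with
  | base => exact hγ
  | succ m _ ih => exact ih (by rw [← forget_proj, hγ, forget_proj])

theorem StableAt.mem_iff (hA : StableAt f k d n A) (h : n ≤ m) {γ : Arcs f} :
    γ ∈ A ↔ proj f m γ ∈ proj f m '' A := by
  refine ⟨fun hγ => ⟨γ, hγ, rfl⟩, ?_⟩
  rintro ⟨γ', hγ', he⟩
  rw [hA.2.1]
  exact ⟨γ', hγ', proj_eq_of_le h he⟩

theorem mapsTo_forget : Set.MapsTo (forget f n) (proj f (n + 1) '' A) (proj f n '' A) := by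
  rintro _ ⟨γ, hγ, rfl⟩
  exact ⟨γ, hγ, (forget_proj n γ).symm⟩

theorem stableAt_empty : StableAt f k d n (∅ : Set (Arcs f)) := by
  refine ⟨⟨0, Fin.elim0, fun j => j.elim0, by simp⟩, by simp, fun m _ => ?_⟩
  exact ⟨mapsTo_forget, 0, Fin.elim0, fun i => i.elim0, by simp, fun j => j.elim0⟩

theorem IsStable.stableAt_level (hA : IsStable f k d A) : StableAt f k d (level f k d A) A :=
  Nat.sInf_mem (s := {n | StableAt f k d n A}) hA

theorem StableAt.level_le (hA : StableAt f k d n A) : level f k d A ≤ n :=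
  Nat.sInf_le (s := {n | StableAt f k d n A}) hA

theorem StableAt.isStable (hA : StableAt f k d n A) : IsStable f k d A := ⟨n, hA⟩

theorem isStable_empty : IsStable f k d (∅ : Set (Arcs f)) := ⟨0, stableAt_empty⟩

/-- Images commute with this difference because `B` is the full preimage of its image at level `m`.
-/
theorem StableAt.image_diff (hB : StableAt f k d n B) (h : n ≤ m) :
    proj f m '' (A \ B) = proj f m '' A \ proj f m '' B := by
  ext u
  constructor
  · rintro ⟨γ, ⟨hγ, hγB⟩, rfl⟩
    exact ⟨⟨γ, hγ, rfl⟩, fun h' => hγB ((hB.mem_iff h).mpr h')⟩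
  · rintro ⟨⟨γ, hγ, rfl⟩, h'⟩
    exact ⟨γ, ⟨hγ, fun hB => h' ⟨γ, hB, rfl⟩⟩, rfl⟩

variable [IsAlgClosed k] (hG : ∀ n, (jetAtlas f k n).Good)

include hG

/-- Constructibility is required at the initial level only; above it, the base of each piecewise
trivial fibration is a finite union of subvarieties. -/
theorem StableAt.cells (hA : StableAt f k d n A) (h : n ≤ m) :
    (jetAtlas f k m).Cells (proj f m '' A) := (hA.2.2 m h).base_cells (hG m)

theorem StableAt.mono (hA : StableAt f k d n A) (h : n ≤ m) : StableAt f k d m A :=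
  ⟨(hA.cells hG h).constructible, by
    ext γ; exact hA.mem_iff h, fun l hl => hA.2.2 l (h.trans hl)⟩

theorem IsStable.exists_common (hA : IsStable f k d A) (hB : IsStable f k d B) :
    ∃ n, StableAt f k d n A ∧ StableAt f k d n B := by
  obtain ⟨n, hn⟩ := hA
  obtain ⟨m, hm⟩ := hB
  exact ⟨max n m, hn.mono hG (le_max_left _ _), hm.mono hG (le_max_right _ _)⟩

theorem StableAt.diff (hA : StableAt f k d n A) (hB : StableAt f k d n B) :
    StableAt f k d n (A \ B) := by
  have hc : ∀ m, n ≤ m → (jetAtlas f k m).Cells (proj f m '' (A \ B)) := fun m hm => by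
    rw [hB.image_diff hm]; exact (hA.cells hG hm).diff (hG m) (hB.cells hG hm)
  refine ⟨(hc n le_rfl).constructible, ?_, fun m hm => ?_⟩
  · ext γ
    rw [Set.mem_preimage, hB.image_diff le_rfl, Set.mem_sdiff, Set.mem_sdiff,
      ← hA.mem_iff le_rfl, ← hB.mem_iff le_rfl]
  · have h1 := (hA.2.2 m hm).restrict (hG m) (hG (m + 1)) (hc m hm)
      (Set.image_mono Set.sdiff_subset)
    convert h1 using 1
    ext u
    constructor
    · rintro ⟨γ, hγ, rfl⟩
      exact ⟨⟨γ, hγ.1, rfl⟩, γ, hγ, (forget_proj m γ).symm⟩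
    · rintro ⟨⟨γ, hγ, rfl⟩, h⟩
      refine ⟨γ, ⟨hγ, fun hγB => ?_⟩, rfl⟩
      rw [Set.mem_preimage, forget_proj, hB.image_diff hm] at h
      exact h.2 ⟨γ, hγB, rfl⟩

theorem StableAt.union (hA : StableAt f k d n A) (hB : StableAt f k d n B) :
    StableAt f k d n (A ∪ B) := by
  have hD := hB.diff hG hA
  have heq : A ∪ B = A ∪ B \ A := Set.union_sdiff_self.symm
  have hc : ∀ m, n ≤ m → (jetAtlas f k m).Cells (proj f m '' (A ∪ B)) := fun m hm => by
    rw [Set.image_union]; exact (hA.cells hG hm).sup (hG m) (hB.cells hG hm)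
  refine ⟨(hc n le_rfl).constructible, ?_, fun m hm => ?_⟩
  · ext γ
    rw [Set.mem_preimage, Set.image_union, Set.mem_union, Set.mem_union,
      ← hA.mem_iff le_rfl, ← hB.mem_iff le_rfl]
  · rw [heq, Set.image_union, Set.image_union]
    refine (hA.2.2 m hm).union (hD.2.2 m hm) ?_
    rw [hA.image_diff hm]
    exact Set.disjoint_sdiff_right

theorem IsStable.diff (hA : IsStable f k d A) (hB : IsStable f k d B) :
    IsStable f k d (A \ B) := by
  obtain ⟨n, h1, h2⟩ := hA.exists_common hG hB
  exact ⟨n, h1.diff hG h2⟩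

theorem IsStable.union (hA : IsStable f k d A) (hB : IsStable f k d B) :
    IsStable f k d (A ∪ B) := by
  obtain ⟨n, h1, h2⟩ := hA.exists_common hG hB
  exact ⟨n, h1.union hG h2⟩

theorem IsStable.inter (hA : IsStable f k d A) (hB : IsStable f k d B) :
    IsStable f k d (A ∩ B) := by
  rw [← Set.sdiff_sdiff_right_self]
  exact hA.diff hG (hA.diff hG hB)

/-- The dimension of a stable set can be computed at any level. -/
theorem StableAt.vdim_eq (hA : StableAt f k d n A) : vdim f k d A =
    castDim ((jetAtlas f k n).dim (proj f n '' A)) +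
      ((-((n : ℤ) * d) : ℤ) : WithBot (WithTop ℤ)) := by
  have h0 := hA.isStable.stableAt_level
  have key : ∀ m, level f k d A ≤ m → vdim f k d A =
      castDim ((jetAtlas f k m).dim (proj f m '' A)) +
        ((-((m : ℤ) * d) : ℤ) : WithBot (WithTop ℤ)) := by
    intro m hm
    induction m, hm using Nat.le_induction with
    | base => rfl
    | succ m hm ih =>
      rw [ih, (h0.2.2 m hm).dim_eq (hG m) (hG (m + 1))]
      refine (castDim_add_nat _ _ _ _ ?_).symm
      push_cast
      ring
  exact key n hA.level_le

/-- The measure of a stable set can be computed at any level. -/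
theorem StableAt.stableMeasure_eq (hA : StableAt f k d n A) : stableMeasure f k d A =
    (jetAtlas f k n).cls (proj f n '' A) * ((M.L k ^ (-((n : ℤ) * d)) : (M k)ˣ) : M k) := by
  have h0 := hA.isStable.stableAt_level
  have key : ∀ m, level f k d A ≤ m → stableMeasure f k d A =
      (jetAtlas f k m).cls (proj f m '' A) * ((M.L k ^ (-((m : ℤ) * d)) : (M k)ˣ) : M k) := by
    intro m hm
    induction m, hm using Nat.le_induction with
    | base => rfl
    | succ m hm ih =>
      rw [ih, (h0.2.2 m hm).cls_eq (hG m) (hG (m + 1)), mul_comm ((M.L k ^ d : (M k)ˣ) : M k),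
        mul_assoc, ← Units.val_mul]
      congr 3
      rw [← zpow_natCast, ← zpow_add]
      congr 1
      push_cast
      ring
  exact key n hA.level_le

theorem stableMeasure_union (hA : IsStable f k d A) (hB : IsStable f k d B) (h : Disjoint A B) :
    stableMeasure f k d (A ∪ B) = stableMeasure f k d A + stableMeasure f k d B := by
  obtain ⟨n, h1, h2⟩ := hA.exists_common hG hB
  rw [(h1.union hG h2).stableMeasure_eq hG, h1.stableMeasure_eq hG, h2.stableMeasure_eq hG,
    Set.image_union, Atlas.cls_union (hG n) (h1.cells hG le_rfl) (h2.cells hG le_rfl), add_mul]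
  rw [← sdiff_eq_left.mpr h, h2.image_diff le_rfl]
  exact Set.disjoint_sdiff_left

/-- Each affine piece in a decomposition of the image has at most the dimension of the image, so
every summand of the measure lies in `F_m`. -/
theorem stableMeasure_mem_F (hA : IsStable f k d A) {m : ℤ}
    (h : vdim f k d A < (m : WithBot (WithTop ℤ))) : stableMeasure f k d A ∈ M.F k m := by
  obtain ⟨n, hn⟩ := hA
  rw [hn.vdim_eq hG] at h
  rw [hn.stableMeasure_eq hG]
  obtain ⟨ι, _, P, hP, hPA⟩ := (hn.cells hG le_rfl).exists_pieces
  rw [hPA, Atlas.cls_eq_sum (hG n) _ (fun i => (P i).isAffineSet) hP, Finset.sum_mul]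
  refine sum_mem fun i _ => ?_
  rw [Atlas.affineCls_carrier (hG n)]
  have := ((P i).isAffineAlgebra (hG n)).finiteType
  have := isReduced_functions (P i).coordRing
  refine M.cls_mul_mem_F ?_
  refine castDim_le_of_lt ?_ h
  rw [← (P i).dim_carrier (hG n), hPA]
  exact Atlas.dim_mono (Set.subset_iUnion (fun i => (P i).carrier) i)

end Stable

/-! ### Stable sets covered by stable sets of smaller dimension -/

section Thin

/-- Finitely many nonempty open subsets of an irreducible set have a common point, so finitely many
conditions that hold generally can be met at once. -/
theorem exists_mem_forall_of_isIrreducible {V ι : Type*} [TopologicalSpace V] {E : Set V}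
    (hE : IsIrreducible E) (s : Finset ι) (p : ι → V → Prop)
    (h : ∀ i ∈ s, ∃ D, IsOpen D ∧ (D ∩ E).Nonempty ∧ ∀ u ∈ D ∩ E, p i u) :
    ∃ u ∈ E, ∀ i ∈ s, p i u := by
  classical
  suffices ∃ D, IsOpen D ∧ (D ∩ E).Nonempty ∧ ∀ u ∈ D ∩ E, ∀ i ∈ s, p i u by
    obtain ⟨D, -, ⟨u, hu⟩, h⟩ := this
    exact ⟨u, hu.2, h u hu⟩
  induction s using Finset.induction_on with
  | empty => exact ⟨Set.univ, isOpen_univ, by simpa using hE.1, by simp⟩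
  | insert a s _ ih =>
    obtain ⟨D, hD, ⟨x, hx⟩, h1⟩ := ih fun i hi => h i (Finset.mem_insert_of_mem hi)
    obtain ⟨D', hD', ⟨y, hy⟩, h2⟩ := h a (Finset.mem_insert_self a s)
    obtain ⟨z, hz⟩ := hE.2 D D' hD hD' ⟨x, hx.2, hx.1⟩ ⟨y, hy.2, hy.1⟩
    refine ⟨D ∩ D', hD.inter hD', ⟨z, hz.2, hz.1⟩, fun u hu i hi => ?_⟩
    rcases Finset.mem_insert.mp hi with rfl | hi
    · exact h2 u ⟨hu.1.2, hu.2⟩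
    · exact h1 u ⟨hu.1.1, hu.2⟩ i hi

variable {k O : Type u} [Field k] [CommRing O] [IsLocalRing O] [Algebra k O] {X : Scheme.{u}}
  {f : X ⟶ Spec (CommRingCat.of O)} {d : ℕ} {A C : Set (Arcs f)}

variable (k A C) in
/-- The general lift of order `j + g` of a jet `u` of order `j` of an arc in `A` does not come from
`C`. -/
def Thin : ∀ (_ j : ℕ), Jets f j → Prop
  | 0, j, u => u ∉ proj f j '' C
  | g + 1, j, u => ∃ D, IsOpen[(jetAtlas f k (j + 1)).zariski] D ∧
      (∃ w ∈ D, w ∈ proj f (j + 1) '' A ∧ forget f j w = u) ∧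
      ∀ w ∈ D, w ∈ proj f (j + 1) '' A → forget f j w = u → Thin g (j + 1) w

variable [IsAlgClosed k] (hG : ∀ n, (jetAtlas f k n).Good)

include hG

/-- The general point of an irreducible subvariety of `π_j(A)` is thin with respect to a stable set
that is too small to contain its preimage. -/
theorem StableAt.exists_isOpen_thin {n : ℕ} (hA : StableAt f k d n A) (g : ℕ) :
    ∀ j e r : ℕ, n ≤ j → e = j + g → StableAt f k d e C → ∀ E ⊆ proj f j '' A,
      (jetAtlas f k j).IsAffineSet E → @IsIrreducible _ (jetAtlas f k j).zariski E →
      r ≤ (jetAtlas f k j).dim E →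
      (jetAtlas f k e).dim (proj f e '' C) < ((r + g * d : ℕ) : WithBot ℕ∞) →
      ∃ D, IsOpen[(jetAtlas f k j).zariski] D ∧ (D ∩ E).Nonempty ∧
        ∀ u ∈ D ∩ E, Thin k A C g j u := by
  induction g with
  | zero =>
    rintro j e r hj rfl hC E - hE hirr hr hdim
    rw [zero_mul, add_zero] at hdim
    -- No lifts remain: the image of `C` has smaller dimension than `E` and misses a nonempty open
    -- part of it.
    exact Atlas.exists_isOpen_disjoint (hG _) hE hirr (hC.cells hG le_rfl) hr hdim
  | succ g ih =>
    intro j e r hj he hC E hEA hE hirr hr hdim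
    have : Infinite k := IsAlgClosed.instInfinite
    let _ := (jetAtlas f k j).zariski
    let _ := (jetAtlas f k (j + 1)).zariski
    obtain ⟨ι, _, S, hS, hES, h⟩ := (hA.2.2 j hj).exists_affine (hG j) (hG (j + 1)) hE.cells hEA
    obtain ⟨l, -, D₁, hD₁, hne₁, hsub₁⟩ := Atlas.exists_isOpen_inter_subset (K := E) S Finset.univ
      (fun i _ => (h i).1.locClosed) hirr.1 (by simp [← hES])
    obtain ⟨D₂, hD₂, hsub₂, hE₁, hirr₁, hr₁⟩ := Atlas.exists_isOpen_le_dim (hG j) hE hirr hD₁ hne₁ hr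
    have hE₁S : E ∩ D₂ ⊆ S l := fun x hx => hsub₁ ⟨hsub₂ hx.2, hx.1⟩
    -- After shrinking `E` to a part over which the fibration is trivial, its preimage `T` is
    -- irreducible of dimension at least `r + d`. The induction hypothesis applies to an affine open
    -- part of `T`, with the same bound `r + (g + 1) d`.
    let T := proj f (j + 1) '' A ∩ forget f j ⁻¹' (E ∩ D₂)
    have hTeq : T = proj f (j + 1) '' A ∩ forget f j ⁻¹' S l ∩ forget f j ⁻¹' (E ∩ D₂) := by
      rw [Set.inter_assoc, ← Set.preimage_inter, Set.inter_eq_right.mpr hE₁S]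
    have hT : (jetAtlas f k j).TrivialOver (jetAtlas f k (j + 1)) d (forget f j) T (E ∩ D₂) := by
      rw [hTeq]; exact (h l).2.2.restrict (hG j) (hG (j + 1)) hE₁S
    have hTL : (jetAtlas f k (j + 1)).LocClosed T := by
      rw [hTeq]; exact (h l).2.2.locClosed (h l).2.1 hE₁.locClosed
    have hTirr := hT.isIrreducible (hG j) hirr₁
    have hTr : ((r + d : ℕ) : WithBot ℕ∞) ≤ (jetAtlas f k (j + 1)).dim T := by
      rw [hT.dim_eq (hG j) hE₁]
      push_cast
      exact add_le_add_left hr₁ _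
    obtain ⟨D₃, hD₃, hE', hirr', hr'⟩ := hTL.exists_isOpen_le_dim (hG (j + 1)) hTirr hTr
    obtain ⟨D₄, hD₄, ⟨w, hw₄, hwT, hw₃⟩, hthin⟩ := ih (j + 1) e (r + d) (hj.trans (Nat.le_succ j))
      (by omega) hC (T ∩ D₃) (fun w hw => hw.1.1) hE' hirr' hr' (by
        convert hdim using 2
        ring)
    -- A trivial fibration is open, so the points of `E` with some lift in the good open set form a
    -- relatively open set.
    obtain ⟨D₅, hD₅, hD₅T⟩ := hT.exists_isOpen (hD₃.inter hD₄)
    have hw : forget f j w ∈ D₅ ∩ (E ∩ D₂) := hD₅T.ge ⟨w, ⟨⟨hw₃, hw₄⟩, hwT⟩, rfl⟩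
    refine ⟨D₅ ∩ D₂, hD₅.inter hD₂, ⟨_, ⟨hw.1, hw.2.2⟩, hw.2.1⟩, fun u hu => ?_⟩
    have hu₂ : u ∈ E ∩ D₂ := ⟨hu.2, hu.1.2⟩
    obtain ⟨v, hv, hvu⟩ := hD₅T.le ⟨hu.1.1, hu₂⟩
    refine ⟨D₃ ∩ D₄, hD₃.inter hD₄, ⟨v, hv.1, hv.2.1, hvu⟩, fun w hw hwA hwu => ?_⟩
    exact hthin w ⟨hw.2, ⟨hwA, by rw [Set.mem_preimage, hwu]; exact hu₂⟩, hw.1⟩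

/-- A stable set that is covered by stable sets of dimension `< m`, the dimensions of which tend to
`-∞`, has dimension `< m`. -/
theorem IsStable.vdim_lt_of_subset_iUnion [IsAdicComplete (maximalIdeal O) O]
    (hA : IsStable f k d A) (C : ℕ → Set (Arcs f)) (hC : ∀ i, IsStable f k d (C i))
    (hAC : A ⊆ ⋃ i, C i) {m : ℤ}
    (hm : ∀ i, vdim f k d (C i) < (m : WithBot (WithTop ℤ)))
    (hlim : ∀ N : ℤ, ∀ᶠ i in atTop, vdim f k d (C i) < (N : WithBot (WithTop ℤ))) :
    vdim f k d A < (m : WithBot (WithTop ℤ)) := by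
  have : Infinite k := IsAlgClosed.instInfinite
  obtain ⟨j, hj⟩ := hA
  by_contra hlt
  rw [hj.vdim_eq hG, castDim_add_lt_iff, sub_neg_eq_add, not_lt] at hlt
  -- An order at which both `A` and `C i` can be tested: whether an arc is in `C i` depends only on
  -- its jet of order `e i`.
  let e : ℕ → ℕ := fun i => max j (level f k d (C i))
  have he : ∀ i, StableAt f k d (e i) (C i) := fun i =>
    (hC i).stableAt_level.mono hG (le_max_right _ _)
  have hje : ∀ i, j ≤ e i := fun i => le_max_left _ _
  have hdim : ∀ i (N : ℤ), vdim f k d (C i) < (N : WithBot (WithTop ℤ)) →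
      (jetAtlas f k (e i)).dim (proj f (e i) '' C i) < ((N + e i * d).toNat : WithBot ℕ∞) :=
    fun i N h => by
      rwa [(he i).vdim_eq hG, castDim_add_lt_iff, sub_neg_eq_add] at h
  -- sets of very small dimension are thin everywhere
  have hauto : ∀ l, j ≤ l → ∀ u ∈ proj f l '' A, ∀ i, l ≤ e i →
      vdim f k d (C i) < ((-(l * d : ℤ) : ℤ) : WithBot (WithTop ℤ)) →
      Thin k A (C i) (e i - l) l u := by
    intro l hl u hu i hli hi
    -- The general statement for the point `{u}`, with `r = 0`: its preimage at order `e i` has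
    -- dimension `(e i - l) d`, more than the image of `C i`.
    obtain ⟨D, -, ⟨v, hvD, rfl⟩, h⟩ := hj.exists_isOpen_thin hG (C := C i) (e i - l) l (e i) 0 hl
      (by omega) (he i) {u} (by simpa using hu) ((hG l).isAffineSet_singleton u)
      (@isIrreducible_singleton _ (jetAtlas f k l).zariski u)
      (Atlas.zero_le_dim (Set.singleton_nonempty u)) (by
        convert hdim i _ hi using 2
        have : ((e i - l : ℕ) : ℤ) = e i - l := by omega
        have h2 : (-(l * d : ℤ) + e i * d) = (((e i - l) * d : ℕ) : ℤ) := by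
          push_cast [this]; ring
        rw [h2, Int.toNat_natCast, zero_add])
    exact h v ⟨hvD, rfl⟩
  have hfin : ∀ N : ℤ, {i | ¬ vdim f k d (C i) < (N : WithBot (WithTop ℤ))}.Finite := fun N => by
    have := hlim N
    rw [← Nat.cofinite_eq_atTop] at this
    exact this
  -- The invariant of the construction: `u` comes from `A`, and its general lifts still escape every
  -- `C i` whose testing order `e i` has not been passed.
  let P : ∀ l, Jets f l → Prop := fun l u => u ∈ proj f l '' A ∧
    ∀ i, l ≤ e i → Thin k A (C i) (e i - l) l u
  have hstart : ∃ u, P j u := by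
    obtain ⟨a, L, hL, hLA⟩ := hj.1
    -- The assumption `dim A ≥ m` enters here: an irreducible subvariety of the image of `A` is
    -- large enough for its general point to be thin for each `C i`. Only finitely many of these
    -- need a condition on the point, the others being covered by `hauto`.
    obtain ⟨q, -, E, hEL, hE, hirr, hr⟩ := Atlas.exists_affine_of_le_dim (hG j) L Finset.univ
      (fun i _ => hL i) (C := proj f j '' A) (by simp [hLA]) hlt
    have hEA : E ⊆ proj f j '' A := by
      rw [hLA]; exact hEL.trans (Set.subset_iUnion L q)
    obtain ⟨u, hu, h⟩ := @exists_mem_forall_of_isIrreducible _ _ (jetAtlas f k j).zariski E hirr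
      (hfin (-(j * d : ℤ))).toFinset (fun i u => Thin k A (C i) (e i - j) j u) (fun i _ => by
        refine hj.exists_isOpen_thin hG (C := C i) (e i - j) j (e i) _ le_rfl
          (by have := hje i; omega) (he i) E hEA hE hirr hr (lt_of_lt_of_le (hdim i m (hm i)) ?_)
        have h1 := hje i
        have h2 : ((e i - j : ℕ) : ℤ) = e i - j := by omega
        have h3 : (m + e i * d : ℤ) = m + j * d + ((e i - j) * d : ℕ) := by
          push_cast [h2]; ring
        have h4 : (m + e i * d).toNat ≤ (m + j * d).toNat + (e i - j) * d := by
          rw [h3]; omega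
        exact_mod_cast h4)
    refine ⟨u, hEA hu, fun i hi => ?_⟩
    by_cases hv : vdim f k d (C i) < ((-(j * d : ℤ) : ℤ) : WithBot (WithTop ℤ))
    · exact hauto j le_rfl u (hEA hu) i hi hv
    · exact h i ((Set.Finite.mem_toFinset _).mpr hv)
  have hstep : ∀ l, j ≤ l → ∀ u, P l u → ∃ w, forget f l w = u ∧ P (l + 1) w := by
    rintro l hl u ⟨huA, hu⟩
    let _ := (jetAtlas f k (l + 1)).zariski
    -- The lifts of `u` form an affine space, hence an irreducible set. Thinness of `u` gives a
    -- nonempty open set of good lifts for each `C i`, and by `hauto` only finitely many indices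
    -- need attention.
    let F := proj f (l + 1) '' A ∩ forget f l ⁻¹' {u}
    have hF : IsIrreducible F := by
      obtain ⟨ι, _, S, hS, hSu, h⟩ := (hj.2.2 l hl).exists_affine (hG l) (hG (l + 1))
        ((hG l).isAffineSet_singleton u).cells (by simpa using huA)
      obtain ⟨q, hq⟩ := Set.mem_iUnion.mp (hSu.le (Set.mem_singleton u))
      have : S q = {u} := Set.Subset.antisymm (hSu ▸ Set.subset_iUnion S q) (by simpa using hq)
      have h1 := (h q).2.2.isIrreducible (hG l)
        (this ▸ @isIrreducible_singleton _ (jetAtlas f k l).zariski u)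
      rwa [this] at h1
    have hfin' : {i | ¬ vdim f k d (C i) < ((-((l + 1 : ℕ) * d : ℤ) : ℤ) : WithBot (WithTop ℤ)) ∧
        l + 1 ≤ e i}.Finite := (hfin (-((l + 1 : ℕ) * d : ℤ))).subset fun i hi => hi.1
    obtain ⟨w, hw, h⟩ := exists_mem_forall_of_isIrreducible hF
      hfin'.toFinset
      (fun i w => Thin k A (C i) (e i - (l + 1)) (l + 1) w) (fun i hi => by
        have hi' := ((Set.Finite.mem_toFinset _).mp hi).2
        have h1 := hu i (by omega)
        have h2 : e i - l = (e i - (l + 1)) + 1 := by omega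
        rw [h2] at h1
        obtain ⟨D, hD, ⟨w, hwD, hwA, hwu⟩, h3⟩ := h1
        exact ⟨D, hD, ⟨w, hwD, hwA, hwu⟩, fun v hv => h3 v hv.1 hv.2.1 hv.2.2⟩)
    refine ⟨w, hw.2, hw.1, fun i hi => ?_⟩
    by_cases hv : vdim f k d (C i) < ((-((l + 1 : ℕ) * d : ℤ) : ℤ) : WithBot (WithTop ℤ))
    · exact hauto (l + 1) (by omega) w hw.1 i hi hv
    · exact h i ((Set.Finite.mem_toFinset _).mpr ⟨hv, hi⟩)
  obtain ⟨u₀, hu₀⟩ := hstart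
  choose next hnext using fun (l : ℕ) (u : {u : Jets f (j + l) // P (j + l) u}) =>
    hstep (j + l) (Nat.le_add_right j l) u.1 u.2
  let v : ∀ l, {u : Jets f (j + l) // P (j + l) u} := fun l =>
    Nat.rec ⟨u₀, hu₀⟩ (fun l u => ⟨next l u, (hnext l u).2⟩) l
  obtain ⟨γ, hγ⟩ := exists_arc j (fun l => (v l).1) (fun l => (hnext l (v l)).1)
  have hγA : γ ∈ A := by
    rw [hj.mem_iff le_rfl]
    have := hγ 0
    exact this ▸ hu₀.1
  obtain ⟨i, hi⟩ := Set.mem_iUnion.mp (hAC hγA)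
  -- At order `e i` the number of remaining lifts is zero, and thinness says that the jet of the
  -- limit arc is not in the image of `C i`.
  obtain ⟨t, ht⟩ := Nat.exists_eq_add_of_le (hje i)
  have h1 := (v t).2.2 i ht.ge
  rw [ht, Nat.sub_self] at h1
  exact h1 ⟨γ, hi, hγ t⟩

end Thin

/-! ### Measurable sets and the motivic measure -/

section Measurable

/-- `S` is covered by a sequence of stable sets of dimension `< m` whose dimensions tend to `-∞`. -/
def Negligible {O : Type u} [CommRing O] [IsLocalRing O] {X : Scheme.{u}}
    (f : X ⟶ Spec (CommRingCat.of O)) (k : Type u) [Field k] [Algebra k O] (d : ℕ) (m : ℤ)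
    (S : Set (Arcs f)) : Prop :=
  ∃ C : ℕ → Set (Arcs f), (∀ i, IsStable f k d (C i)) ∧ S ⊆ ⋃ i, C i ∧
    (∀ i, vdim f k d (C i) < (m : WithBot (WithTop ℤ))) ∧
    ∀ N : ℤ, ∀ᶠ i in atTop, vdim f k d (C i) < (N : WithBot (WithTop ℤ))

variable {k O : Type u} [Field k] [CommRing O] [IsLocalRing O] [Algebra k O] {X : Scheme.{u}}
  {f : X ⟶ Spec (CommRingCat.of O)} {d : ℕ} {m m' : ℤ} {A A' B B' S T : Set (Arcs f)}

theorem Negligible.mono (h : Negligible f k d m S) (hT : T ⊆ S) (hm : m ≤ m') :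
    Negligible f k d m' T := by
  obtain ⟨C, h1, h2, h3, h4⟩ := h
  refine ⟨C, h1, hT.trans h2, fun i => (h3 i).trans_le ?_, h4⟩
  exact WithBot.coe_le_coe.mpr (WithTop.coe_le_coe.mpr hm)

theorem Negligible.union (hS : Negligible f k d m S) (hT : Negligible f k d m T) :
    Negligible f k d m (S ∪ T) := by
  obtain ⟨C, h1, h2, h3, h4⟩ := hS
  obtain ⟨D, h1', h2', h3', h4'⟩ := hT
  have hall : ∀ p : Set (Arcs f) → Prop, (∀ i, p (C i)) → (∀ i, p (D i)) →
      ∀ i, p (if Even i then C (i / 2) else D (i / 2)) := fun p hC hD i => by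
    split_ifs
    exacts [hC _, hD _]
  -- The two coverings are interleaved, which keeps the dimensions tending to `-∞`.
  refine ⟨fun i => if Even i then C (i / 2) else D (i / 2), hall _ h1 h1', ?_,
    hall (fun S => vdim f k d S < (m : WithBot (WithTop ℤ))) h3 h3', fun N => ?_⟩
  · rintro x (hx | hx)
    · obtain ⟨i, hi⟩ := Set.mem_iUnion.mp (h2 hx)
      refine Set.mem_iUnion.mpr ⟨2 * i, ?_⟩
      rwa [if_pos (even_two_mul i), Nat.mul_div_cancel_left _ two_pos]
    · obtain ⟨i, hi⟩ := Set.mem_iUnion.mp (h2' hx)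
      refine Set.mem_iUnion.mpr ⟨2 * i + 1, ?_⟩
      rwa [if_neg (by simp), show (2 * i + 1) / 2 = i by omega]
  · obtain ⟨a, ha⟩ := eventually_atTop.mp ((h4 N).and (h4' N))
    refine eventually_atTop.mpr ⟨2 * a, fun i hi => ?_⟩
    have := ha (i / 2) (by omega)
    beta_reduce
    split_ifs
    exacts [this.1, this.2]

theorem negligible_empty : Negligible f k d m ∅ := by
  have h : ∀ N : ℤ, vdim f k d (∅ : Set (Arcs f)) < (N : WithBot (WithTop ℤ)) := fun N => by
    rw [vdim, Set.image_empty, Atlas.dim_empty]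
    exact WithBot.bot_lt_coe _
  exact ⟨fun _ => ∅, fun _ => isStable_empty, Set.empty_subset _, fun _ => h m,
    fun N => Eventually.of_forall fun _ => h N⟩

theorem IsStable.approximates (hA : IsStable f k d A) : Approximates f k d m A A :=
  ⟨hA, by rw [symmDiff_self]; exact negligible_empty⟩

variable [IsAlgClosed k] (hG : ∀ n, (jetAtlas f k n).Good)

include hG

theorem Approximates.union (h : Approximates f k d m A B) (h' : Approximates f k d m A' B') :
    Approximates f k d m (A ∪ A') (B ∪ B') := by
  refine ⟨h.1.union hG h'.1, (Negligible.union h.2 h'.2).mono ?_ le_rfl⟩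
  rintro x (⟨h1, h2⟩ | ⟨h1, h2⟩) <;>
    simp only [Set.mem_union, Set.mem_symmDiff] at * <;> tauto

theorem Approximates.diff (h : Approximates f k d m A B) (h' : Approximates f k d m A' B') :
    Approximates f k d m (A \ A') (B \ B') := by
  refine ⟨h.1.diff hG h'.1, (Negligible.union h.2 h'.2).mono ?_ le_rfl⟩
  rintro x (⟨h1, h2⟩ | ⟨h1, h2⟩) <;>
    simp only [Set.mem_union, Set.mem_symmDiff, Set.mem_sdiff] at * <;> tauto

theorem isSetRing_isMeasurable : MeasureTheory.IsSetRing {A | IsMeasurable f k d A} where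
  empty_mem m _ := ⟨∅, isStable_empty.approximates⟩
  union_mem A B hA hB m hm := by
    obtain ⟨A', hA'⟩ := hA m hm
    obtain ⟨B', hB'⟩ := hB m hm
    exact ⟨_, hA'.union hG hB'⟩
  sdiff_mem A B hA hB m hm := by
    obtain ⟨A', hA'⟩ := hA m hm
    obtain ⟨B', hB'⟩ := hB m hm
    exact ⟨_, hA'.diff hG hB'⟩

variable [IsAdicComplete (maximalIdeal O) O]

/-- Stable sets that differ by a negligible set have almost the same measure. -/
theorem stableMeasure_sub_mem_F (hA : IsStable f k d A) (hB : IsStable f k d B)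
    (h : Negligible f k d m (symmDiff A B)) :
    stableMeasure f k d A - stableMeasure f k d B ∈ M.F k m := by
  -- Each half of the symmetric difference is itself stable, so the bound on the dimension of a
  -- covered stable set applies to it.
  have hsmall : ∀ S, IsStable f k d S → S ⊆ symmDiff A B → stableMeasure f k d S ∈ M.F k m := by
    intro S hS hsub
    obtain ⟨C, h1, h2, h3, h4⟩ := h.mono hsub le_rfl
    exact stableMeasure_mem_F hG hS (hS.vdim_lt_of_subset_iUnion hG C h1 h2 h3 h4)
  have hsplit : ∀ {A B : Set (Arcs f)}, IsStable f k d A → IsStable f k d B →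
      stableMeasure f k d A = stableMeasure f k d (A ∩ B) + stableMeasure f k d (A \ B) := by
    intro A B hA hB
    conv_lhs => rw [← Set.inter_union_sdiff A B]
    exact stableMeasure_union hG (hA.inter hG hB) (hA.diff hG hB)
      (Set.disjoint_left.mpr fun x h1 h2 => h2.2 h1.2)
  rw [hsplit hA hB, hsplit hB hA, Set.inter_comm B A, add_sub_add_left_eq_sub]
  exact sub_mem (hsmall _ (hA.diff hG hB) Set.subset_union_left)
    (hsmall _ (hB.diff hG hA) Set.subset_union_right)

/-- The difference of `B` and `B'` is contained in the union of their differences from `A`. This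
gives both the compatibility of the coordinates of the measure and its independence of choices. -/
theorem Approximates.mk_eq {M₀ : ℤ} (h : Approximates f k d m A B) (h' : Approximates f k d m' A B')
    (hm : m ≤ M₀) (hm' : m' ≤ M₀) :
    (QuotientAddGroup.mk (stableMeasure f k d B) : M k ⧸ M.F k M₀) =
      QuotientAddGroup.mk (stableMeasure f k d B') := by
  have h1 : Negligible f k d M₀ (symmDiff B B') := by
    refine ((Negligible.mono h.2 subset_rfl hm).union
      (Negligible.mono h'.2 subset_rfl hm')).mono ?_ le_rfl
    rintro x (⟨h1, h2⟩ | ⟨h1, h2⟩) <;> simp only [Set.mem_union, Set.mem_symmDiff] <;> tauto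
  have h2 := stableMeasure_sub_mem_F hG h.1 h'.1 h1
  rw [QuotientAddGroup.eq]
  have := neg_mem h2
  rwa [neg_sub, sub_eq_neg_add] at this

end Measurable

/-! ### Separation and convergence in the completion -/

section MHat

variable {k : Type u} [Field k]

instance : T2Space (MHat k) := by
  let _ : ∀ m : ℤ, TopologicalSpace (M k ⧸ M.F k m) := fun _ => ⊥
  have : ∀ m : ℤ, DiscreteTopology (M k ⧸ M.F k m) := fun _ => ⟨rfl⟩
  exact T2Space.of_injective_continuous (f := (Subtype.val : MHat k → ∀ m : ℤ, M k ⧸ M.F k m))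
    Subtype.val_injective continuous_induced_dom

theorem tendsto_MHat {ι : Type*} {l : Filter ι} {x : ι → MHat k} {y : MHat k}
    (h : ∀ m, ∀ᶠ i in l, (x i).1 m = y.1 m) : Tendsto x l (𝓝 y) := by
  let _ : ∀ m : ℤ, TopologicalSpace (M k ⧸ M.F k m) := fun _ => ⊥
  have : ∀ m : ℤ, DiscreteTopology (M k ⧸ M.F k m) := fun _ => ⟨rfl⟩
  rw [nhds_induced, tendsto_comap_iff, tendsto_pi_nhds]
  intro m
  rw [nhds_discrete, tendsto_pure]
  exact h m

end MHat

/-! ### The motivic measure -/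

section Measure

variable {k O : Type u} [Field k] [CommRing O] [IsLocalRing O] [Algebra k O] {X : Scheme.{u}}
  (f : X ⟶ Spec (CommRingCat.of O)) (d : ℕ)

/-- A stable set that approximates a measurable set up to dimension `< min m (-1)`. -/
def approximation (A : {A : Set (Arcs f) // IsMeasurable f k d A}) (m : ℤ) : Set (Arcs f) :=
  -- Measurability speaks of negative bounds only, while the completion has a coordinate for every
  -- integer `m`; hence the minimum with `-1`.
  (A.2 (min m (-1)) ((min_le_right _ _).trans_lt (by norm_num))).choose

variable {f d}

theorem approximates_approximation (A : {A : Set (Arcs f) // IsMeasurable f k d A}) (m : ℤ) :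
    Approximates f k d (min m (-1)) A.1 (approximation f d A m) :=
  (A.2 (min m (-1)) ((min_le_right _ _).trans_lt (by norm_num))).choose_spec

variable [IsAlgClosed k] (hG : ∀ n, (jetAtlas f k n).Good) [IsAdicComplete (maximalIdeal O) O]

/-- The motivic measure. -/
def motivicMeasure (A : {A : Set (Arcs f) // IsMeasurable f k d A}) : MHat k :=
  ⟨fun m => QuotientAddGroup.mk (stableMeasure f k d (approximation f d A m)), fun m m' h =>
    ⟨stableMeasure f k d (approximation f d A m), rfl,
      (approximates_approximation A m).mk_eq hG (approximates_approximation A m')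
        ((min_le_left _ _).trans h) (min_le_left _ _)⟩⟩

theorem tendsto_motivicMeasure (A : {A : Set (Arcs f) // IsMeasurable f k d A})
    (B : ℤ → Set (Arcs f)) (hB : ∀ m : ℤ, m < 0 → Approximates f k d m A.1 (B m)) :
    Tendsto (fun m : ℤ => toMHat k (stableMeasure f k d (B m))) atBot
      (𝓝 (motivicMeasure hG A)) := by
  refine tendsto_MHat fun m => ?_
  -- Each coordinate is eventually constant: from `min m (-1)` downwards it has its limiting value.
  filter_upwards [eventually_le_atBot (min m (-1))] with l hl
  exact (hB l (by have := hl.trans (min_le_right _ _); omega)).mk_eq hG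
    (approximates_approximation A m) (hl.trans (min_le_left _ _)) (min_le_left _ _)

/-- A stable set approximates itself to every order, so its measure is the limit of a constant
family. -/
theorem motivicMeasure_of_isStable {A : {A : Set (Arcs f) // IsMeasurable f k d A}}
    (hA : IsStable f k d A.1) :
    motivicMeasure hG A = toMHat k (stableMeasure f k d A.1) :=
  tendsto_nhds_unique (tendsto_motivicMeasure hG A (fun _ => A.1) fun _ _ => hA.approximates)
    tendsto_const_nhds

theorem motivicMeasure_union (A B C : {A : Set (Arcs f) // IsMeasurable f k d A})
    (hAB : Disjoint A.1 B.1) (hC : C.1 = A.1 ∪ B.1) :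
    motivicMeasure hG C = motivicMeasure hG A + motivicMeasure hG B := by
  apply Subtype.ext
  ext m
  have hA := approximates_approximation A m
  have hB := approximates_approximation B m
  have hU := hA.union hG hB
  rw [← hC] at hU
  have h1 := (approximates_approximation C m).mk_eq hG hU (min_le_left m _) (min_le_left m _)
  set a := approximation f d A m
  set b := approximation f d B m
  -- The approximations of disjoint sets may overlap, but only in a negligible set, so `b` may be
  -- replaced by `b \ a` before additivity on stable sets is used.
  have h2 : Approximates f k d (min m (-1)) b (b \ a) := by
    refine ⟨hB.1.diff hG hA.1, (Negligible.union hA.2 hB.2).mono ?_ le_rfl⟩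
    rintro x (⟨h1, h2⟩ | ⟨h1, h2⟩)
    · have hxa : x ∈ a := by by_contra h; exact h2 ⟨h1, h⟩
      by_cases hxA : x ∈ A.1
      · exact Or.inr (Or.inr ⟨h1, fun hxB => Set.disjoint_left.mp hAB hxA hxB⟩)
      · exact Or.inl (Or.inr ⟨hxa, hxA⟩)
    · exact absurd h1.1 h2
  have h3 := (hB.1.approximates (m := m)).mk_eq hG h2 le_rfl (min_le_left m (-1))
  have h4 := stableMeasure_union hG hA.1 (hB.1.diff hG hA.1) Set.disjoint_sdiff_right
  rw [Set.union_sdiff_self] at h4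
  refine h1.trans ?_
  rw [h4, QuotientAddGroup.mk_add, ← h3]
  rfl

end Measure

end Motivic

end

/-! ### The proposition -/

theorem proposition2p1 {k O : Type u} [Field k] [IsAlgClosed k] [CharZero k]
    [CommRing O] [IsDomain O] [IsDiscreteValuationRing O] [IsAdicComplete (maximalIdeal O) O]
    [Algebra k O] (hk : Function.Bijective (algebraMap k (ResidueField O)))
    {X : Scheme.{u}} (f : X ⟶ Spec (CommRingCat.of O)) (d : ℕ)
    (hX : Motivic.IsDVariety f) (hd : Motivic.HasPureRelativeDimension f d) :
    MeasureTheory.IsSetRing {A : Set (Motivic.Arcs f) | Motivic.IsMeasurable f k d A} ∧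
    ∃ μ : {A : Set (Motivic.Arcs f) // Motivic.IsMeasurable f k d A} → Motivic.MHat k,
      (∀ (A : {A : Set (Motivic.Arcs f) // Motivic.IsMeasurable f k d A})
        (B : ℤ → Set (Motivic.Arcs f)),
        (∀ m : ℤ, m < 0 → Motivic.Approximates f k d m A.1 (B m)) →
        Tendsto (fun m : ℤ => Motivic.toMHat k (Motivic.stableMeasure f k d (B m)))
          atBot (𝓝 (μ A)) ∧
        ∀ x : Motivic.MHat k,
          Tendsto (fun m : ℤ => Motivic.toMHat k (Motivic.stableMeasure f k d (B m)))
            atBot (𝓝 x) → x = μ A) ∧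
      (∀ A : Set (Motivic.Arcs f), Motivic.IsStable f k d A →
        ∃ hA : Motivic.IsMeasurable f k d A,
          μ ⟨A, hA⟩ = Motivic.toMHat k (Motivic.stableMeasure f k d A)) ∧
      (∀ A B C : {A : Set (Motivic.Arcs f) // Motivic.IsMeasurable f k d A},
        Disjoint A.1 B.1 → C.1 = A.1 ∪ B.1 → μ C = μ A + μ B) := by
  have := hX.locallyOfFiniteType
  have := hX.quasiCompact
  have hG := Motivic.good_jetAtlas hk f
  refine ⟨Motivic.isSetRing_isMeasurable hG, Motivic.motivicMeasure hG, fun A B hB => ?_,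
    fun A hA => ?_, Motivic.motivicMeasure_union hG⟩
  · have hlim := Motivic.tendsto_motivicMeasure hG A B hB
    exact ⟨hlim, fun x hx => tendsto_nhds_unique hx hlim⟩
  · have hm : Motivic.IsMeasurable f k d A := fun m _ => ⟨A, hA.approximates⟩
    exact ⟨hm, Motivic.motivicMeasure_of_isStable hG (A := ⟨A, hm⟩) hA⟩
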